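/- **Setting.** Fix $d\ge 3$. A *model* consists of a set $B$ of bodies, sets $IOb\subseteq Ob\subseteq B$ (inertial observers, observers) and $Ph\subseteq B$ (photons), an ordered field $Q$ of quantities, disjoint from $B$, and a worldview relation $W\subseteq Ob\times B\times Q^d$. For $p=(p_1,\dots,p_d)\in Q^d$ put $p_\tau=p_1$ and $p_\sigma=(p_2,\dots,p_d)$; $|\cdot|$ is Euclidean length. A vector $r$ is *spacelike* if $|r_\sigma|>|r_\tau|$. The signed Minkowski length is $\mu(p)=\sqrt{p_\tau^2-|p_\sigma|^2}$ if $p_\tau^2\ge|p_\sigma|^2$, and $\mu(p)=-\sqrt{|p_\sigma|^2-p_\tau^2}$ otherwise. Let $ev_m(p)=\{b: W(m,b,p)\}$, $Cd_m=\{p: ev_m(p)\ne\emptyset\}$, $Ev_m=\{ev_m(p):p\in Cd_m\}$, $Ev=\bigcup_{m\in Ob}Ev_m$ (the elements of $Ev$ are the *events*), and $wl_m(b)=\{p: W(m,b,p)\}$. If there is exactly one $p$ with $ev_m(p)=e$, it is denoted $loc_m(e)$. Put $time_m(e,e')=|loc_m(e)_\tau-loc_m(e')_\tau|$ and $dist_m(e,e')=|loc_m(e)_\sigma-loc_m(e')_\sigma|$;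 an equation or inequality between such terms asserts in particular that they are defined. The worldview transformation is the relation $w^k_m=\{(p,q): ev_k(p)=ev_m(q)\neq\emptyset\}$. Observer $m$ is *co-moving* with $k$ at $q$ if $q\in\mathrm{Dom}\,w^k_m$ and for every $\varepsilon>0$ there is $\delta>0$ such that for all $p\in \mathrm{Dom}\,w^k_m$ with $|p-q|<\delta$ the value $w^k_m(p)$ is unique and $|w^k_m(p)-p|\le\varepsilon|p-q|$. **AccRel** consists of the following axioms. * AxEOF: positive elements of $Q$ have square roots. * AxSelf$_0$: for $m\in Ob$, $m\in ev_m(p)$ iff $p\in Cd_m$ and $p_\sigma=0$. * AxSelf$_0^+$: for $k\in Ob$, the set $\{p_\tau: k\in ev_k(p)\}$ is convex and has at least two elements. * AxPh: for $m\in IOb$ and all $p,q\in Q^d$, $|p_\sigma-q_\sigma|=|p_\tau-q_\tau|$ iff some photon is in $ev_m(p)\cap ev_m(q)$. * AxEv: $Ev_m=Ev_k$ for $m,k\in IOb$. * AxEvTr: if $m\in Ob$ and $m\in e\in Ev$, then $e\in Ev_m$. * AxSymDist: if $m,k\in IOb$ and $e_1,e_2\in Ev_m\cap Ev_k$ are simultaneous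 for both $m$ and $k$ (that is, each of them observes $e_1$ and $e_2$ at points with the same time component), then $dist_m(e_1,e_2)=dist_k(e_1,e_2)$. * AxCmv: if $k\in Ob$ and $k\in ev_k(q)$, some inertial observer is co-moving with $k$ at $q$. * CONT (a schema): every nonempty bounded subset of $Q$ that is first-order definable with parameters in the language with $B,Ob,IOb,Ph,Q,+,\cdot,<,W$ has a supremum. **Acceleration.** The life-curve of $k$ according to $m$ is $lc^k_m=\{(t,p): \exists q\; k\in ev_k(q)=ev_m(p),\ q_\tau=t\}$. The relative acceleration $a^k_m$ of $k$ according to $m$ is the second derivative of $lc^k_m$ (with $\varepsilon$-$\delta$ derivatives over $Q$, relative to the domain of the curve). Observer $k$ is *positively accelerated* if for each $t\in\mathrm{Dom}\,lc^k_k$ the acceleration $-\mu(a^k_m(t))$, which is to be defined and the same for all $m\in IOb$, is positive. **Radar spaceships.** An event $e$ is at radar distance $r>0$ from $k$ if there are events $e_1,e_2\ni k$ with $time_k(e_1,e_2)=2r$, a photon in $e\cap e_1$ and a photon in $e\cap e_2$; it is at radar distance $0$ if $k\in e$. Observers $b,k,c$ form a *radar spaceship* $\langle b,k,c\rangle$ if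 for some inertial observer $m$ the set $wl_m(b)\cup wl_m(k)\cup wl_m(c)$ lies in a vertical plane (a plane parallel to the time-axis), and if there are $r_b,r_c$ such that all events in which $b$ (respectively $c$) participates are at radar distance $r_b$ (respectively $r_c$) from $k$. *The direction of the spaceship is the same as that of the acceleration of $k$* if for every inertial observer $m$ according to whom the three world-lines lie in a common vertical plane, for all $t\in\mathrm{Dom}\,a^k_m$ and all $p\in wl_m(c)$, $q\in wl_m(b)$ with $p-q$ spacelike, $a^k_m(t)$ is spacelike and $\lambda\, a^k_m(t)_\sigma=(p-q)_\sigma$ for some $\lambda>0$. **Simultaneity.** Events $e_1,e_2$ are *radar simultaneous* for $k$ if there is an event $e\ni k$ such that for each $i\in\{1,2\}$ there are events $\hat e_i,\tilde e_i\ni k$, a photon in $e_i\cap\hat e_i$ and a photon in $e_i\cap\tilde e_i$, with $time_k(e,\hat e_i)=time_k(e,\tilde e_i)$ and ($\hat e_i\ne\tilde e_i$ or $e_i=e$). Event $e_1$ *precedes* $e$ according to $k$ if $loc_m(e_1)_\tau\le loc_m(e)_\tau$ for every inertial $m$ that is co-moving with $k$ at some $q$ with $k\in ev_k(q)$. Events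 $e_1,e_2$ are *photon simultaneous* for $k$ if there are an event $e\ni k$, a photon in $e\cap e_1$ and a photon in $e\cap e_2$, and $e_1$ and $e_2$ precede $e$ according to $k$. *The clock of $b$ runs slower than the clock of $c$* with respect to a relation $\sim$ if $time_b(e_b,\bar e_b)<time_c(e_c,\bar e_c)$ for all events $e_b,\bar e_b\ni b$ and $e_c,\bar e_c\ni c$ with $e_b\sim e_c$, $\bar e_b\sim\bar e_c$ and $(e_b,e_c)\ne(\bar e_b,\bar e_c)$. **Theorem.** Let $d\ge3$ and assume AccRel. Let $\langle b,k,c\rangle$ be a radar spaceship such that (i) $k$ is positively accelerated, (ii) the direction of the spaceship is the same as that of the acceleration of $k$, and (iii) $b$ and $c$ never meet (no event contains both). Then: 1. the clock of $b$ runs slower than the clock of $c$ with respect to radar simultaneity for $k$ (as seen by $k$ by radar); 2. the clock of $b$ runs slower than the clock of $c$ with respect to photon simultaneity for each of $k$, $b$ and $c$ (as seen by each of them by photons). -/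

import Mathlib

universe u v

/-- The nonnegative square root of a quantity; it is `0` if there is none (this does not happen for
nonnegative arguments in a Euclidean ordered field). -/
noncomputable def qsqrt {Q : Type v} [Field Q] [LinearOrder Q] (x : Q) : Q :=
  open Classical in if h : ∃ y : Q, 0 ≤ y ∧ y * y = x then h.choose else 0

theorem qsqrt_spec {Q : Type v} [Field Q] [LinearOrder Q] {x : Q}
    (h : ∃ y : Q, 0 ≤ y ∧ y * y = x) : 0 ≤ qsqrt x ∧ qsqrt x * qsqrt x = x := by
  unfold qsqrt
  rw [dif_pos h]
  exact h.choose_spec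

/-- Coordinate points of a spacetime of dimension `n + 1`: the entry with index `0` is the time
component, the entries with index `i.succ` form the space component. -/
abbrev Coord (n : ℕ) (Q : Type v) : Type v := Fin (n + 1) → Q

section Geometry

variable {n : ℕ} {Q : Type v} [Field Q] [LinearOrder Q]

/-- Euclidean length. -/
noncomputable def euclLen (p : Coord n Q) : Q := qsqrt (∑ i, p i ^ 2)

/-- Euclidean length of the space component. -/
noncomputable def spaceLen (p : Coord n Q) : Q := qsqrt (∑ i : Fin n, p i.succ ^ 2)

def Spacelike (p : Coord n Q) : Prop := |p 0| < spaceLen p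

/-- The signed Minkowski length. -/
noncomputable def minkLen (p : Coord n Q) : Q :=
  if ∑ i : Fin n, p i.succ ^ 2 ≤ p 0 ^ 2 then qsqrt (p 0 ^ 2 - ∑ i : Fin n, p i.succ ^ 2)
  else -qsqrt ((∑ i : Fin n, p i.succ ^ 2) - p 0 ^ 2)

/-- Two spacelike vectors have the same direction: their space components are positive multiples of
each other. -/
def SameDirection (p q : Coord n Q) : Prop :=
  Spacelike p ∧ Spacelike q ∧ ∃ l : Q, 0 < l ∧ ∀ i : Fin n, l * p i.succ = q i.succ

/-- A plane that is parallel to the time-axis. -/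
def IsVerticalPlane (P : Set (Coord n Q)) : Prop :=
  ∃ o w : Coord n Q, (∃ i : Fin n, w i.succ ≠ 0) ∧
    P = {p | ∃ s x : Q, p = o + s • (Pi.single 0 1 : Coord n Q) + x • w}

/-- The derivative `F'` of a partial function `F` from `Q` to `Q^d`, both as binary relations: `F'`
relates `t` in the domain of `F` to the derivative vectors of `F` at `t`. -/
def derivRel (F : Set (Q × Coord n Q)) : Set (Q × Coord n Q) :=
  {a | ∃ y, (a.1, y) ∈ F ∧ ∀ ε : Q, 0 < ε → ∃ δ : Q, 0 < δ ∧ ∀ x z, (x, z) ∈ F → |x - a.1| < δ →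
    euclLen (z - y - (x - a.1) • a.2) ≤ ε * |x - a.1|}

end Geometry

/-- The data of a model of the frame language for spacetime dimension `n + 1`: bodies `B`, observers,
inertial observers, photons and the worldview relation `W m b p` (observer `m` coordinatizes body `b`
at the coordinate point `p`). The field structure and the order of the quantities are those of `Q`. -/
structure WorldModel (n : ℕ) (B : Type u) (Q : Type v) where
  Ob : Set B
  IOb : Set B
  Ph : Set B
  W : B → B → Coord n Q → Prop
  iob_sub_ob : IOb ⊆ Ob
  w_ob : ∀ m b p, W m b p → m ∈ Ob

/-- The relation symbols of the frame language. The field operations act on quantities only and are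
represented by their graphs. -/
inductive FrameRel (n : ℕ) : ℕ → Type
  | body : FrameRel n 1
  | observer : FrameRel n 1
  | inertial : FrameRel n 1
  | photon : FrameRel n 1
  | quantity : FrameRel n 1
  | add : FrameRel n 3
  | mul : FrameRel n 3
  | lt : FrameRel n 2
  | world : FrameRel n (n + 3)

/-- The first-order frame language. -/
def frameLang (n : ℕ) : FirstOrder.Language := ⟨fun _ => Empty, FrameRel n⟩

namespace WorldModel

variable {n : ℕ} {B : Type u} {Q : Type v}

/-- The universe of a model: all bodies and all quantities. -/
inductive Univ {n : ℕ} {B : Type u} {Q : Type v} (M : WorldModel n B Q) : Type (max u v)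
  | body (b : B) : Univ M
  | qty (q : Q) : Univ M

section Language

variable [Field Q] [LinearOrder Q]

/-- Interpretation of the relation symbols. -/
def interp (M : WorldModel n B Q) : {r : ℕ} → FrameRel n r → (Fin r → M.Univ) → Prop
  | _, .body, x => ∃ b, x 0 = Univ.body b
  | _, .observer, x => ∃ b ∈ M.Ob, x 0 = Univ.body b
  | _, .inertial, x => ∃ b ∈ M.IOb, x 0 = Univ.body b
  | _, .photon, x => ∃ b ∈ M.Ph, x 0 = Univ.body b
  | _, .quantity, x => ∃ q, x 0 = Univ.qty q
  | _, .add, x => ∃ p q, x 0 = Univ.qty p ∧ x 1 = Univ.qty q ∧ x 2 = Univ.qty (p + q)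
  | _, .mul, x => ∃ p q, x 0 = Univ.qty p ∧ x 1 = Univ.qty q ∧ x 2 = Univ.qty (p * q)
  | _, .lt, x => ∃ p q, x 0 = Univ.qty p ∧ x 1 = Univ.qty q ∧ p < q
  | _, .world, x => ∃ m b p, x 0 = Univ.body m ∧ x 1 = Univ.body b ∧
      (∀ i : Fin (n + 1), x i.succ.succ = Univ.qty (p i)) ∧ M.W m b p

instance instStructure (M : WorldModel n B Q) : (frameLang n).Structure M.Univ where
  funMap f := f.elim
  RelMap r x := M.interp r x

/-- A set of quantities that is first-order definable with parameters in the frame language. -/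
def DefinableSet (M : WorldModel n B Q) (S : Set Q) : Prop :=
  Set.Definable₁ (Set.univ : Set M.Univ) (frameLang n) {x : M.Univ | ∃ a ∈ S, x = Univ.qty a}

end Language

/-! ### Events -/

/-- The event observed by `m` at `p`. -/
def ev (M : WorldModel n B Q) (m : B) (p : Coord n Q) : Set B := {b | M.W m b p}

/-- The nonempty events coordinatized by `m`. -/
def EvOf (M : WorldModel n B Q) (m : B) : Set (Set B) := {e | (∃ p, M.ev m p = e) ∧ e.Nonempty}

/-- All observed events. -/
def Ev (M : WorldModel n B Q) : Set (Set B) := {e | ∃ m ∈ M.Ob, e ∈ M.EvOf m}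

/-- The coordinate-domain of `m`. -/
def Cd (M : WorldModel n B Q) (m : B) : Set (Coord n Q) := {p | (M.ev m p).Nonempty}

/-- The world-line of `b` according to `m`. -/
def wl (M : WorldModel n B Q) (m b : B) : Set (Coord n Q) := {p | M.W m b p}

/-- The worldview transformation from the coordinates of `k` to those of `m`, as a relation. -/
def wvt (M : WorldModel n B Q) (k m : B) : Set (Coord n Q × Coord n Q) :=
  {a | M.ev k a.1 = M.ev m a.2 ∧ (M.ev k a.1).Nonempty}

/-- `p` is the location of `e` according to `m`: the unique coordinate point where `m` observes `e`. -/
def IsLoc (M : WorldModel n B Q) (m : B) (e : Set B) (p : Coord n Q) : Prop :=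
  M.ev m p = e ∧ ∀ q, M.ev m q = e → q = p

/-- `e₁` and `e₂` are simultaneous for `m`. -/
def Simul (M : WorldModel n B Q) (m : B) (e₁ e₂ : Set B) : Prop :=
  ∃ p q, M.ev m p = e₁ ∧ M.ev m q = e₂ ∧ p 0 = q 0

/-- The life-curve of `k` according to `m`: the world-line of `k` according to `m` parametrized by the
time measured by `k`. -/
def lifeCurve (M : WorldModel n B Q) (m k : B) : Set (Q × Coord n Q) :=
  {a | ∃ q, k ∈ M.ev k q ∧ M.ev k q = M.ev m a.2 ∧ q 0 = a.1}

section Kinematics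

variable [Field Q] [LinearOrder Q]

/-- The time elapsed between `e₁` and `e₂` according to `m` is defined and equals `x`. -/
def Elapsed (M : WorldModel n B Q) (m : B) (e₁ e₂ : Set B) (x : Q) : Prop :=
  ∃ p q, M.IsLoc m e₁ p ∧ M.IsLoc m e₂ q ∧ x = |p 0 - q 0|

/-- The spatial distance of `e₁` and `e₂` according to `m` is defined and equals `x`. -/
def SpatialDist (M : WorldModel n B Q) (m : B) (e₁ e₂ : Set B) (x : Q) : Prop :=
  ∃ p q, M.IsLoc m e₁ p ∧ M.IsLoc m e₂ q ∧ x = spaceLen (p - q)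

/-- `m` is a co-moving observer of `k` at `q`. -/
def CoMoving (M : WorldModel n B Q) (m k : B) (q : Coord n Q) : Prop :=
  (∃ q', (q, q') ∈ M.wvt k m) ∧
  ∀ ε : Q, 0 < ε → ∃ δ : Q, 0 < δ ∧ ∀ p, euclLen (p - q) < δ → (∃ p', (p, p') ∈ M.wvt k m) →
    ∃ p', (p, p') ∈ M.wvt k m ∧ (∀ p'', (p, p'') ∈ M.wvt k m → p'' = p') ∧
      euclLen (p' - p) ≤ ε * euclLen (p - q)

/-! ### The axioms -/

/-- Positive quantities have square roots. -/
def AxEOF (_M : WorldModel n B Q) : Prop := ∀ x : Q, 0 < x → ∃ y : Q, y * y = x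

/-- An observer coordinatizes itself exactly on the part of the time-axis in its coordinate domain. -/
def AxSelf0 (M : WorldModel n B Q) : Prop :=
  ∀ m ∈ M.Ob, ∀ p, m ∈ M.ev m p ↔ p ∈ M.Cd m ∧ ∀ i : Fin n, p i.succ = 0

/-- The set of time-instances in which an observer encounters an event is connected and has at least
two elements. -/
def AxSelf0Plus (M : WorldModel n B Q) : Prop :=
  ∀ k ∈ M.Ob, (∃ p q : Coord n Q, p 0 ≠ q 0 ∧ k ∈ M.ev k p ∩ M.ev k q) ∧
    Set.OrdConnected {t : Q | ∃ r, k ∈ M.ev k r ∧ r 0 = t}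

/-- For inertial observers, there is a photon through two points iff their slope is `1`. -/
def AxPh (M : WorldModel n B Q) : Prop :=
  ∀ m ∈ M.IOb, ∀ p q : Coord n Q,
    spaceLen (p - q) = |p 0 - q 0| ↔ (M.Ph ∩ M.ev m p ∩ M.ev m q).Nonempty

/-- Inertial observers coordinatize the same events. -/
def AxEv (M : WorldModel n B Q) : Prop := ∀ m ∈ M.IOb, ∀ k ∈ M.IOb, M.EvOf m = M.EvOf k

/-- Every observer encounters the events in which it has been observed. -/
def AxEvTr (M : WorldModel n B Q) : Prop := ∀ m ∈ M.Ob, ∀ e ∈ M.Ev, m ∈ e → e ∈ M.EvOf m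

/-- Inertial observers agree on the spatial distance of events simultaneous for both of them. -/
def AxSymDist (M : WorldModel n B Q) : Prop :=
  ∀ m ∈ M.IOb, ∀ k ∈ M.IOb, ∀ e₁ ∈ M.EvOf m ∩ M.EvOf k, ∀ e₂ ∈ M.EvOf m ∩ M.EvOf k,
    M.Simul m e₁ e₂ → M.Simul k e₁ e₂ → ∃ x, M.SpatialDist m e₁ e₂ x ∧ M.SpatialDist k e₁ e₂ x

/-- At each event encountered by an observer there is a co-moving inertial observer. -/
def AxCmv (M : WorldModel n B Q) : Prop :=
  ∀ k ∈ M.Ob, ∀ q, k ∈ M.ev k q → ∃ m ∈ M.IOb, M.CoMoving m k q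

/-- The continuity schema: every definable, nonempty and bounded set of quantities has a supremum. -/
def CONT (M : WorldModel n B Q) : Prop :=
  ∀ S : Set Q, M.DefinableSet S → S.Nonempty → BddAbove S → ∃ s, IsLUB S s

/-- The theory of accelerated observers. -/
structure AccRel (M : WorldModel n B Q) : Prop where
  axEOF : M.AxEOF
  axSelf0 : M.AxSelf0
  axSelf0Plus : M.AxSelf0Plus
  axPh : M.AxPh
  axEv : M.AxEv
  axEvTr : M.AxEvTr
  axSymDist : M.AxSymDist
  axCmv : M.AxCmv
  cont : M.CONT

/-! ### Acceleration -/

/-- The relative velocity of `k` according to `m`, as a relation between instants and vectors. -/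
def relVelocity (M : WorldModel n B Q) (m k : B) : Set (Q × Coord n Q) := derivRel (M.lifeCurve m k)

/-- The relative acceleration of `k` according to `m`. -/
def relAcceleration (M : WorldModel n B Q) (m k : B) : Set (Q × Coord n Q) :=
  derivRel (M.relVelocity m k)

/-- The acceleration of `k` at the instant `t` is defined and equals `x`. -/
def Acceleration (M : WorldModel n B Q) (k : B) (t x : Q) : Prop :=
  ∀ m ∈ M.IOb, ∃ a, (t, a) ∈ M.relAcceleration m k ∧ x = -minkLen a

def PositivelyAccelerated (M : WorldModel n B Q) (k : B) : Prop :=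
  ∀ t, (∃ p, (t, p) ∈ M.lifeCurve k k) → ∃ x, M.Acceleration k t x ∧ 0 < x

/-! ### Spaceships -/

/-- Event `e` is at radar distance `r` from observer `k`. -/
def RadarDist (M : WorldModel n B Q) (k : B) (e : Set B) (r : Q) : Prop :=
  (r = 0 ∧ k ∈ e) ∨
  (0 < r ∧ ∃ e₁ ∈ M.Ev, ∃ e₂ ∈ M.Ev, ∃ ph₁ ∈ M.Ph, ∃ ph₂ ∈ M.Ph,
    k ∈ e₁ ∩ e₂ ∧ ph₁ ∈ e ∩ e₁ ∧ ph₂ ∈ e ∩ e₂ ∧ M.Elapsed k e₁ e₂ (2 * r))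

/-- `b` is at constant radar distance from `k` according to `k`. -/
def ConstRadarDist (M : WorldModel n B Q) (k b : B) : Prop :=
  ∃ r, ∀ e ∈ M.Ev, b ∈ e → M.RadarDist k e r

/-- In the coordinate system of `m`, the world-lines of `b`, `k`, `c` lie in one vertical plane. -/
def CoplanarFor (M : WorldModel n B Q) (m b k c : B) : Prop :=
  ∃ P, IsVerticalPlane P ∧ M.wl m b ∪ M.wl m k ∪ M.wl m c ⊆ P

structure RadarSpaceship (M : WorldModel n B Q) (b k c : B) : Prop where
  rear_ob : b ∈ M.Ob
  mid_ob : k ∈ M.Ob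
  front_ob : c ∈ M.Ob
  coplanar : ∃ m ∈ M.IOb, M.CoplanarFor m b k c
  rear_dist : M.ConstRadarDist k b
  front_dist : M.ConstRadarDist k c

/-- The direction of the spaceship (from `b` to `c`) is the same as that of the acceleration of `k`,
in the coordinate systems of the inertial observers for which the spaceship moves in a vertical
plane. -/
def DirectionOfAcceleration (M : WorldModel n B Q) (b k c : B) : Prop :=
  ∀ m ∈ M.IOb, M.CoplanarFor m b k c → ∀ t a, (t, a) ∈ M.relAcceleration m k →
    ∀ p ∈ M.Cd m, ∀ q ∈ M.Cd m, c ∈ M.ev m p → b ∈ M.ev m q → Spacelike (p - q) →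
      SameDirection a (p - q)

/-! ### Simultaneity and clocks -/

/-- `e₁` precedes `e₂` according to `k`: it is not later for any inertial observer that is co-moving
with `k` at some point of the life of `k`. -/
def Precedes (M : WorldModel n B Q) (k : B) (e₁ e₂ : Set B) : Prop :=
  ∀ m ∈ M.IOb, (∃ q, k ∈ M.ev k q ∧ M.CoMoving m k q) →
    ∃ p₁ p₂, M.IsLoc m e₁ p₁ ∧ M.IsLoc m e₂ p₂ ∧ p₁ 0 ≤ p₂ 0

/-- The part of radar simultaneity that concerns one event: according to `k`, the event `e'` is
connected by photons with two events of the life of `k` that are equally far in time from the event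
`e` of the life of `k`. -/
def RadarAt (M : WorldModel n B Q) (k : B) (e e' : Set B) : Prop :=
  ∃ f ∈ M.Ev, ∃ g ∈ M.Ev, ∃ ph ∈ M.Ph, ∃ ph' ∈ M.Ph,
    k ∈ f ∧ k ∈ g ∧ ph ∈ e' ∩ f ∧ ph' ∈ e' ∩ g ∧ (g ≠ f ∨ e' = e) ∧
    ∃ x, M.Elapsed k e f x ∧ M.Elapsed k e g x

/-- `e₁` and `e₂` are radar simultaneous for `k`. -/
def RadarSimul (M : WorldModel n B Q) (k : B) (e₁ e₂ : Set B) : Prop :=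
  ∃ e ∈ M.Ev, k ∈ e ∧ M.RadarAt k e e₁ ∧ M.RadarAt k e e₂

/-- `e₁` and `e₂` are photon simultaneous for `k`. -/
def PhotonSimul (M : WorldModel n B Q) (k : B) (e₁ e₂ : Set B) : Prop :=
  ∃ e ∈ M.Ev, ∃ ph₁ ∈ M.Ph, ∃ ph₂ ∈ M.Ph, k ∈ e ∧ ph₁ ∈ e ∩ e₁ ∧ ph₂ ∈ e ∩ e₂ ∧
    M.Precedes k e₁ e ∧ M.Precedes k e₂ e

/-- The clock of `b` runs slower than the clock of `c` with respect to a simultaneity relation: between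
any two different pairs of simultaneous events of their lives, `b` measures less time than `c`. -/
def RunsSlower (M : WorldModel n B Q) (sim : Set B → Set B → Prop) (b c : B) : Prop :=
  ∀ eb ∈ M.Ev, ∀ eb' ∈ M.Ev, ∀ ec ∈ M.Ev, ∀ ec' ∈ M.Ev,
    b ∈ eb ∩ eb' → c ∈ ec ∩ ec' → sim eb ec → sim eb' ec' → ¬(eb = eb' ∧ ec = ec') →
      ∃ x y, M.Elapsed b eb eb' x ∧ M.Elapsed c ec ec' y ∧ x < y

end Kinematics

end WorldModel

/-! Inertial observers. By `AxPh` and `AxEv` the worldview transformation between two of them is a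
bijection that preserves lightlikeness in both directions. An Alexandrov–Zeeman argument over the
ordered field Q makes it additive up to translation. `AxSymDist` then excludes a nontrivial action
on scalars and a conformal factor, so it is a Poincaré transformation (`AccRel.poincare`). With
`AxCmv` every observer gets a velocity of Minkowski square 1 with respect to its own time
(`AccRel.exists_velocity`).

The plane. The spaceship moves in a Minkowski plane with light coordinates u, v, oriented so that
both increase along k. The life of k is s ↦ (U s, V s) with U' V' = 1. The event at radar time s and
signed radar distance ρ is (U (s - ρ), V (s + ρ)). By connectedness, constant radar distance means
constant ρ (`PlaneLife.exists_signed_distance`), and a clock kept at ρ has the rate √(U' (s - ρ) V'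
(s + ρ)) = √(V' (s + ρ) / V' (s - ρ)) with respect to s (`PlaneLife.exists_clock`).

The comparison. Let ρb < ρc; the other case is its mirror image. Acceleration towards c makes V'
strictly increasing. Compare b at s with c at s + α, where |α| ≤ ρc - ρb. Then s + α + ρc ≥ s + ρb
and s + α - ρc ≤ s - ρb, with at most one equality, so c has the greater rate
(`PlaneLife.clock_lt`). Each simultaneity of the theorem is such a constant offset: α = 0 for radar,
±(|ρb| - |ρc|) for photons seen by k, and ±|ρb - ρc| for photons seen by b or c. Hence all four
claims are instances of `ShipFrame.runsSlower`.

Q need not be complete: `CONT` gives suprema of definable sets only. Intermediate values,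
monotonicity and the Darboux property are proved for definable functions, and every function used is
shown to be definable. -/

set_option linter.unusedSectionVars false

/-! ### Minkowski form and lightlike vectors. -/

section MinkowskiForm

variable {n : ℕ} {Q : Type v} [Field Q]

/-- The Minkowski bilinear form. -/
def mb (p q : Coord n Q) : Q := p 0 * q 0 - ∑ i : Fin n, p i.succ * q i.succ

/-- The Minkowski quadratic form. -/
def mq (p : Coord n Q) : Q := p 0 ^ 2 - ∑ i : Fin n, p i.succ ^ 2

theorem mq_eq_mb (p : Coord n Q) : mq p = mb p p := by
  simp [mq, mb, sq]

theorem mb_comm (p q : Coord n Q) : mb p q = mb q p := by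
  simp [mb, mul_comm]

theorem mb_add_left (p q r : Coord n Q) : mb (p + q) r = mb p r + mb q r := by
  simp only [mb, Pi.add_apply, add_mul, Finset.sum_add_distrib]; ring

theorem mb_smul_left (c : Q) (p r : Coord n Q) : mb (c • p) r = c * mb p r := by
  simp only [mb, Pi.smul_apply, smul_eq_mul, mul_sub, Finset.mul_sum, mul_assoc]

theorem mb_add_right (p q r : Coord n Q) : mb r (p + q) = mb r p + mb r q := by
  rw [mb_comm, mb_add_left, mb_comm p, mb_comm q]

theorem mb_smul_right (c : Q) (p r : Coord n Q) : mb r (c • p) = c * mb r p := by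
  rw [mb_comm, mb_smul_left, mb_comm p]

theorem mb_sub_left (p q r : Coord n Q) : mb (p - q) r = mb p r - mb q r := by
  rw [sub_eq_add_neg, ← neg_one_smul Q q, mb_add_left, mb_smul_left]; ring

theorem mb_sub_right (p q r : Coord n Q) : mb r (p - q) = mb r p - mb r q := by
  rw [mb_comm, mb_sub_left, mb_comm p, mb_comm q]

theorem mq_add (p q : Coord n Q) : mq (p + q) = mq p + mq q + 2 * mb p q := by
  simp only [mq_eq_mb, mb_add_left, mb_add_right, mb_comm q p]; ring

theorem mq_sub (p q : Coord n Q) : mq (p - q) = mq p + mq q - 2 * mb p q := by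
  simp only [mq_eq_mb, mb_sub_left, mb_sub_right, mb_comm q p]; ring

theorem mq_smul (c : Q) (p : Coord n Q) : mq (c • p) = c ^ 2 * mq p := by
  simp only [mq_eq_mb, mb_smul_left, mb_smul_right]; ring

theorem mq_zero : mq (0 : Coord n Q) = 0 := by simp [mq]

end MinkowskiForm

section Light

variable {n : ℕ} {Q : Type v} [Field Q] [LinearOrder Q] [IsStrictOrderedRing Q]

theorem time_ne_zero_of_lightlike {a : Coord n Q} (ha : mq a = 0) (ha0 : a ≠ 0) : a 0 ≠ 0 := by
  intro h
  apply ha0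
  have hs : ∑ i : Fin n, a i.succ ^ 2 = 0 := by
    simp only [mq, h] at ha
    linarith
  rw [Finset.sum_eq_zero_iff_of_nonneg (fun i _ => sq_nonneg _)] at hs
  funext i
  refine Fin.cases h (fun j => ?_) i
  have := hs j (Finset.mem_univ j)
  simpa using this

/-- Orthogonal lightlike vectors are parallel. -/
theorem lightlike_parallel {a b : Coord n Q} (ha : mq a = 0) (ha0 : a ≠ 0) (hb : mq b = 0)
    (hab : mb a b = 0) : ∃ l : Q, b = l • a := by
  have h0 := time_ne_zero_of_lightlike ha ha0
  refine ⟨b 0 / a 0, ?_⟩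
  by_contra hne
  have hc : mq (b - (b 0 / a 0) • a) = 0 := by
    rw [mq_sub, mq_smul, mb_smul_right, mb_comm b a, ha, hb, hab]; ring
  refine time_ne_zero_of_lightlike hc (sub_ne_zero.mpr hne) ?_
  simp only [Pi.sub_apply, Pi.smul_apply, smul_eq_mul]
  field_simp
  ring

/-- If y, a and y - a are lightlike, then y is orthogonal to a, hence parallel to it. This describes
a light line by lightlikeness alone, so cone preserving maps carry light lines to light lines. -/
theorem mem_light_line_iff {a y : Coord n Q} (ha : mq a = 0) (ha0 : a ≠ 0) :
    (∃ l : Q, y = l • a) ↔ mq y = 0 ∧ mq (y - a) = 0 := by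
  constructor
  · rintro ⟨l, rfl⟩
    refine ⟨by rw [mq_smul, ha, mul_zero], ?_⟩
    rw [mq_sub, mq_smul, mb_smul_left, ← mq_eq_mb, ha]; ring
  · rintro ⟨h1, h2⟩
    rw [mq_sub, h1, ha] at h2
    refine lightlike_parallel ha ha0 h1 ?_
    rw [mb_comm]
    linarith

/-- Disjoint light lines are parallel if each point of one is connected by light with a point of the
other. -/
theorem light_lines_parallel {a c y : Coord n Q} (ha : mq a = 0) (ha0 : a ≠ 0) (hc : mq c = 0)
    (hconn : ∀ l : Q, ∃ m : Q, mq (y + l • c - m • a) = 0)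
    (hdisj : ∀ l m : Q, y + l • c ≠ m • a) : ∃ l : Q, c = l • a := by
  refine lightlike_parallel ha ha0 hc ?_
  by_contra hne
  have hne' : mb c a ≠ 0 := by rwa [mb_comm]
  -- The parameter is chosen to make the point Y orthogonal to a. Its light connection to the line
  -- of a then forces Y to be lightlike, so Y lies on that line, against disjointness.
  obtain ⟨m, hm⟩ := hconn (-(mb y a) / mb c a)
  set Y := y + (-(mb y a) / mb c a) • c with hY
  have hYa : mb Y a = 0 := by
    rw [hY, mb_add_left, mb_smul_left]
    field_simp
    ring
  have hYq : mq Y = 0 := by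
    rw [mq_sub, mq_smul, mb_smul_right, hYa, ha] at hm
    linarith
  obtain ⟨l, hl⟩ := lightlike_parallel ha ha0 hYq (by rwa [mb_comm])
  exact hdisj _ _ hl

/-- The vector with time component `x` and entry `y` at the space coordinate `i`. -/
def tx (i : Fin n) (x y : Q) : Coord n Q := Fin.cons x (Pi.single i y)

end Light

/-! ### Cone preserving bijections are additive up to translation. -/

section ConePreserving

variable {n : ℕ} {Q : Type v} [Field Q] [LinearOrder Q] [IsStrictOrderedRing Q]

theorem tx_zero_apply (i : Fin n) (x y : Q) : tx i x y 0 = x := rfl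

theorem tx_succ_apply (i j : Fin n) (x y : Q) : tx i x y j.succ = (Pi.single i y : Fin n → Q) j :=
  rfl

theorem tx_add (i : Fin n) (x y x' y' : Q) : tx i x y + tx i x' y' = tx i (x + x') (y + y') := by
  funext j
  refine Fin.cases rfl (fun j => ?_) j
  simp only [Pi.add_apply, tx_succ_apply, Pi.single_add]

theorem smul_tx (i : Fin n) (c x y : Q) : c • tx i x y = tx i (c * x) (c * y) := by
  funext j
  refine Fin.cases rfl (fun j => ?_) j
  by_cases h : j = i
  · subst h; simp [tx_succ_apply]
  · simp [tx_succ_apply, h]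

theorem mb_tx (i : Fin n) (x y : Q) (p : Coord n Q) : mb (tx i x y) p = x * p 0 - y * p i.succ := by
  have : ∑ j : Fin n, (Pi.single i y : Fin n → Q) j * p j.succ = y * p i.succ := by
    rw [Finset.sum_eq_single i]
    · simp
    · intro j _ hj; simp [hj]
    · simp
  simp only [mb, tx_zero_apply, tx_succ_apply, this]

theorem mq_tx (i : Fin n) (x y : Q) : mq (tx i x y) = x ^ 2 - y ^ 2 := by
  rw [mq_eq_mb, mb_tx, tx_zero_apply, tx_succ_apply, Pi.single_eq_same]; ring

theorem eq_time_add_sum_tx (p : Coord n Q) (i : Fin n) :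
    p = tx i (p 0) 0 + ∑ j, tx j 0 (p j.succ) := by
  funext l
  refine Fin.cases ?_ (fun l => ?_) l
  · simp [tx_zero_apply]
  · simp only [Pi.add_apply, Finset.sum_apply, tx_succ_apply]
    rw [Finset.sum_eq_single l]
    · simp
    · intro j _ hj; simp [Ne.symm hj]
    · simp

/-- A subgroup that contains enough lightlike vectors is everything. -/
theorem subgroup_eq_top_of_lightlike (H : AddSubgroup (Coord n Q)) (j : Fin n)
    (hj : ∀ x : Q, tx j x x ∈ H) (hj' : ∀ x : Q, tx j x (-x) ∈ H)
    (h : ∀ i : Fin n, (∀ x : Q, tx i x x ∈ H) ∨ (∀ x : Q, tx i x (-x) ∈ H)) (p : Coord n Q) :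
    p ∈ H := by
  have ht : ∀ x : Q, tx j x 0 ∈ H := by
    intro x
    have := H.add_mem (hj (x / 2)) (hj' (x / 2))
    rw [tx_add] at this
    simpa using this
  have htt : ∀ (i : Fin n) (x : Q), (tx i x 0 : Coord n Q) = tx j x 0 := by
    intro i x
    funext l
    refine Fin.cases rfl (fun l => ?_) l
    simp [tx_succ_apply]
  have hx : ∀ (i : Fin n) (x : Q), tx i 0 x ∈ H := by
    intro i x
    rcases h i with h | h
    · have := H.add_mem (h x) (ht (-x))
      rw [← htt i, tx_add] at this
      simpa using this
    · have := H.add_mem (h (-x)) (ht x)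
      rw [← htt i, tx_add] at this
      simpa using this
  rw [eq_time_add_sum_tx p j]
  exact H.add_mem (ht _) (H.sum_mem fun i _ => hx i _)

variable {f : Coord n Q → Coord n Q}

theorem map_light_line (hf : ∀ p q, mq (f p - f q) = 0 ↔ mq (p - q) = 0) (hi : f.Injective)
    {p a : Coord n Q} (ha : mq a = 0) (ha0 : a ≠ 0) (l : Q) :
    ∃ m : Q, f (p + l • a) = f p + m • (f (p + a) - f p) := by
  have h1 : mq (f (p + a) - f p) = 0 := by rw [hf]; simpa using ha
  have h2 : f (p + a) - f p ≠ 0 := by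
    rw [sub_ne_zero, hi.ne_iff]; simpa using ha0
  have h3 := (mem_light_line_iff (y := f (p + l • a) - f p) h1 h2).mpr ⟨?_, ?_⟩
  · obtain ⟨m, hm⟩ := h3
    exact ⟨m, by rw [← hm]; abel⟩
  · rw [hf, add_sub_cancel_left, mq_smul, ha, mul_zero]
  · rw [sub_sub_sub_cancel_right, hf, add_sub_add_left_eq_sub]
    exact ((mem_light_line_iff ha ha0).mp ⟨l, rfl⟩).2

theorem map_light_line_surj (hf : ∀ p q, mq (f p - f q) = 0 ↔ mq (p - q) = 0)
    (hs : f.Surjective) (hi : f.Injective)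
    {p a : Coord n Q} (ha : mq a = 0) (ha0 : a ≠ 0) (m : Q) :
    ∃ l : Q, f (p + l • a) = f p + m • (f (p + a) - f p) := by
  have h1 : mq (f (p + a) - f p) = 0 := by rw [hf]; simpa using ha
  have h2 : f (p + a) - f p ≠ 0 := by
    rw [sub_ne_zero, hi.ne_iff]; simpa using ha0
  obtain ⟨r, hr⟩ := hs (f p + m • (f (p + a) - f p))
  have h3 := (mem_light_line_iff (y := m • (f (p + a) - f p)) h1 h2).mp ⟨m, rfl⟩
  have h4 : m • (f (p + a) - f p) = f r - f p := by rw [hr]; abel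
  rw [h4, hf, sub_sub_sub_cancel_right, hf] at h3
  obtain ⟨l, hl⟩ := (mem_light_line_iff (y := r - p) ha ha0).mpr ⟨h3.1, by rw [← h3.2]; congr 1; abel⟩
  exact ⟨l, by rw [← hl, ← hr]; congr 1; abel⟩

/-- Translation by b connects each point of one light line with a point of the other by light, and
the two lines are disjoint because b is not parallel to a. Both facts survive under f, and
`light_lines_parallel` applies to the images. -/
theorem map_parallel (hf : ∀ p q, mq (f p - f q) = 0 ↔ mq (p - q) = 0)
    (hs : f.Surjective) (hi : f.Injective)
    {p a b : Coord n Q} (ha : mq a = 0) (hb : mq b = 0) (hab : mb a b ≠ 0) :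
    ∃ l : Q, f (p + b + a) - f (p + b) = l • (f (p + a) - f p) := by
  have ha0 : a ≠ 0 := by rintro rfl; simp [mb] at hab
  have h1 : mq (f (p + a) - f p) = 0 := by rw [hf]; simpa using ha
  have h2 : f (p + a) - f p ≠ 0 := by
    rw [sub_ne_zero, hi.ne_iff]; simpa using ha0
  have h1' : mq (f (p + b + a) - f (p + b)) = 0 := by rw [hf]; simpa using ha
  refine light_lines_parallel (y := f (p + b) - f p) h1 h2 h1' ?_ ?_
  · intro l
    obtain ⟨l', hl'⟩ := map_light_line_surj (p := p + b) hf hs hi ha ha0 l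
    obtain ⟨m, hm⟩ := map_light_line (p := p) hf hi ha ha0 l'
    refine ⟨m, ?_⟩
    have : f (p + b) - f p + l • (f (p + b + a) - f (p + b)) - m • (f (p + a) - f p)
        = f (p + b + l' • a) - f (p + l' • a) := by rw [hl', hm]; abel
    rw [this, hf]
    rw [← hb]; congr 1; abel
  · intro l m h
    obtain ⟨l', hl'⟩ := map_light_line_surj (p := p + b) hf hs hi ha ha0 l
    obtain ⟨m', hm'⟩ := map_light_line_surj (p := p) hf hs hi ha ha0 m
    have : f (p + b + l' • a) = f (p + m' • a) := by
      rw [hl', hm', ← h]; abel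
    have := hi this
    have hb' : b = (m' - l') • a := by
      rw [sub_smul]
      have h5 : p + b + l' • a - (p + l' • a) = p + m' • a - (p + l' • a) := by rw [this]
      have h6 : b = p + b + l' • a - (p + l' • a) := by abel
      rw [h6, h5]; abel
    apply hab
    rw [hb', mb_smul_right, ← mq_eq_mb, ha, mul_zero]

/-- Opposite sides of the image are parallel by `map_parallel` used in both directions. They are
equal unless adjacent sides are parallel too; that would make the image of a - b lightlike, contrary
to mb a b ≠ 0. -/
theorem map_light_parallelogram (hf : ∀ p q, mq (f p - f q) = 0 ↔ mq (p - q) = 0)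
    (hs : f.Surjective) (hi : f.Injective)
    (p : Coord n Q) {a b : Coord n Q} (ha : mq a = 0) (hb : mq b = 0) (hab : mb a b ≠ 0) :
    f (p + b + a) - f (p + b) = f (p + a) - f p := by
  obtain ⟨l, hl⟩ := map_parallel (p := p) hf hs hi ha hb hab
  obtain ⟨m, hm⟩ := map_parallel (p := p) hf hs hi hb ha (by rwa [mb_comm])
  have ha0 : a ≠ 0 := by rintro rfl; simp [mb] at hab
  have hb0 : b ≠ 0 := by rintro rfl; simp [mb] at hab
  rw [show p + a + b = p + b + a by abel] at hm
  have key : (1 - l) • (f (p + a) - f p) = (1 - m) • (f (p + b) - f p) := by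
    rw [sub_smul, sub_smul, ← hl, ← hm, one_smul, one_smul]; abel
  by_cases hl1 : l = 1
  · rw [hl, hl1, one_smul]
  · exfalso
    have h1 : f (p + a) - f p = ((1 - m) / (1 - l)) • (f (p + b) - f p) := by
      rw [div_eq_inv_mul, mul_smul, ← key, smul_smul, inv_mul_cancel₀, one_smul]
      exact sub_ne_zero.mpr (Ne.symm hl1)
    have h2 : mq (f (p + b) - f p) = 0 := by rw [hf]; simpa using hb
    have h3 : mq (f (p + a) - f (p + b)) = 0 := by
      have : f (p + a) - f (p + b) = ((1 - m) / (1 - l) - 1) • (f (p + b) - f p) := by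
        rw [sub_smul, ← h1, one_smul]; abel
      rw [this, mq_smul, h2, mul_zero]
    rw [hf, add_sub_add_left_eq_sub, mq_sub, ha, hb] at h3
    apply hab
    linarith

/-- The increments of a cone preserving bijection along a lightlike vector are constant. -/
theorem map_add_lightlike (hn : 2 ≤ n) (hf : ∀ p q, mq (f p - f q) = 0 ↔ mq (p - q) = 0)
    (hs : f.Surjective) (hi : f.Injective) {a : Coord n Q} (ha : mq a = 0) (p : Coord n Q) :
    f (p + a) - f p = f a - f 0 := by
  by_cases ha0 : a = 0
  · simp [ha0]
  have h0 := time_ne_zero_of_lightlike ha ha0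
  -- The translations that leave the increment along a unchanged form a group. It contains every
  -- lightlike b not orthogonal to a, and it remains to see that these generate everything.
  let H : AddSubgroup (Coord n Q) :=
    { carrier := {z | ∀ p, f (p + z + a) - f (p + z) = f (p + a) - f p}
      zero_mem' := by intro p; simp
      add_mem' := by
        intro x y hx hy p
        rw [← add_assoc, hy, hx]
      neg_mem' := by
        intro x hx p
        have := hx (p + -x)
        rw [neg_add_cancel_right] at this
        exact this.symm }
  have hmem : ∀ b : Coord n Q, mq b = 0 → mb a b ≠ 0 → b ∈ H := fun b hb hab p =>
    map_light_parallelogram hf hs hi p ha hb hab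
  have hp : ∀ (i : Fin n), a 0 - a i.succ ≠ 0 → ∀ x : Q, tx i x x ∈ H := by
    intro i hai x
    by_cases hx : x = 0
    · subst hx
      have : tx i (0 : Q) 0 = 0 := by simpa using (smul_tx i (0 : Q) 0 0).symm
      rw [this]; exact H.zero_mem
    refine hmem _ (by rw [mq_tx]; ring) ?_
    rw [mb_comm, mb_tx, ← mul_sub]
    exact mul_ne_zero hx hai
  have hm : ∀ (i : Fin n), a 0 + a i.succ ≠ 0 → ∀ x : Q, tx i x (-x) ∈ H := by
    intro i hai x
    by_cases hx : x = 0
    · subst hx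
      have : tx i (0 : Q) (-0) = 0 := by simpa using (smul_tx i (0 : Q) 0 0).symm
      rw [this]; exact H.zero_mem
    refine hmem _ (by rw [mq_tx]; ring) ?_
    rw [mb_comm, mb_tx, neg_mul, sub_neg_eq_add, ← mul_add]
    exact mul_ne_zero hx hai
  -- If all squares of space entries equalled a 0 ^ 2, then mq a would be (1 - n) a 0 ^ 2, nonzero
  -- since n ≥ 2. On the axis j so found both light directions are non-orthogonal to a; on every
  -- other axis at least one is, as a 0 ≠ 0.
  have hex : ∃ j : Fin n, a 0 ^ 2 ≠ a j.succ ^ 2 := by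
    by_contra hcon
    push Not at hcon
    simp only [mq, ← hcon, Finset.sum_const, Finset.card_univ, Fintype.card_fin, nsmul_eq_mul] at ha
    have h2 : (2 : Q) ≤ n := by exact_mod_cast hn
    have : 0 < a 0 ^ 2 := by positivity
    nlinarith
  obtain ⟨j, hj⟩ := hex
  have hz := subgroup_eq_top_of_lightlike H j
    (hp j (fun h => hj (by rw [sub_eq_zero.mp h])))
    (hm j (fun h => hj (by rw [eq_neg_of_add_eq_zero_left h]; ring)))
    (fun i => by
      by_cases h : a 0 - a i.succ = 0
      · right
        refine hm i (fun h' => h0 ?_)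
        linarith
      · exact Or.inl (hp i h)) p
  have := hz 0
  simpa using this

/-- A cone preserving bijection that fixes the origin is additive. -/
theorem map_add_of_cone (hn : 2 ≤ n) (hf : ∀ p q, mq (f p - f q) = 0 ↔ mq (p - q) = 0)
    (hs : f.Surjective) (hi : f.Injective) (h0 : f 0 = 0) (p q : Coord n Q) :
    f (p + q) = f p + f q := by
  let H : AddSubgroup (Coord n Q) :=
    { carrier := {z | ∀ p, f (p + z) = f p + f z}
      zero_mem' := by intro p; simp [h0]
      add_mem' := by
        intro x y hx hy p
        rw [← add_assoc, hy, hx, hy, add_assoc]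
      neg_mem' := by
        intro x hx p
        have h1 := hx (p + -x)
        have h2 := hx (-x)
        rw [neg_add_cancel_right] at h1
        rw [neg_add_cancel, h0] at h2
        rw [h1, add_assoc, add_comm (f x), ← h2, add_zero] }
  have hmem : ∀ b : Coord n Q, mq b = 0 → b ∈ H := fun b hb p => by
    have := map_add_lightlike hn hf hs hi hb p
    rw [h0, sub_zero] at this
    rw [← this]; abel
  refine subgroup_eq_top_of_lightlike H ⟨0, by omega⟩ (fun x => hmem _ ?_) (fun x => hmem _ ?_)
    (fun i => Or.inl fun x => hmem _ ?_) q p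
  all_goals rw [mq_tx]; ring

end ConePreserving

/-! ### From additivity to linearity and isometry. -/

section LorentzMap

variable {n : ℕ} {Q : Type v} [Field Q] [LinearOrder Q] [IsStrictOrderedRing Q]

/-- Taking Minkowski squares in the relation leaves 2xy · mb A B = 0, so x or y vanishes; pairing
with A and B kills the rest. -/
theorem lightlike_independent {A B C : Coord n Q} (hA : mq A = 0) (hB : mq B = 0) (hC : mq C = 0)
    (hAB : mb A B ≠ 0) (hAC : mb A C ≠ 0) (hBC : mb B C ≠ 0) {x y z : Q}
    (h : x • A + y • B = z • C) : x = 0 ∧ y = 0 ∧ z = 0 := by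
  have hq : mq (x • A + y • B) = mq (z • C) := by rw [h]
  rw [mq_add, mq_smul, mq_smul, mq_smul, hA, hB, hC, mb_smul_left, mb_smul_right] at hq
  have h1 : mb (x • A + y • B) A = mb (z • C) A := by rw [h]
  have h2 : mb (x • A + y • B) B = mb (z • C) B := by rw [h]
  have h3 : mb (x • A + y • B) C = mb (z • C) C := by rw [h]
  simp only [mb_add_left, mb_smul_left, ← mq_eq_mb, hA, hB, hC, mb_comm B A, mb_comm C A,
    mb_comm C B, mul_zero, zero_add, add_zero] at h1 h2 h3
  have hxy : x * y = 0 := by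
    have : x * y * mb A B = 0 := by linarith
    exact (mul_eq_zero.mp this).resolve_right hAB
  rcases mul_eq_zero.mp hxy with hx | hy
  · subst hx
    rw [zero_mul, eq_comm] at h2
    have hz := (mul_eq_zero.mp h2).resolve_right hBC
    subst hz
    rw [zero_mul] at h1
    exact ⟨rfl, (mul_eq_zero.mp h1).resolve_right hAB, rfl⟩
  · subst hy
    rw [zero_mul, eq_comm] at h1
    have hz := (mul_eq_zero.mp h1).resolve_right hAC
    subst hz
    rw [zero_mul] at h2
    exact ⟨(mul_eq_zero.mp h2).resolve_right hAB, rfl, rfl⟩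

variable {f : Coord n Q → Coord n Q}

/-- Lightlike a and b are orthogonal exactly when a - b is lightlike, and f reflects lightlikeness.
-/
theorem mb_map_ne_zero (hf : ∀ p q, mq (f p - f q) = 0 ↔ mq (p - q) = 0) (h0 : f 0 = 0)
    {a b : Coord n Q} (ha : mq a = 0) (hb : mq b = 0) (hab : mb a b ≠ 0) : mb (f a) (f b) ≠ 0 := by
  intro h
  have hfa : mq (f a) = 0 := by simpa [h0] using (hf a 0).mpr (by simpa using ha)
  have hfb : mq (f b) = 0 := by simpa [h0] using (hf b 0).mpr (by simpa using hb)
  have := (hf a b).mp (by rw [mq_sub, hfa, hfb, h]; ring)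
  rw [mq_sub, ha, hb] at this
  apply hab
  linarith

theorem tx_time_eq (i j : Fin n) (x : Q) : (tx i x 0 : Coord n Q) = tx j x 0 := by
  funext l
  refine Fin.cases rfl (fun l => ?_) l
  simp [tx_succ_apply]

theorem mb_tx_tx_ne {i j : Fin n} (hij : i ≠ j) (x y : Q) :
    mb (tx i 1 x) (tx j 1 y) = 1 := by
  rw [mb_tx, tx_zero_apply, tx_succ_apply, Pi.single_eq_of_ne hij]; ring

theorem mb_tx_tx (i : Fin n) : mb (tx i (1 : Q) 1) (tx i 1 (-1)) = 2 := by
  rw [mb_tx, tx_zero_apply, tx_succ_apply, Pi.single_eq_same]; ring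

/-- Along four particular lightlike directions, a cone preserving additive map has the same scaling
behaviour. -/
theorem exists_scale_pair (hf : ∀ p q, mq (f p - f q) = 0 ↔ mq (p - q) = 0)
    (hi : f.Injective) (h0 : f 0 = 0) (hadd : ∀ p q, f (p + q) = f p + f q)
    {i j : Fin n} (hij : i ≠ j) (x : Q) :
    ∃ m : Q, (f (tx i x x) = m • f (tx i 1 1) ∧ f (tx i x (-x)) = m • f (tx i 1 (-1))) ∧
      (f (tx j x x) = m • f (tx j 1 1) ∧ f (tx j x (-x)) = m • f (tx j 1 (-1))) := by
  have hl : ∀ (l : Fin n) (s : Q), s ^ 2 = 1 → ∃ m : Q, f (tx l x (x * s)) = m • f (tx l 1 s) := by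
    intro l s hs
    have h1 : mq (tx l (1 : Q) s) = 0 := by rw [mq_tx, hs]; ring
    have h2 : tx l (1 : Q) s ≠ 0 := fun h => by
      have := congrFun h 0
      simp [tx_zero_apply] at this
    obtain ⟨m, hm⟩ := map_light_line (p := 0) hf hi h1 h2 x
    rw [smul_tx] at hm
    simp only [zero_add, h0, sub_zero, mul_one] at hm
    exact ⟨m, hm⟩
  obtain ⟨m1, h1⟩ := hl i 1 (by norm_num)
  obtain ⟨m2, h2⟩ := hl i (-1) (by norm_num)
  obtain ⟨m3, h3⟩ := hl j 1 (by norm_num)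
  obtain ⟨m4, h4⟩ := hl j (-1) (by norm_num)
  simp only [mul_one, mul_neg] at h1 h2 h3 h4
  have hsum : ∀ y : Q, f (tx i y y) + f (tx i y (-y)) = f (tx j y y) + f (tx j y (-y)) := by
    intro y
    rw [← hadd, ← hadd, tx_add, tx_add]
    simp only [add_neg_cancel]
    rw [tx_time_eq i j]
  -- The light vectors of each axis add up to the same multiple of the time vector. Eliminating the
  -- fourth image turns this into a relation between three independent lightlike vectors, so all
  -- four scale factors agree.
  have hD : f (tx j 1 (-1)) = f (tx i 1 1) + f (tx i 1 (-1)) - f (tx j 1 1) := by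
    rw [hsum 1]; abel
  have key : (m1 - m4) • f (tx i 1 1) + (m2 - m4) • f (tx i 1 (-1)) = (m3 - m4) • f (tx j 1 1) := by
    have := hsum x
    rw [h1, h2, h3, h4, hD] at this
    rw [sub_smul, sub_smul, sub_smul]
    rw [smul_sub, smul_add] at this
    rw [sub_add_sub_comm, this]
    abel
  have hq : ∀ (l : Fin n) (s : Q), s ^ 2 = 1 → mq (tx l 1 s) = 0 := fun l s hs => by
    rw [mq_tx, hs]; ring
  have hfq : ∀ (l : Fin n) (s : Q), s ^ 2 = 1 → mq (f (tx l 1 s)) = 0 := fun l s hs => by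
    simpa [h0] using (hf (tx l 1 s) 0).mpr (by simpa using hq l s hs)
  have h1' : (1 : Q) ^ 2 = 1 := by norm_num
  have h2' : (-1 : Q) ^ 2 = 1 := by norm_num
  obtain ⟨e1, e2, e3⟩ := lightlike_independent (hfq i 1 h1') (hfq i (-1) h2') (hfq j 1 h1')
    (mb_map_ne_zero hf h0 (hq _ _ h1') (hq _ _ h2') (by rw [mb_tx_tx]; norm_num))
    (mb_map_ne_zero hf h0 (hq _ _ h1') (hq _ _ h1') (by rw [mb_tx_tx_ne hij]; norm_num))
    (mb_map_ne_zero hf h0 (hq _ _ h2') (hq _ _ h1') (by rw [mb_tx_tx_ne hij]; norm_num)) key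
  rw [sub_eq_zero] at e1 e2 e3
  rw [e1] at h1
  rw [e2] at h2
  rw [e3] at h3
  exact ⟨m4, ⟨h1, h2⟩, h3, h4⟩

theorem exists_scale (hn : 2 ≤ n) (hf : ∀ p q, mq (f p - f q) = 0 ↔ mq (p - q) = 0)
    (hi : f.Injective) (h0 : f 0 = 0) (hadd : ∀ p q, f (p + q) = f p + f q) (x : Q) :
    ∃ m : Q, ∀ i : Fin n,
      f (tx i x x) = m • f (tx i 1 1) ∧ f (tx i x (-x)) = m • f (tx i 1 (-1)) := by
  let i0 : Fin n := ⟨0, by omega⟩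
  let j0 : Fin n := ⟨1, by omega⟩
  have hij : i0 ≠ j0 := by simp [i0, j0]
  obtain ⟨m, hm, -⟩ := exists_scale_pair hf hi h0 hadd hij x
  refine ⟨m, fun i => ?_⟩
  by_cases h : i0 = i
  · rw [← h]; exact hm
  · obtain ⟨m', hm', hm''⟩ := exists_scale_pair hf hi h0 hadd h x
    have hne : f (tx i0 1 1) ≠ 0 := by
      rw [← h0, hi.ne_iff]
      intro h
      have := congrFun h 0
      simp [tx_zero_apply] at this
    have : m' = m := by
      have := hm'.1.symm.trans hm.1
      exact smul_left_injective Q hne this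
    rw [← this]
    exact hm''

/-- A cone preserving additive bijection is linear if it preserves the length of the vectors that are
horizontal before and after the map. -/
theorem map_smul_of_cone (hn : 2 ≤ n) (hf : ∀ p q, mq (f p - f q) = 0 ↔ mq (p - q) = 0)
    (hs : f.Surjective) (hi : f.Injective) (h0 : f 0 = 0) (hadd : ∀ p q, f (p + q) = f p + f q)
    (hd : ∀ z, z 0 = 0 → f z 0 = 0 → mq (f z) = mq z) (c : Q) (p : Coord n Q) :
    f (c • p) = c • f p := by
  let i0 : Fin n := ⟨0, by omega⟩
  let j0 : Fin n := ⟨1, by omega⟩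
  have hij : i0 ≠ j0 := by simp [i0, j0]
  -- φ x is the common factor by which f scales the light directions of the axes. Linearity amounts
  -- to φ being the identity, and only the distance hypothesis `hd` can give that.
  choose φ hφ using exists_scale hn hf hi h0 hadd
  have hne : ∀ (i : Fin n), f (tx i 1 1) ≠ 0 := by
    intro i
    rw [← h0, hi.ne_iff]
    intro h
    have := congrFun h 0
    simp [tx_zero_apply] at this
  have hφadd : ∀ x y, φ (x + y) = φ x + φ y := by
    intro x y
    apply smul_left_injective Q (hne i0)
    simp only
    rw [add_smul, ← (hφ _ i0).1, ← (hφ _ i0).1, ← (hφ _ i0).1, ← hadd, tx_add]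
  have hφ1 : φ 1 = 1 := by
    apply smul_left_injective Q (hne i0)
    simp only
    rw [← (hφ _ i0).1, one_smul]
  have hφs : ∀ m, ∃ x, φ x = m := by
    intro m
    have h1 : mq (tx i0 (1 : Q) 1) = 0 := by rw [mq_tx]; ring
    have h2 : tx i0 (1 : Q) 1 ≠ 0 := fun h => hne i0 (by rw [h, h0])
    obtain ⟨x, hx⟩ := map_light_line_surj (p := 0) hf hs hi h1 h2 m
    simp only [zero_add, h0, sub_zero, smul_tx, mul_one] at hx
    exact ⟨x, smul_left_injective Q (hne i0) (by simpa using ((hφ x i0).1.symm.trans hx))⟩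
  -- A space vector is a difference of two lightlike vectors on its axis, so φ governs space axes as
  -- well.
  have hsp : ∀ i x, f (tx i 0 x) = φ x • f (tx i 0 1) := by
    intro i x
    have key : ∀ y, f (tx i 0 y) = φ (y / 2) • (f (tx i 1 1) - f (tx i 1 (-1))) := by
      intro y
      have e : tx i (y / 2) (y / 2) = tx i 0 y + tx i (y / 2) (-(y / 2)) := by
        rw [tx_add]; congr 1 <;> ring
      have := congrArg f e
      rw [hadd] at this
      rw [smul_sub, ← (hφ _ i).1, ← (hφ _ i).2, this]; abel
    have hφ2 : φ x = 2 * φ (x / 2) := by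
      rw [two_mul, ← hφadd]; congr 1; ring
    have h12 : 2 * φ (1 / 2) = 1 := by
      have := hφadd (1 / 2) (1 / 2)
      rw [add_halves, hφ1] at this
      linarith
    rw [key x, key 1, smul_smul, hφ2]
    congr 1
    linear_combination (-φ (x / 2)) * h12
  have hmq : ∀ x y : Q, mq (tx i0 0 x + tx j0 0 y) = -(x ^ 2 + y ^ 2) := by
    intro x y
    rw [mq_add, mq_tx, mq_tx, mb_tx, tx_zero_apply, tx_succ_apply, Pi.single_eq_of_ne hij]; ring
  have hφid : ∀ x, φ x = x := by
    set A := f (tx i0 0 1)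
    set B := f (tx j0 0 1)
    have hAB : ∀ x y, f (tx i0 0 x + tx j0 0 y) = φ x • A + φ y • B := by
      intro x y; rw [hadd, hsp i0 x, hsp j0 y]
    have hd' : ∀ x y, φ x * A 0 + φ y * B 0 = 0 →
        mq (φ x • A + φ y • B) = -(x ^ 2 + y ^ 2) := by
      intro x y h
      rw [← hAB, hd, hmq]
      · simp [tx_zero_apply]
      · rw [hAB]; simpa using h
    have hφ0 : φ 0 = 0 := by
      have := hφadd 0 0
      simpa using this
    -- If the image of the second axis is horizontal, `hd` gives φ x ^ 2 = x ^ 2; comparing x with x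
    -- + 1 removes the sign.
    by_cases hB : B 0 = 0
    · have h1 : ∀ x, φ x ^ 2 * mq B = -(x ^ 2) := by
        intro x
        have := hd' 0 x (by rw [hB, hφ0]; ring)
        rw [hφ0, zero_smul, zero_add, mq_smul] at this
        rw [this]; ring
      have hC : mq B = -1 := by
        have := h1 1
        rw [hφ1] at this
        linarith
      intro x
      have e1 := h1 x
      have e2 := h1 (x + 1)
      rw [hφadd, hφ1, hC] at e2
      rw [hC] at e1
      linarith
    -- Otherwise surjectivity of φ provides for each x a y such that the combination with
    -- coefficients x, y has a horizontal image, namely φ x • C. The lengths for x, 1 and x + 1 then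
    -- polarize to `e4`.
    · have hy : ∀ x, ∃ y, φ y = -(φ x) * A 0 / B 0 := fun x => hφs _
      obtain ⟨y1, hy1⟩ := hy 1
      intro x
      obtain ⟨y, hy⟩ := hy x
      have hE : ∀ m : Q, m • A + (-m * A 0 / B 0) • B = m • (A + (-(A 0 / B 0)) • B) := by
        intro m
        rw [smul_add, smul_smul]
        congr 2
        ring
      set C := A + (-(A 0 / B 0)) • B
      have e1 := hd' x y (by rw [hy]; field_simp; ring)
      have e2 := hd' 1 y1 (by rw [hy1]; field_simp; ring)
      have e3 := hd' (x + 1) (y + y1) (by rw [hφadd, hφadd, hy, hy1]; field_simp; ring)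
      rw [hφadd x, hφadd y, hy, hy1, hφ1,
        show -φ x * A 0 / B 0 + -1 * A 0 / B 0 = -(φ x + 1) * A 0 / B 0 by ring, hE,
        mq_smul] at e3
      rw [hy, hE, mq_smul] at e1
      rw [hy1, hE, mq_smul, hφ1] at e2
      have e4 : φ x * mq C = -(x + y * y1) := by linarith
      have hCne : mq C = -(1 + y1 ^ 2) := by linarith
      -- Equality in the Cauchy–Schwarz inequality for (x, y) and (1, y1), by Lagrange's identity.
      have e5 : (x * y1 - y) ^ 2 = 0 := by
        have : (φ x * mq C) ^ 2 = (φ x ^ 2 * mq C) * mq C := by ring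
        rw [e4, e1, hCne] at this
        linear_combination -this
      have e6 : y = x * y1 := by
        have := pow_eq_zero_iff (two_ne_zero) |>.mp e5
        linarith
      rw [hCne, e6] at e4
      have hpos : (1 + y1 ^ 2) ≠ 0 := by positivity
      apply mul_right_cancel₀ hpos
      linarith
  let H : AddSubgroup (Coord n Q) :=
    { carrier := {z | f (c • z) = c • f z}
      zero_mem' := by simp [h0]
      add_mem' := by
        intro x y hx hy
        simp only [Set.mem_ofPred_eq] at hx hy ⊢
        rw [smul_add, hadd, hx, hy, hadd, smul_add]
      neg_mem' := by
        intro x hx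
        simp only [Set.mem_ofPred_eq] at hx ⊢
        have hneg : ∀ w, f (-w) = -f w := fun w => by
          rw [eq_neg_iff_add_eq_zero, ← hadd, neg_add_cancel, h0]
        rw [smul_neg, hneg, hneg, hx, smul_neg] }
  have hp : ∀ i x, tx i x x ∈ H := by
    intro i x
    change f (c • tx i x x) = c • f (tx i x x)
    rw [smul_tx, (hφ _ i).1, (hφ x i).1, hφid, hφid, smul_smul]
  have hm : ∀ i x, tx i x (-x) ∈ H := by
    intro i x
    change f (c • tx i x (-x)) = c • f (tx i x (-x))
    rw [smul_tx, mul_neg, (hφ _ i).2, (hφ x i).2, hφid, hφid, smul_smul]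
  exact subgroup_eq_top_of_lightlike H i0 (hp _) (hm _) (fun i => Or.inl (hp i)) p

/-- A cone preserving linear map is conformal. -/
theorem mq_map_of_cone (hE : ∀ x : Q, 0 < x → ∃ y : Q, y * y = x)
    (L : Coord n Q →ₗ[Q] Coord n Q) (hL : ∀ p, mq p = 0 → mq (L p) = 0) (p : Coord n Q) :
    mq (L p) = mq (L (Pi.single 0 1)) * mq p := by
  set e : Coord n Q := Pi.single 0 1 with he
  have he0 : e 0 = 1 := by simp [he]
  have hes : ∀ i : Fin n, e i.succ = 0 := by intro i; simp [he]
  obtain ⟨r, hr⟩ : ∃ r, r * r = ∑ i : Fin n, p i.succ ^ 2 := by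
    rcases (Finset.sum_nonneg fun (i : Fin n) _ => sq_nonneg (p i.succ)).lt_or_eq with h | h
    · exact hE _ h
    · exact ⟨0, by rw [← h]; ring⟩
  have hbe : ∀ q, mb e q = q 0 := by
    intro q; simp [mb, he0, hes]
  have hee : mq e = 1 := by rw [mq_eq_mb, hbe, he0]
  -- l is p moved along the time direction onto the cone, and (2r) e - l has the same time component
  -- r and the opposite space component. Lightlikeness of both images determines mb (L e) (L l).
  set l : Coord n Q := p + (r - p 0) • e with hl
  have hpq : mq p = p 0 ^ 2 - r * r := by rw [hr]; rfl
  have hlq : mq l = 0 := by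
    rw [hl, mq_add, mq_smul, mb_smul_right, mb_comm, hbe, hee, hpq]; ring
  have hl' : mq ((2 * r) • e - l) = 0 := by
    rw [mq_sub, mq_smul, mb_smul_left, hbe, hlq, hee, hl]
    simp only [Pi.add_apply, Pi.smul_apply, he0, smul_eq_mul]
    ring
  have h1 := hL _ hlq
  have h2 := hL _ hl'
  rw [map_sub, map_smul, mq_sub, mq_smul, mb_smul_left, h1] at h2
  have h3 : L p = L l + (-(r - p 0)) • L e := by
    rw [hl, map_add, map_smul, neg_smul]; abel
  rw [h3, mq_add, mq_smul, mb_smul_right, h1, mb_comm, hpq]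
  by_cases hr0 : r = 0
  · have : l = 0 := by
      have hs : ∑ i : Fin n, p i.succ ^ 2 = 0 := by rw [← hr, hr0]; ring
      by_contra hne
      refine time_ne_zero_of_lightlike hlq hne ?_
      simp [hl, he0, hr0]
    rw [this, map_zero, hr0]
    simp [mb]
    ring
  · have h4 : mb (L e) (L l) = r * mq (L e) := by
      apply mul_left_cancel₀ (mul_ne_zero four_ne_zero hr0 : (4 * r : Q) ≠ 0)
      linear_combination -h2
    rw [h4]; ring

/-- A cone preserving bijection is a Poincaré transformation if it preserves the distance of any two
points that are simultaneous before and after the map. -/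
theorem poincare_of_cone (hn : 2 ≤ n) (hE : ∀ x : Q, 0 < x → ∃ y : Q, y * y = x)
    (hf : ∀ p q, mq (f p - f q) = 0 ↔ mq (p - q) = 0) (hs : f.Surjective) (hi : f.Injective)
    (hd : ∀ p q, p 0 = q 0 → f p 0 = f q 0 → mq (f p - f q) = mq (p - q)) :
    ∃ L : Coord n Q →ₗ[Q] Coord n Q, (∀ p, mq (L p) = mq p) ∧ ∀ p, f p = L p + f 0 := by
  set g : Coord n Q → Coord n Q := fun p => f p - f 0 with hg
  have hgf : ∀ p q, g p - g q = f p - f q := fun p q => by simp [hg]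
  have hg0 : g 0 = 0 := by simp [hg]
  have hgc : ∀ p q, mq (g p - g q) = 0 ↔ mq (p - q) = 0 := fun p q => by rw [hgf, hf]
  have hgs : g.Surjective := fun y => by
    obtain ⟨x, hx⟩ := hs (y + f 0)
    exact ⟨x, by simp [hg, hx]⟩
  have hgi : g.Injective := fun x y h => hi (by simpa [hg] using h)
  have hgd : ∀ z, z 0 = 0 → g z 0 = 0 → mq (g z) = mq z := by
    intro z hz hz'
    have := hd z 0 hz (by simpa [hg, sub_eq_zero] using hz')
    simpa using this
  have hadd := map_add_of_cone hn hgc hgs hgi hg0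
  have hsmul := map_smul_of_cone hn hgc hgs hgi hg0 hadd hgd
  let L : Coord n Q →ₗ[Q] Coord n Q := { toFun := g, map_add' := hadd, map_smul' := hsmul }
  have hLg : ∀ p, L p = g p := fun p => rfl
  have hcone : ∀ p, mq p = 0 → mq (L p) = 0 := by
    intro p hp
    have := (hgc p 0).mpr (by simpa using hp)
    rw [hg0, sub_zero] at this
    exact this
  have hconf := mq_map_of_cone hE L hcone
  have hone : mq (L (Pi.single 0 1)) = 1 := by
    let i0 : Fin n := ⟨0, by omega⟩
    let j0 : Fin n := ⟨1, by omega⟩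
    have hij : i0 ≠ j0 := by simp [i0, j0]
    have hmq : ∀ x y : Q, mq (tx i0 0 x + tx j0 0 y) = -(x ^ 2 + y ^ 2) := by
      intro x y
      rw [mq_add, mq_tx, mq_tx, mb_tx, tx_zero_apply, tx_succ_apply, Pi.single_eq_of_ne hij]; ring
    -- One linear equation in two unknowns: the plane of two space axes contains a nonzero vector
    -- with horizontal image. Its length is preserved, so the conformal factor is 1.
    obtain ⟨x, y, hxy, hz⟩ : ∃ x y : Q, x ^ 2 + y ^ 2 ≠ 0 ∧ L (tx i0 0 x + tx j0 0 y) 0 = 0 := by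
      have hlin : ∀ x y : Q, L (tx i0 0 x + tx j0 0 y) 0
          = x * L (tx i0 0 1) 0 + y * L (tx j0 0 1) 0 := by
        intro x y
        have h1 : tx i0 0 x = x • tx i0 0 1 := by rw [smul_tx]; simp
        have h2 : tx j0 0 y = y • tx j0 0 1 := by rw [smul_tx]; simp
        rw [h1, h2, map_add, map_smul, map_smul]
        simp
      by_cases hB : L (tx j0 0 1) 0 = 0
      · exact ⟨0, 1, by norm_num, by rw [hlin, hB]; ring⟩
      · refine ⟨1, -(L (tx i0 0 1) 0 / L (tx j0 0 1) 0), by positivity, ?_⟩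
        rw [hlin]; field_simp; ring
    have h1 := hgd (tx i0 0 x + tx j0 0 y) (by simp [tx_zero_apply]) hz
    rw [← hLg, hconf, hmq] at h1
    exact mul_right_cancel₀ (neg_ne_zero.mpr hxy) (by rw [h1, one_mul])
  refine ⟨L, fun p => by rw [hconf, hone, one_mul], fun p => by simp [hLg, hg]⟩

end LorentzMap

/-! ### Worldview transformations between inertial observers. -/

section Inertial

variable {n : ℕ} {B : Type u} {Q : Type v} [Field Q] [LinearOrder Q] [IsStrictOrderedRing Q]

theorem qsqrt_spec_of_nonneg (hE : ∀ x : Q, 0 < x → ∃ y : Q, y * y = x) {x : Q} (hx : 0 ≤ x) :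
    0 ≤ qsqrt x ∧ qsqrt x * qsqrt x = x := by
  apply qsqrt_spec
  rcases hx.lt_or_eq with h | h
  · obtain ⟨y, hy⟩ := hE x h
    exact ⟨|y|, abs_nonneg y, by rw [abs_mul_abs_self, hy]⟩
  · exact ⟨0, le_rfl, by rw [← h, mul_zero]⟩

theorem spaceLen_spec (hE : ∀ x : Q, 0 < x → ∃ y : Q, y * y = x) (p : Coord n Q) :
    0 ≤ spaceLen p ∧ spaceLen p * spaceLen p = ∑ i : Fin n, p i.succ ^ 2 :=
  qsqrt_spec_of_nonneg hE (Finset.sum_nonneg fun _ _ => sq_nonneg _)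

theorem euclLen_spec (hE : ∀ x : Q, 0 < x → ∃ y : Q, y * y = x) (p : Coord n Q) :
    0 ≤ euclLen p ∧ euclLen p * euclLen p = ∑ i, p i ^ 2 :=
  qsqrt_spec_of_nonneg hE (Finset.sum_nonneg fun _ _ => sq_nonneg _)

theorem spaceLen_eq_abs_iff (hE : ∀ x : Q, 0 < x → ∃ y : Q, y * y = x) (p : Coord n Q) :
    spaceLen p = |p 0| ↔ mq p = 0 := by
  obtain ⟨h1, h2⟩ := spaceLen_spec hE p
  rw [mq, sub_eq_zero, ← h2, ← sq_abs (p 0), ← sq, sq_eq_sq₀ (abs_nonneg _) h1, eq_comm]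

theorem spacelike_iff (hE : ∀ x : Q, 0 < x → ∃ y : Q, y * y = x) (p : Coord n Q) :
    Spacelike p ↔ mq p < 0 := by
  obtain ⟨h1, h2⟩ := spaceLen_spec hE p
  rw [mq, sub_neg, ← h2, ← sq_abs (p 0), ← sq, sq_lt_sq₀ (abs_nonneg _) h1, Spacelike]

namespace WorldModel

variable {M : WorldModel n B Q}

theorem AccRel.photon_iff (hM : M.AccRel) {m : B} (hm : m ∈ M.IOb) (p q : Coord n Q) :
    mq (p - q) = 0 ↔ (M.Ph ∩ M.ev m p ∩ M.ev m q).Nonempty := by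
  rw [← hM.axPh m hm p q, ← spaceLen_eq_abs_iff hM.axEOF]
  rfl

theorem AccRel.ev_nonempty (hM : M.AccRel) {m : B} (hm : m ∈ M.IOb) (p : Coord n Q) :
    (M.ev m p).Nonempty := by
  obtain ⟨x, hx⟩ := (hM.photon_iff hm p p).mp (by rw [sub_self, mq_zero])
  exact ⟨x, hx.2⟩

/-- Points with the same event have the same light cone by `AxPh`, and a cone determines its vertex:
q - p is lightlike and orthogonal to all lightlike vectors, so its time component vanishes. -/
theorem AccRel.ev_injective (hn : 2 ≤ n) (hM : M.AccRel) {m : B} (hm : m ∈ M.IOb)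
    {p q : Coord n Q} (h : M.ev m p = M.ev m q) : p = q := by
  have key : ∀ r, mq (r - p) = 0 ↔ mq (r - q) = 0 := fun r => by
    rw [hM.photon_iff hm, hM.photon_iff hm, h]
  have h1 : mq (q - p) = 0 := (key q).mpr (by rw [sub_self, mq_zero])
  have h2 : ∀ l : Coord n Q, mq l = 0 → mb l (q - p) = 0 := by
    intro l hl
    have := (key (p + l)).mp (by rwa [add_sub_cancel_left])
    rw [show p + l - q = l - (q - p) by abel, mq_sub, hl, h1] at this
    linarith
  have i : Fin n := ⟨0, by omega⟩
  have e1 := h2 (tx i 1 1) (by rw [mq_tx]; ring)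
  have e2 := h2 (tx i 1 (-1)) (by rw [mq_tx]; ring)
  rw [mb_tx] at e1 e2
  by_contra hne
  exact time_ne_zero_of_lightlike h1 (sub_ne_zero.mpr (Ne.symm hne)) (by linarith)

theorem IsLoc.eq {m : B} {e : Set B} {p q : Coord n Q} (hp : M.IsLoc m e p) (hq : M.ev m q = e) :
    q = p := hp.2 q hq

/-- The worldview transformation between inertial observers is a Poincaré transformation. -/
theorem AccRel.poincare (hn : 2 ≤ n) (hM : M.AccRel) {m k : B} (hm : m ∈ M.IOb) (hk : k ∈ M.IOb) :
    ∃ (L : Coord n Q →ₗ[Q] Coord n Q) (o : Coord n Q), (∀ p, mq (L p) = mq p) ∧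
      ∀ p, M.ev k (L p + o) = M.ev m p := by
  have hex : ∀ {a b : B}, a ∈ M.IOb → b ∈ M.IOb → ∀ p, ∃ q, M.ev b q = M.ev a p := by
    intro a b ha hb p
    have h1 : M.ev a p ∈ M.EvOf a := ⟨⟨p, rfl⟩, hM.ev_nonempty ha p⟩
    rw [hM.axEv a ha b hb] at h1
    exact h1.1
  choose f hf using hex hm hk
  have hi : f.Injective := fun p q h => hM.ev_injective hn hm (by rw [← hf, ← hf, h])
  have hs : f.Surjective := fun q => by
    obtain ⟨p, hp⟩ := hex hk hm q
    exact ⟨p, hM.ev_injective hn hk (by rw [hf, hp])⟩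
  have hc : ∀ p q, mq (f p - f q) = 0 ↔ mq (p - q) = 0 := fun p q => by
    rw [hM.photon_iff hk, hM.photon_iff hm, hf, hf]
  have hd : ∀ p q, p 0 = q 0 → f p 0 = f q 0 → mq (f p - f q) = mq (p - q) := by
    intro p q hpq hfpq
    have hmem : ∀ r, M.ev m r ∈ M.EvOf m ∩ M.EvOf k := fun r =>
      ⟨⟨⟨r, rfl⟩, hM.ev_nonempty hm r⟩, ⟨f r, hf r⟩, hM.ev_nonempty hm r⟩
    obtain ⟨x, ⟨p1, q1, hp1, hq1, hx1⟩, ⟨p2, q2, hp2, hq2, hx2⟩⟩ := hM.axSymDist m hm k hk _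
      (hmem p) _ (hmem q) ⟨p, q, rfl, rfl, hpq⟩ ⟨f p, f q, hf p, hf q, hfpq⟩
    rw [← hp1.eq rfl, ← hq1.eq rfl] at hx1
    rw [← hp2.eq (hf p), ← hq2.eq (hf q)] at hx2
    have e1 := (spaceLen_spec hM.axEOF (p - q)).2
    have e2 := (spaceLen_spec hM.axEOF (f p - f q)).2
    rw [← hx1] at e1
    rw [← hx2] at e2
    rw [mq, mq, ← e1, ← e2]
    simp [hpq, hfpq]
  obtain ⟨L, hL, hLf⟩ := poincare_of_cone hn hM.axEOF hc hs hi hd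
  exact ⟨L, f 0, hL, fun p => by rw [← hLf, hf]⟩

end WorldModel

end Inertial

/-! ### Definable sets and functions of quantities. -/

section Definability

open Set FirstOrder

namespace WorldModel

variable {n : ℕ} {B : Type u} {Q : Type v} [Field Q] [LinearOrder Q] (M : WorldModel n B Q)
  {α β : Type}

/-- A property of tuples of elements of the universe that is definable with parameters. -/
def UDef (P : (α → M.Univ) → Prop) : Prop :=
  (univ : Set M.Univ).Definable (frameLang n) {x | P x}

/-- A property of tuples of quantities that is definable with parameters. -/
def QDef (P : (α → Q) → Prop) : Prop :=
  M.UDef fun x : α → M.Univ => ∃ a : α → Q, (∀ i, x i = Univ.qty (a i)) ∧ P a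

/-- A function of quantities that is definable with parameters. -/
def QFun (f : (α → Q) → Q) : Prop :=
  M.QDef fun a : Option α → Q => a none = f fun i => a (some i)

variable {M}

namespace UDef

theorem and {P R : (α → M.Univ) → Prop} (hP : M.UDef P) (hR : M.UDef R) :
    M.UDef fun x => P x ∧ R x := Definable.inter hP hR

theorem not {P : (α → M.Univ) → Prop} (hP : M.UDef P) : M.UDef fun x => ¬P x :=
  Definable.compl hP

theorem or {P R : (α → M.Univ) → Prop} (hP : M.UDef P) (hR : M.UDef R) :
    M.UDef fun x => P x ∨ R x := Definable.union hP hR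

theorem congr {P R : (α → M.Univ) → Prop} (hP : M.UDef P) (h : ∀ x, R x ↔ P x) : M.UDef R := by
  have : R = P := funext fun x => propext (h x)
  rwa [this]

theorem iff {P R : (α → M.Univ) → Prop} (hP : M.UDef P) (hR : M.UDef R) :
    M.UDef fun x => P x ↔ R x :=
  ((hP.and hR).or (hP.not.and hR.not)).congr fun _ => by tauto

theorem reindex {P : (α → M.Univ) → Prop} (hP : M.UDef P) (g : α → β) :
    M.UDef fun x : β → M.Univ => P fun i => x (g i) :=
  Definable.preimage_comp g hP

theorem ex [Finite β] {P : (α → M.Univ) → (β → M.Univ) → Prop}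
    (hP : M.UDef fun x : α ⊕ β → M.Univ => P (fun i => x (.inl i)) fun i => x (.inr i)) :
    M.UDef fun x => ∃ y, P x y :=
  Definable.exists_of_finite hP

theorem all [Finite β] {P : (α → M.Univ) → (β → M.Univ) → Prop}
    (hP : M.UDef fun x : α ⊕ β → M.Univ => P (fun i => x (.inl i)) fun i => x (.inr i)) :
    M.UDef fun x => ∀ y, P x y :=
  Definable.forall_of_finite hP

theorem all_fin [Finite β] {P : β → (α → M.Univ) → Prop} (hP : ∀ j, M.UDef (P j)) :
    M.UDef fun x => ∀ j, P j x := by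
  have := definable_iInter_of_finite hP
  unfold UDef
  rwa [ofPred_forall]

theorem rel {r : ℕ} (R : FrameRel n r) : M.UDef fun x : Fin r → M.Univ => M.interp R x := by
  have h : (∅ : Set M.Univ).Definable (frameLang n) {x : Fin r → M.Univ | M.interp R x} := by
    rw [empty_definable_iff]
    refine ⟨Language.Relations.formula (L := frameLang n) (R : (frameLang n).Relations r)
      fun i => Language.Term.var i, ?_⟩
    ext x
    simp only [mem_ofPred_eq]
    rfl
  exact h.mono (empty_subset _)

/-- The arguments of an atomic formula may be variables or parameters; the language has no function
symbols. -/
theorem rel_subst {r : ℕ} (R : FrameRel n r) {F : (α → M.Univ) → Fin r → M.Univ}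
    (hF : ∀ j, (∃ i, ∀ x, F x j = x i) ∨ ∃ c, ∀ x, F x j = c) : M.UDef fun x => M.interp R (F x) := by
  refine Definable.preimage_map (F := F) (fun j => ?_) (rel R)
  rcases hF j with ⟨i, hi⟩ | ⟨c, hc⟩
  · simp only [hi]
    exact DefinableFun.proj _
  · simp only [hc]
    exact Language.definableFun_const (frameLang n) α (mem_univ c)

theorem eq_const (i : α) (c : M.Univ) : M.UDef fun x : α → M.Univ => x i = c :=
  DefinableFun.ofPred_eq_const (DefinableFun.proj _) (mem_univ c)

theorem eq_var (i j : α) : M.UDef fun x : α → M.Univ => x i = x j :=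
  DefinableFun.ofPred_eq (DefinableFun.proj _) (DefinableFun.proj _)

theorem qty (i : α) : M.UDef fun x : α → M.Univ => ∃ q, x i = Univ.qty q :=
  rel_subst (F := fun x (_ : Fin 1) => x i) .quantity fun _ => Or.inl ⟨i, fun _ => rfl⟩

end UDef

namespace QDef

theorem congr {P R : (α → Q) → Prop} (hP : M.QDef P) (h : ∀ x, R x ↔ P x) : M.QDef R := by
  have : R = P := funext fun x => propext (h x)
  rwa [this]

theorem and {P R : (α → Q) → Prop} (hP : M.QDef P) (hR : M.QDef R) :
    M.QDef fun x => P x ∧ R x := by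
  refine (UDef.and hP hR).congr fun x => ?_
  constructor
  · rintro ⟨a, ha, h1, h2⟩
    exact ⟨⟨a, ha, h1⟩, a, ha, h2⟩
  · rintro ⟨⟨a, ha, h1⟩, a', ha', h2⟩
    have : a = a' := funext fun i => by
      have := (ha i).symm.trans (ha' i)
      injection this
    subst this
    exact ⟨a, ha, h1, h2⟩

theorem or {P R : (α → Q) → Prop} (hP : M.QDef P) (hR : M.QDef R) :
    M.QDef fun x => P x ∨ R x := by
  refine (UDef.or hP hR).congr fun x => ?_
  constructor
  · rintro ⟨a, ha, h | h⟩
    · exact Or.inl ⟨a, ha, h⟩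
    · exact Or.inr ⟨a, ha, h⟩
  · rintro (⟨a, ha, h⟩ | ⟨a, ha, h⟩)
    · exact ⟨a, ha, Or.inl h⟩
    · exact ⟨a, ha, Or.inr h⟩

/-- A complement in the two-sorted universe also contains tuples with bodies as entries. These are
cut away by a finite conjunction of sort conditions. -/
theorem not [Finite α] {P : (α → Q) → Prop} (hP : M.QDef P) : M.QDef fun x => ¬P x := by
  refine ((UDef.not hP).and (UDef.all_fin fun i => UDef.qty i)).congr fun x => ?_
  constructor
  · rintro ⟨a, ha, h⟩
    refine ⟨?_, fun i => ⟨a i, ha i⟩⟩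
    rintro ⟨a', ha', h'⟩
    have : a = a' := funext fun i => by
      have := (ha i).symm.trans (ha' i)
      injection this
    subst this
    exact h h'
  · rintro ⟨h, hq⟩
    choose a ha using hq
    exact ⟨a, ha, fun h' => h ⟨a, ha, h'⟩⟩

theorem imp [Finite α] {P R : (α → Q) → Prop} (hP : M.QDef P) (hR : M.QDef R) :
    M.QDef fun x => P x → R x :=
  (hP.not.or hR).congr fun _ => by tauto

theorem reindex [Finite β] {P : (α → Q) → Prop} (hP : M.QDef P) (g : α → β) :
    M.QDef fun x : β → Q => P fun i => x (g i) := by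
  refine ((UDef.reindex hP g).and (UDef.all_fin fun i => UDef.qty i)).congr fun x => ?_
  constructor
  · rintro ⟨a, ha, h⟩
    exact ⟨⟨fun i => a (g i), fun i => ha _, h⟩, fun i => ⟨a i, ha i⟩⟩
  · rintro ⟨⟨a', ha', h⟩, hq⟩
    choose a ha using hq
    have : a' = fun i => a (g i) := funext fun i => by
      have := (ha' i).symm.trans (ha (g i))
      injection this
    subst this
    exact ⟨a, ha, h⟩

theorem ex_tuple [Finite β] {P : (α → Q) → (β → Q) → Prop}
    (hP : M.QDef fun x : α ⊕ β → Q => P (fun i => x (.inl i)) fun i => x (.inr i)) :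
    M.QDef fun x => ∃ y, P x y := by
  refine (UDef.ex (β := β) (P := fun x y => ∃ a : α ⊕ β → Q,
    (∀ i, Sum.elim x y i = Univ.qty (a i)) ∧ P (fun i => a (.inl i)) fun i => a (.inr i)) ?_).congr
    fun x => ?_
  · refine UDef.congr hP fun x => ?_
    have : (Sum.elim (fun i => x (.inl i)) fun i => x (.inr i)) = x := by
      funext i
      cases i <;> rfl
    rw [this]
  · constructor
    · rintro ⟨a, ha, b, h⟩
      refine ⟨fun j => Univ.qty (b j), Sum.elim a b, fun i => ?_, h⟩
      cases i with
      | inl i => exact ha i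
      | inr i => rfl
    · rintro ⟨y, a, ha, h⟩
      exact ⟨fun i => a (.inl i), fun i => ha (.inl i), fun i => a (.inr i), h⟩

theorem ex [Finite α] {P : (α → Q) → Q → Prop}
    (hP : M.QDef fun x : Option α → Q => P (fun i => x (some i)) (x none)) :
    M.QDef fun x => ∃ y, P x y := by
  have h : M.QDef fun x => ∃ y : Unit → Q, P x (y ()) :=
    ex_tuple (hP.reindex (fun o : Option α => o.elim (Sum.inr ()) Sum.inl))
  refine h.congr fun x => ⟨fun ⟨y, hy⟩ => ⟨fun _ => y, hy⟩, fun ⟨y, hy⟩ => ⟨_, hy⟩⟩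

theorem all [Finite α] {P : (α → Q) → Q → Prop}
    (hP : M.QDef fun x : Option α → Q => P (fun i => x (some i)) (x none)) :
    M.QDef fun x => ∀ y, P x y :=
  ((ex (P := fun x y => ¬P x y) hP.not).not).congr fun x => by push Not; rfl

theorem all_fin [Finite α] [Finite β] {P : β → (α → Q) → Prop} (hP : ∀ j, M.QDef (P j)) :
    M.QDef fun x => ∀ j, P j x := by
  refine ((UDef.all_fin hP).and (UDef.all_fin fun i : α => UDef.qty i)).congr fun x => ?_
  constructor
  · rintro ⟨a, ha, h⟩
    exact ⟨fun j => ⟨a, ha, h j⟩, fun i => ⟨a i, ha i⟩⟩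
  · rintro ⟨h, hq⟩
    choose a ha using hq
    refine ⟨a, ha, fun j => ?_⟩
    obtain ⟨a', ha', h'⟩ := h j
    have : a = a' := funext fun i => by
      have := (ha i).symm.trans (ha' i)
      injection this
    rwa [this]

theorem rel3 (R : FrameRel n 3) (op : Q → Q → Q)
    (hR : ∀ x : Fin 3 → M.Univ, M.interp R x ↔
      ∃ p q, x 0 = Univ.qty p ∧ x 1 = Univ.qty q ∧ x 2 = Univ.qty (op p q)) :
    M.QDef fun a : Fin 3 → Q => op (a 0) (a 1) = a 2 := by
  refine (UDef.rel R).congr fun x => ?_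
  rw [hR]
  constructor
  · rintro ⟨a, ha, h⟩
    exact ⟨a 0, a 1, ha 0, ha 1, by rw [ha 2, h]⟩
  · rintro ⟨p, q, h0, h1, h2⟩
    refine ⟨![p, q, op p q], fun i => ?_, rfl⟩
    fin_cases i
    · exact h0
    · exact h1
    · exact h2

theorem add_rel : M.QDef fun a : Fin 3 → Q => a 0 + a 1 = a 2 :=
  rel3 .add (· + ·) fun _ => Iff.rfl

theorem mul_rel : M.QDef fun a : Fin 3 → Q => a 0 * a 1 = a 2 :=
  rel3 .mul (· * ·) fun _ => Iff.rfl

theorem lt_rel : M.QDef fun a : Fin 2 → Q => a 0 < a 1 := by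
  refine (UDef.rel .lt).congr fun x => ?_
  constructor
  · rintro ⟨a, ha, h⟩
    exact ⟨a 0, a 1, ha 0, ha 1, h⟩
  · rintro ⟨p, q, h0, h1, h2⟩
    refine ⟨![p, q], fun i => ?_, h2⟩
    fin_cases i
    · exact h0
    · exact h1

theorem eq_const [Finite α] (i : α) (c : Q) : M.QDef fun a : α → Q => a i = c := by
  refine ((UDef.eq_const i (Univ.qty c)).and (UDef.all_fin fun i : α => UDef.qty i)).congr fun x => ?_
  constructor
  · rintro ⟨a, ha, h⟩
    exact ⟨by rw [ha i, h], fun i => ⟨a i, ha i⟩⟩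
  · rintro ⟨h, hq⟩
    choose a ha using hq
    refine ⟨a, ha, ?_⟩
    have := (ha i).symm.trans h
    injection this

theorem eq_var [Finite α] (i j : α) : M.QDef fun a : α → Q => a i = a j := by
  refine ((UDef.eq_var i j).and (UDef.all_fin fun i : α => UDef.qty i)).congr fun x => ?_
  constructor
  · rintro ⟨a, ha, h⟩
    exact ⟨by rw [ha i, ha j, h], fun i => ⟨a i, ha i⟩⟩
  · rintro ⟨h, hq⟩
    choose a ha using hq
    refine ⟨a, ha, ?_⟩
    have := ((ha i).symm.trans h).trans (ha j)
    injection this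

/-- Substitution of definable functions. -/
theorem subst [Finite α] [Finite β] {P : (β → Q) → Prop} (hP : M.QDef P) {f : β → (α → Q) → Q}
    (hf : ∀ j, M.QFun (f j)) : M.QDef fun a => P fun j => f j a := by
  have h : M.QDef fun a : α → Q => ∃ y : β → Q, (∀ j, y j = f j a) ∧ P y := by
    refine ex_tuple ((all_fin fun j => ?_).and (hP.reindex Sum.inr))
    exact (hf j).reindex fun o : Option α => o.elim (Sum.inr j) Sum.inl
  refine h.congr fun a => ⟨fun h => ⟨_, fun _ => rfl, h⟩, ?_⟩
  rintro ⟨y, hy, h⟩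
  rwa [show y = fun j => f j a from funext hy] at h

theorem comp [Finite α] {S : Q → Prop} (hS : M.QDef fun a : Fin 1 → Q => S (a 0))
    {f : (α → Q) → Q} (hf : M.QFun f) : M.QDef fun a => S (f a) :=
  hS.subst (f := fun _ => f) fun _ => hf

theorem lt [Finite α] {f g : (α → Q) → Q} (hf : M.QFun f) (hg : M.QFun g) :
    M.QDef fun a => f a < g a := by
  refine (lt_rel (M := M)).subst (f := ![f, g]) fun j => ?_
  fin_cases j
  · exact hf
  · exact hg

theorem eq [Finite α] {f g : (α → Q) → Q} (hf : M.QFun f) (hg : M.QFun g) :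
    M.QDef fun a => f a = g a := by
  refine (eq_var (M := M) (0 : Fin 2) 1).subst (f := ![f, g]) fun j => ?_
  fin_cases j
  · exact hf
  · exact hg

theorem le [Finite α] {f g : (α → Q) → Q} (hf : M.QFun f) (hg : M.QFun g) :
    M.QDef fun a => f a ≤ g a :=
  (lt hg hf).not.congr fun _ => not_lt.symm

end QDef

namespace QFun

theorem var [Finite α] (i : α) : M.QFun fun a : α → Q => a i :=
  QDef.eq_var none (some i)

theorem const [Finite α] (c : Q) : M.QFun fun _ : α → Q => c :=
  QDef.eq_const none c

theorem comp_tuple [Finite α] [Finite β] {g : (β → Q) → Q} (hg : M.QFun g) {f : β → (α → Q) → Q}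
    (hf : ∀ j, M.QFun (f j)) : M.QFun fun a => g fun j => f j a := by
  refine QDef.subst (P := fun b : Option β → Q => b none = g fun j => b (some j)) hg
    (f := fun o (a : Option α → Q) => o.elim (a none) fun j => f j fun i => a (some i)) fun o => ?_
  cases o with
  | none => exact var none
  | some j => exact (hf j).reindex fun o : Option α => o.elim none fun i => some (some i)

theorem comp [Finite α] {g : Q → Q} (hg : M.QFun fun a : Fin 1 → Q => g (a 0)) {f : (α → Q) → Q}
    (hf : M.QFun f) : M.QFun fun a => g (f a) :=
  hg.comp_tuple (f := fun _ => f) fun _ => hf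

theorem binop {op : Q → Q → Q} (h : M.QDef fun a : Fin 3 → Q => op (a 0) (a 1) = a 2)
    [Finite α] {f g : (α → Q) → Q} (hf : M.QFun f) (hg : M.QFun g) :
    M.QFun fun a => op (f a) (g a) := by
  have h2 : M.QFun fun a : Fin 2 → Q => op (a 0) (a 1) := by
    refine (h.reindex ![some 0, some 1, none]).congr fun a => ?_
    simp [eq_comm]
  refine h2.comp_tuple (f := ![f, g]) fun j => ?_
  fin_cases j
  · exact hf
  · exact hg

theorem add [Finite α] {f g : (α → Q) → Q} (hf : M.QFun f) (hg : M.QFun g) :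
    M.QFun fun a => f a + g a := binop QDef.add_rel hf hg

theorem mul [Finite α] {f g : (α → Q) → Q} (hf : M.QFun f) (hg : M.QFun g) :
    M.QFun fun a => f a * g a := binop QDef.mul_rel hf hg

theorem congr {f g : (α → Q) → Q} (hf : M.QFun f) (h : ∀ a, g a = f a) : M.QFun g := by
  rwa [show g = f from funext h]

theorem neg [Finite α] {f : (α → Q) → Q} (hf : M.QFun f) : M.QFun fun a => -f a :=
  ((const (-1)).mul hf).congr fun _ => by ring

theorem sub [Finite α] {f g : (α → Q) → Q} (hf : M.QFun f) (hg : M.QFun g) :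
    M.QFun fun a => f a - g a := (hf.add hg.neg).congr fun _ => by ring

theorem sum [Finite α] {ι : Type} (s : Finset ι) {f : ι → (α → Q) → Q} (hf : ∀ i, M.QFun (f i)) :
    M.QFun fun a => ∑ i ∈ s, f i a := by
  classical
  induction s using Finset.induction_on with
  | empty => exact (const 0).congr fun _ => by simp
  | insert i s hi ih => exact ((hf i).add ih).congr fun _ => by rw [Finset.sum_insert hi]

/-- Functions obtained by choice or by cases are not terms; their definability comes from a relation
that characterizes the value. Such functions are given the value 0 off their domain, to make the
graph total. -/
theorem of_graph [Finite α] {f : (α → Q) → Q} {R : (α → Q) → Q → Prop}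
    (hR : M.QDef fun a : Option α → Q => R (fun i => a (some i)) (a none))
    (h : ∀ a y, R a y ↔ y = f a) : M.QFun f :=
  hR.congr fun _ => (h _ _).symm

theorem abs [IsStrictOrderedRing Q] [Finite α] {f : (α → Q) → Q} (hf : M.QFun f) :
    M.QFun fun a => |f a| := by
  have h1 : M.QFun fun a : Fin 1 → Q => |a 0| := by
    refine of_graph (R := fun a y => (0 ≤ a 0 ∧ y = a 0) ∨ (a 0 < 0 ∧ y = -a 0)) ?_ ?_
    · exact ((QDef.le (const 0) (var _)).and (QDef.eq_var _ _)).or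
        ((QDef.lt (var _) (const 0)).and (QDef.eq (var _) (var _).neg))
    · intro a y
      rcases le_or_gt 0 (a 0) with h | h
      · rw [abs_of_nonneg h]; simp [h, not_lt.mpr h]
      · rw [abs_of_neg h]; simp [h, not_le.mpr h]
  exact h1.comp hf

end QFun

theorem CONT.exists_isLUB (hM : M.CONT) {S : Q → Prop} (hS : M.QDef fun a : Fin 1 → Q => S (a 0))
    (hne : ∃ x, S x) {b : Q} (hb : ∀ x, S x → x ≤ b) : ∃ s, IsLUB {x | S x} s := by
  refine hM {x | S x} ?_ hne ⟨b, fun x hx => hb x hx⟩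
  refine UDef.congr hS fun x => ?_
  constructor
  · rintro ⟨a, ha, h⟩
    exact ⟨fun _ => a, fun i => by rw [Subsingleton.elim i 0, h], ha⟩
  · rintro ⟨a, ha, h⟩
    exact ⟨a 0, h, ha 0⟩

/-- The life-curve relation is definable. -/
theorem qdef_lifeCurve (M : WorldModel n B Q) (m k : B) :
    M.QDef fun a : Option (Fin (n + 1)) → Q => (a none, fun i => a (some i)) ∈ M.lifeCurve m k := by
  have hw : ∀ {γ : Type} {y z : (γ → M.Univ) → M.Univ} {r : Fin (n + 1) → γ},
      ((∃ i, ∀ x, y x = x i) ∨ ∃ c, ∀ x, y x = c) → ((∃ i, ∀ x, z x = x i) ∨ ∃ c, ∀ x, z x = c) →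
      M.UDef fun x => M.interp .world (Fin.cons (y x) (Fin.cons (z x) fun i => x (r i))) := by
    intro γ y z r hy hz
    refine UDef.rel_subst .world fun j => ?_
    refine Fin.cases hy (fun j => ?_) j
    refine Fin.cases hz (fun j => ?_) j
    exact Or.inl ⟨r j, fun _ => rfl⟩
  have hint : ∀ (m : B) (z : M.Univ) (p : Coord n Q),
      M.interp .world (Fin.cons (Univ.body m) (Fin.cons z fun i => Univ.qty (p i))) ↔
        ∃ b, z = Univ.body b ∧ M.W m b p := by
    intro m z p
    constructor
    · rintro ⟨m', b, p', h1, h2, h3, h4⟩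
      simp only [Fin.cons_zero, Univ.body.injEq] at h1
      have h3' : p = p' := funext fun i => by
        have := h3 i
        simp only [Fin.cons_succ, Univ.qty.injEq] at this
        exact this
      subst h1 h3'
      exact ⟨b, h2, h4⟩
    · rintro ⟨b, rfl, h⟩
      exact ⟨m, b, p, rfl, rfl, fun i => rfl, h⟩
  -- Equality of the event of k at q with that of m at the given point is expressed by quantifying
  -- over all z of the universe; for z a quantity both sides of the equivalence are false.
  have h : M.UDef fun x : Option (Fin (n + 1)) → M.Univ => ∃ q : Fin (n + 1) → M.Univ,
      ((∀ i, ∃ t, q i = Univ.qty t) ∧ (∀ i, ∃ t, x i = Univ.qty t)) ∧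
      (M.interp .world (Fin.cons (Univ.body k) (Fin.cons (Univ.body k) q)) ∧ q 0 = x none) ∧
      ∀ z : Unit → M.Univ, M.interp .world (Fin.cons (Univ.body k) (Fin.cons (z ()) q)) ↔
        M.interp .world (Fin.cons (Univ.body m) (Fin.cons (z ()) fun i => x (some i))) := by
    refine UDef.ex (((UDef.all_fin fun i => UDef.qty _).and (UDef.all_fin fun i => UDef.qty _)).and
      (((hw (Or.inr ⟨_, fun _ => rfl⟩) (Or.inr ⟨_, fun _ => rfl⟩)).and (UDef.eq_var _ _)).and
        (UDef.all (UDef.iff ?_ ?_))))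
    · exact hw (z := fun x => x (Sum.inr ())) (r := fun i => Sum.inl (Sum.inr i))
        (Or.inr ⟨_, fun _ => rfl⟩) (Or.inl ⟨Sum.inr (), fun _ => rfl⟩)
    · exact hw (z := fun x => x (Sum.inr ())) (r := fun i => Sum.inl (Sum.inl (some i)))
        (Or.inr ⟨_, fun _ => rfl⟩) (Or.inl ⟨Sum.inr (), fun _ => rfl⟩)
  refine h.congr fun x => ?_
  constructor
  · rintro ⟨a, ha, q, hq1, hq2, hq3⟩
    refine ⟨fun i => Univ.qty (q i), ⟨fun i => ⟨_, rfl⟩, fun i => ⟨_, ha i⟩⟩, ⟨?_, ?_⟩, fun z => ?_⟩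
    · rw [hint]
      exact ⟨k, rfl, hq1⟩
    · rw [ha none]
      exact congrArg Univ.qty hq3
    · rw [show (fun i => x (some i)) = fun i => Univ.qty (a (some i)) from funext fun i => ha _,
        hint, hint]
      have : ∀ b, M.W k b q ↔ M.W m b fun i => a (some i) := fun b =>
        (Set.ext_iff.mp hq2) b
      simp only [this]
  · rintro ⟨q, ⟨hq, hx⟩, ⟨h1, h2⟩, h3⟩
    choose q' hq' using hq
    choose a ha using hx
    obtain rfl : q = fun i => Univ.qty (q' i) := funext hq'
    simp only [show (fun i => x (some i)) = fun i => Univ.qty (a (some i)) from funext fun i => ha _,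
      hint] at h3
    rw [hint] at h1
    obtain ⟨k', hk', h1⟩ := h1
    injection hk' with hk'
    subst hk'
    refine ⟨a, ha, q', h1, ?_, ?_⟩
    · ext b
      have := h3 fun _ => Univ.body b
      simp only [Univ.body.injEq, exists_eq_left'] at this
      exact this
    · rw [ha none] at h2
      injection h2

end WorldModel

end Definability

/-! ### Definable calculus over an ordered field. -/

section Calculus

variable {n : ℕ} {B : Type u} {Q : Type v} [Field Q] [LinearOrder Q] [IsStrictOrderedRing Q]

/-- `f` has the derivative `y` at `x` relative to `I`. -/
def QDeriv (f : Q → Q) (I : Set Q) (x y : Q) : Prop :=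
  ∀ ε : Q, 0 < ε → ∃ δ : Q, 0 < δ ∧ ∀ z ∈ I, |z - x| < δ → |f z - f x - (z - x) * y| ≤ ε * |z - x|

/-- `f` is continuous at `x` relative to `I`. -/
def QCont (f : Q → Q) (I : Set Q) (x : Q) : Prop :=
  ∀ ε : Q, 0 < ε → ∃ δ : Q, 0 < δ ∧ ∀ z ∈ I, |z - x| < δ → |f z - f x| < ε

/-- `f` increases through `x` relative to `I`. -/
def IncAt (f : Q → Q) (I : Set Q) (x : Q) : Prop :=
  ∃ δ : Q, 0 < δ ∧ ∀ z ∈ I, |z - x| < δ → (x < z → f x < f z) ∧ (z < x → f z < f x)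

namespace QDeriv

variable {f g : Q → Q} {I J : Set Q} {x y y' : Q}

theorem mono (h : QDeriv f I x y) (hJ : J ⊆ I) : QDeriv f J x y := fun ε hε => by
  obtain ⟨δ, hδ, h⟩ := h ε hε
  exact ⟨δ, hδ, fun z hz => h z (hJ hz)⟩

theorem congr (h : QDeriv f I x y) (hx : x ∈ I) (hfg : ∀ z ∈ I, g z = f z) : QDeriv g I x y :=
  fun ε hε => by
    obtain ⟨δ, hδ, h⟩ := h ε hε
    refine ⟨δ, hδ, fun z hz hzx => ?_⟩
    rw [hfg z hz, hfg x hx]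
    exact h z hz hzx

theorem add (hf : QDeriv f I x y) (hg : QDeriv g I x y') :
    QDeriv (fun z => f z + g z) I x (y + y') := fun ε hε => by
  obtain ⟨δ, hδ, h⟩ := hf (ε / 2) (half_pos hε)
  obtain ⟨δ', hδ', h'⟩ := hg (ε / 2) (half_pos hε)
  refine ⟨min δ δ', lt_min hδ hδ', fun z hz hzx => ?_⟩
  have h1 := h z hz (hzx.trans_le (min_le_left _ _))
  have h2 := h' z hz (hzx.trans_le (min_le_right _ _))
  calc |f z + g z - (f x + g x) - (z - x) * (y + y')|
      = |(f z - f x - (z - x) * y) + (g z - g x - (z - x) * y')| := by congr 1; ring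
    _ ≤ _ := abs_add_le _ _
    _ ≤ ε / 2 * |z - x| + ε / 2 * |z - x| := add_le_add h1 h2
    _ = ε * |z - x| := by ring

theorem const_mul (hf : QDeriv f I x y) (c : Q) : QDeriv (fun z => c * f z) I x (c * y) :=
  fun ε hε => by
    have hc : 0 < |c| + 1 := by positivity
    obtain ⟨δ, hδ, h⟩ := hf (ε / (|c| + 1)) (div_pos hε hc)
    refine ⟨δ, hδ, fun z hz hzx => ?_⟩
    have h1 := h z hz hzx
    calc |c * f z - c * f x - (z - x) * (c * y)| = |c| * |f z - f x - (z - x) * y| := by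
          rw [← abs_mul]; congr 1; ring
      _ ≤ (|c| + 1) * (ε / (|c| + 1) * |z - x|) := by
          apply mul_le_mul _ h1 (abs_nonneg _) hc.le
          linarith
      _ = ε * |z - x| := by field_simp

theorem neg (hf : QDeriv f I x y) : QDeriv (fun z => -f z) I x (-y) := by
  simpa using hf.const_mul (-1)

theorem sub (hf : QDeriv f I x y) (hg : QDeriv g I x y') :
    QDeriv (fun z => f z - g z) I x (y - y') := by
  simpa [sub_eq_add_neg] using hf.add hg.neg

theorem const (c : Q) : QDeriv (fun _ => c) I x 0 := fun ε hε =>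
  ⟨1, one_pos, fun z _ _ => by simp; positivity⟩

theorem sum {ι : Type*} (s : Finset ι) {F : ι → Q → Q} {F' : ι → Q}
    (h : ∀ i, QDeriv (F i) I x (F' i)) : QDeriv (fun z => ∑ i ∈ s, F i z) I x (∑ i ∈ s, F' i) := by
  classical
  induction s using Finset.induction_on with
  | empty => simpa using const 0
  | insert i s hi ih => simpa only [Finset.sum_insert hi] using (h i).add ih

/-- Translation of the argument. -/
theorem comp_add (hf : QDeriv f I (x + c) y) (hJ : ∀ z ∈ J, z + c ∈ I) :
    QDeriv (fun z => f (z + c)) J x y := fun ε hε => by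
  obtain ⟨δ, hδ, h⟩ := hf ε hε
  refine ⟨δ, hδ, fun z hz hzx => ?_⟩
  have := h (z + c) (hJ z hz) (by rwa [add_sub_add_right_eq_sub])
  rwa [add_sub_add_right_eq_sub] at this

theorem lipschitz (h : QDeriv f I x y) :
    ∃ δ : Q, 0 < δ ∧ ∀ z ∈ I, |z - x| < δ → |f z - f x| ≤ (|y| + 1) * |z - x| := by
  obtain ⟨δ, hδ, h⟩ := h 1 one_pos
  refine ⟨δ, hδ, fun z hz hzx => ?_⟩
  calc |f z - f x| = |(f z - f x - (z - x) * y) + (z - x) * y| := by congr 1; ring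
    _ ≤ _ := abs_add_le _ _
    _ ≤ 1 * |z - x| + |z - x| * |y| := by
      rw [abs_mul]; exact add_le_add_left (h z hz hzx) _
    _ = (|y| + 1) * |z - x| := by ring

theorem cont (h : QDeriv f I x y) : QCont f I x := fun ε hε => by
  obtain ⟨δ, hδ, h⟩ := h.lipschitz
  have hy : 0 < |y| + 1 := by positivity
  refine ⟨min δ (ε / (|y| + 1)), lt_min hδ (div_pos hε hy), fun z hz hzx => ?_⟩
  refine (h z hz (hzx.trans_le (min_le_left _ _))).trans_lt ?_
  have := hzx.trans_le (min_le_right _ _)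
  rw [lt_div_iff₀ hy] at this
  linarith

/-- A positive derivative gives a lower bound for the growth. -/
theorem growth (h : QDeriv f I x y) (hy : 0 < y) : ∃ δ : Q, 0 < δ ∧ ∀ z ∈ I, |z - x| < δ →
    (x < z → y / 2 * (z - x) ≤ f z - f x) ∧ (z < x → y / 2 * (x - z) ≤ f x - f z) := by
  obtain ⟨δ, hδ, h⟩ := h (y / 2) (half_pos hy)
  refine ⟨δ, hδ, fun z hz hzx => ?_⟩
  have h1 := h z hz hzx
  constructor
  · intro hlt
    rw [abs_of_pos (sub_pos.mpr hlt)] at h1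
    have := (abs_le.mp h1).1
    linarith
  · intro hlt
    rw [abs_of_neg (sub_neg.mpr hlt)] at h1
    have := (abs_le.mp h1).2
    linarith

theorem incAt (h : QDeriv f I x y) (hy : 0 < y) : IncAt f I x := by
  obtain ⟨δ, hδ, h⟩ := h.growth hy
  refine ⟨δ, hδ, fun z hz hzx => ⟨fun hlt => ?_, fun hlt => ?_⟩⟩
  · have := (h z hz hzx).1 hlt
    have : 0 < y / 2 * (z - x) := mul_pos (half_pos hy) (sub_pos.mpr hlt)
    linarith
  · have := (h z hz hzx).2 hlt
    have : 0 < y / 2 * (x - z) := mul_pos (half_pos hy) (sub_pos.mpr hlt)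
    linarith

end QDeriv

/-- An interval with another point contains points arbitrarily near. -/
theorem exists_near {I : Set Q} (hI : I.OrdConnected) {x w : Q} (hx : x ∈ I) (hw : w ∈ I)
    (hne : w ≠ x) {δ : Q} (hδ : 0 < δ) : ∃ z ∈ I, z ≠ x ∧ |z - x| < δ ∧ (x < z ↔ x < w) := by
  rcases lt_or_gt_of_ne hne with h | h
  · refine ⟨max w (x - δ / 2), hI.out hw hx ⟨le_max_left _ _, max_le h.le (by linarith)⟩, ?_, ?_, ?_⟩
    · exact (max_lt h (by linarith)).ne
    · rw [abs_of_neg (sub_neg.mpr (max_lt h (by linarith)))]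
      have := le_max_right w (x - δ / 2)
      linarith
    · have := max_lt h (show x - δ / 2 < x by linarith)
      exact ⟨fun h' => absurd h' this.not_gt, fun h' => absurd h' h.not_gt⟩
  · refine ⟨min w (x + δ / 2), hI.out hx hw ⟨le_min h.le (by linarith), min_le_left _ _⟩, ?_, ?_, ?_⟩
    · exact (lt_min h (by linarith)).ne'
    · rw [abs_of_pos (sub_pos.mpr (lt_min h (by linarith)))]
      have := min_le_right w (x + δ / 2)
      linarith
    · exact ⟨fun _ => h, fun _ => lt_min h (by linarith)⟩

theorem QDeriv.unique {f : Q → Q} {I : Set Q} {x y y' w : Q} (hI : I.OrdConnected) (hx : x ∈ I)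
    (hw : w ∈ I) (hne : w ≠ x) (h : QDeriv f I x y) (h' : QDeriv f I x y') : y = y' := by
  by_contra hyy
  have hpos : 0 < |y - y'| := abs_pos.mpr (sub_ne_zero.mpr hyy)
  obtain ⟨δ, hδ, h⟩ := (h.sub h') (|y - y'| / 2) (half_pos hpos)
  obtain ⟨z, hz, hzx, hzδ, -⟩ := exists_near hI hx hw hne hδ
  have h1 := h z hz hzδ
  have hzp : 0 < |z - x| := abs_pos.mpr (sub_ne_zero.mpr hzx)
  simp only [sub_self, zero_sub, abs_neg, abs_mul] at h1
  have : 0 < |z - x| * |y - y'| := mul_pos hzp hpos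
  linarith

namespace WorldModel

variable {M : WorldModel n B Q}

/-- A definable set of quantities. -/
def QSet (M : WorldModel n B Q) (I : Set Q) : Prop := M.QDef fun a : Fin 1 → Q => a 0 ∈ I

/-- A definable function of one quantity. -/
def QMap (M : WorldModel n B Q) (f : Q → Q) : Prop := M.QFun fun a : Fin 1 → Q => f (a 0)

/-- The supremum of the initial segments on which T holds satisfies T by `hl`, and `hr` would push
it further if it were less than b. This replaces compactness arguments for definable properties. -/
theorem real_induction (hc : M.CONT) {a b : Q} {T : Q → Prop} (hT : M.QDef fun x : Fin 1 → Q => T (x 0))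
    (h0 : T a)
    (hr : ∀ x, a ≤ x → x < b → T x → ∃ δ, 0 < δ ∧ ∀ y, x < y → y < x + δ → y ≤ b → T y)
    (hl : ∀ x, a < x → x ≤ b → (∀ y, a ≤ y → y < x → T y) → T x) {x : Q} (hax : a ≤ x)
    (hxb : x ≤ b) : T x := by
  have hab := hax.trans hxb
  obtain ⟨s, hs⟩ := hc.exists_isLUB
    (S := fun x => (a ≤ x ∧ x ≤ b) ∧ ∀ y, a ≤ y → y ≤ x → T y) (b := b)
    (((QDef.le (.const _) (.var _)).and (QDef.le (.var _) (.const _))).and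
      (QDef.all ((QDef.le (.const _) (.var _)).imp ((QDef.le (.var _) (.var _)).imp
        (hT.comp (.var _))))))
    ⟨a, ⟨le_rfl, hab⟩, fun y h1 h2 => by rwa [le_antisymm h2 h1]⟩ (fun x hx => hx.1.2)
  have has : a ≤ s := hs.1 ⟨⟨le_rfl, hab⟩, fun y h1 h2 => by rwa [le_antisymm h2 h1]⟩
  have hsb : s ≤ b := hs.2 fun x hx => hx.1.2
  have hlt : ∀ y, a ≤ y → y < s → T y := by
    intro y hay hys
    obtain ⟨x, hx, hyx⟩ := (lt_isLUB_iff hs).mp hys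
    exact hx.2 y hay hyx.le
  have hTs : T s := by
    rcases has.eq_or_lt with h | h
    · rwa [← h]
    · exact hl s h hsb hlt
  have hle : ∀ y, a ≤ y → y ≤ s → T y := fun y hay hys => by
    rcases hys.eq_or_lt with h | h
    · rwa [h]
    · exact hlt y hay h
  rcases hsb.eq_or_lt with h | h
  · exact hle x hax (by rwa [h])
  · obtain ⟨δ, hδ, hδT⟩ := hr s has h hTs
    have hlt' : s < min b (s + δ / 2) := lt_min h (by linarith)
    have hmem : min b (s + δ / 2) ≤ s := hs.1 ⟨⟨has.trans hlt'.le, min_le_left _ _⟩,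
      fun y hay hy => by
        rcases le_or_gt y s with h' | h'
        · exact hle y hay h'
        · refine hδT y h' ?_ (hy.trans (min_le_left _ _))
          have := hy.trans (min_le_right _ _)
          linarith⟩
    exact absurd hlt' hmem.not_gt

/-- A definable property that holds or fails locally is constant on intervals. -/
theorem locally_constant (hc : M.CONT) {I : Set Q} (hI : I.OrdConnected) {T : Q → Prop}
    (hT : M.QDef fun x : Fin 1 → Q => T (x 0))
    (h1 : ∀ x ∈ I, T x → ∃ δ, 0 < δ ∧ ∀ z ∈ I, |z - x| < δ → T z)
    (h2 : ∀ x ∈ I, ¬T x → ∃ δ, 0 < δ ∧ ∀ z ∈ I, |z - x| < δ → ¬T z) {a b : Q} (ha : a ∈ I)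
    (hb : b ∈ I) (hTa : T a) : T b := by
  have key : ∀ {a b : Q} {T : Q → Prop}, (M.QDef fun x : Fin 1 → Q => T (x 0)) →
      (∀ x ∈ I, T x → ∃ δ, 0 < δ ∧ ∀ z ∈ I, |z - x| < δ → T z) →
      (∀ x ∈ I, ¬T x → ∃ δ, 0 < δ ∧ ∀ z ∈ I, |z - x| < δ → ¬T z) → a ∈ I → b ∈ I → a ≤ b → T a →
      T b := by
    intro a b T hT h1 h2 ha hb hab hTa
    refine real_induction hc hT hTa ?_ ?_ hab le_rfl
    · intro x hax hxb hx
      obtain ⟨δ, hδ, h⟩ := h1 x (hI.out ha hb ⟨hax, hxb.le⟩) hx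
      refine ⟨δ, hδ, fun y hxy hyδ hyb => h y (hI.out ha hb ⟨hax.trans hxy.le, hyb⟩) ?_⟩
      rw [abs_of_pos (sub_pos.mpr hxy)]
      linarith
    · intro x hax hxb hx
      by_contra hn
      have hxI := hI.out ha hb ⟨hax.le, hxb⟩
      obtain ⟨δ, hδ, h⟩ := h2 x hxI hn
      have hlt : max a (x - δ / 2) < x := max_lt hax (by linarith)
      refine h (max a (x - δ / 2)) (hI.out ha hxI ⟨le_max_left _ _, hlt.le⟩) ?_
        (hx _ (le_max_left _ _) hlt)
      rw [abs_of_neg (sub_neg.mpr hlt)]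
      have := le_max_right a (x - δ / 2)
      linarith
  rcases le_total a b with h | h
  · exact key hT h1 h2 ha hb h hTa
  · by_contra hn
    exact key hT.not h2 (fun x hx hx' => by
      simp only [not_not] at hx' ⊢
      exact h1 x hx hx') hb ha h hn hTa

theorem ivt (hc : M.CONT) {f : Q → Q} (hf : M.QMap f) {a b y : Q} (hab : a ≤ b)
    (hcont : ∀ x ∈ Set.Icc a b, QCont f (Set.Icc a b) x) (ha : f a ≤ y) (hb : y ≤ f b) :
    ∃ x ∈ Set.Icc a b, f x = y := by
  obtain ⟨s, hs⟩ := hc.exists_isLUB (S := fun x => (a ≤ x ∧ x ≤ b) ∧ f x ≤ y) (b := b)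
    (((QDef.le (.const _) (.var _)).and (QDef.le (.var _) (.const _))).and
      (QDef.le (QFun.comp hf (.var _)) (.const _))) ⟨a, ⟨le_rfl, hab⟩, ha⟩ (fun x hx => hx.1.2)
  have has : a ≤ s := hs.1 ⟨⟨le_rfl, hab⟩, ha⟩
  have hsb : s ≤ b := hs.2 fun x hx => hx.1.2
  refine ⟨s, ⟨has, hsb⟩, ?_⟩
  rcases lt_trichotomy (f s) y with h | h | h
  · exfalso
    have hsb' : s < b := hsb.lt_of_ne (fun h' => by rw [h'] at h; exact absurd h hb.not_gt)
    obtain ⟨δ, hδ, hδ'⟩ := hcont s ⟨has, hsb⟩ (y - f s) (by linarith)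
    have hlt : s < min b (s + δ / 2) := lt_min hsb' (by linarith)
    have hm : min b (s + δ / 2) ∈ Set.Icc a b := ⟨has.trans hlt.le, min_le_left _ _⟩
    have := hδ' _ hm (by
      rw [abs_of_pos (sub_pos.mpr hlt)]
      have := min_le_right b (s + δ / 2)
      linarith)
    have := (abs_lt.mp this).2
    exact absurd hlt (hs.1 ⟨hm, by linarith⟩).not_gt
  · exact h
  · exfalso
    obtain ⟨δ, hδ, hδ'⟩ := hcont s ⟨has, hsb⟩ (f s - y) (by linarith)
    obtain ⟨x, hx, hxs⟩ := (lt_isLUB_iff hs).mp (show s - δ < s by linarith)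
    have hxs' : x ≤ s := hs.1 hx
    have := hδ' x hx.1 (by rw [abs_of_nonpos (by linarith)]; linarith)
    have := (abs_lt.mp this).1
    have := hx.2
    linarith

/-- A function that increases through each point is increasing. -/
theorem lt_of_incAt (hc : M.CONT) {f : Q → Q} (hf : M.QMap f) {a b : Q} (hab : a < b)
    (hinc : ∀ x ∈ Set.Icc a b, IncAt f (Set.Icc a b) x) : f a < f b := by
  have : b = a ∨ f a < f b := by
    refine real_induction hc (T := fun x => x = a ∨ f a < f x) (a := a) (b := b)
      ((QDef.eq (.var _) (.const _)).or (QDef.lt (.const _) (QFun.comp hf (.var _)))) (Or.inl rfl) ?_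
      ?_ hab.le le_rfl
    · intro x hax hxb hx
      obtain ⟨δ, hδ, h⟩ := hinc x ⟨hax, hxb.le⟩
      refine ⟨δ, hδ, fun y hxy hyδ hyb => Or.inr ?_⟩
      have := (h y ⟨hax.trans hxy.le, hyb⟩ (by rw [abs_of_pos (sub_pos.mpr hxy)]; linarith)).1 hxy
      rcases hx with rfl | hx
      · exact this
      · exact hx.trans this
    · intro x hax hxb hx
      obtain ⟨δ, hδ, h⟩ := hinc x ⟨hax.le, hxb⟩
      have hlt : max a (x - δ / 2) < x := max_lt hax (by linarith)
      have h1 := (h _ ⟨le_max_left _ _, hlt.le.trans hxb⟩ (by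
        rw [abs_of_neg (sub_neg.mpr hlt)]
        have := le_max_right a (x - δ / 2)
        linarith)).2 hlt
      rcases hx _ (le_max_left _ _) hlt with h2 | h2
      · rw [h2] at h1; exact Or.inr h1
      · exact Or.inr (h2.trans h1)
  exact this.resolve_left hab.ne'

/-- A continuous function that increases or decreases through each point of an interval, and that
increases through the first point, increases through the last point. -/
theorem incAt_of_incAt (hc : M.CONT) {f : Q → Q} (hf : M.QMap f) {a b : Q} (hab : a < b)
    (hcont : ∀ x ∈ Set.Icc a b, QCont f (Set.Icc a b) x)
    (hinc : ∀ x ∈ Set.Icc a b, IncAt f (Set.Icc a b) x ∨ IncAt (fun z => -f z) (Set.Icc a b) x)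
    (ha : IncAt f (Set.Icc a b) a) : IncAt f (Set.Icc a b) b := by
  have hfv : ∀ {γ : Type} [Finite γ] (i : γ), M.QFun fun x : γ → Q => f (x i) :=
    fun i => QFun.comp hf (.var i)
  -- s is the last point at which f is maximal on the segment from a. The aim is s = b.
  obtain ⟨s, hs⟩ := hc.exists_isLUB
    (S := fun x => (a ≤ x ∧ x ≤ b) ∧ ∀ z, a ≤ z → z ≤ x → f z ≤ f x) (b := b)
    (((QDef.le (.const _) (.var _)).and (QDef.le (.var _) (.const _))).and
      (QDef.all ((QDef.le (.const _) (.var _)).imp ((QDef.le (.var _) (.var _)).imp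
        (QDef.le (hfv _) (hfv _))))))
    ⟨a, ⟨le_rfl, hab.le⟩, fun y h1 h2 => by rw [le_antisymm h2 h1]⟩ (fun x hx => hx.1.2)
  have has : a ≤ s := hs.1 ⟨⟨le_rfl, hab.le⟩, fun y h1 h2 => by rw [le_antisymm h2 h1]⟩
  have hsb : s ≤ b := hs.2 fun x hx => hx.1.2
  have hsT : ∀ z, a ≤ z → z ≤ s → f z ≤ f s := by
    intro z haz hzs
    rcases hzs.eq_or_lt with h | h
    · rw [h]
    by_contra hlt
    push Not at hlt
    obtain ⟨δ, hδ, hδ'⟩ := hcont s ⟨has, hsb⟩ (f z - f s) (by linarith)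
    obtain ⟨x, hx, hxs⟩ := (lt_isLUB_iff hs).mp (max_lt h (show s - δ < s by linarith))
    have hxs' : x ≤ s := hs.1 hx
    have h1 := hx.2 z haz ((le_max_left _ _).trans hxs.le)
    have h2 := (le_max_right _ _).trans_lt hxs
    have := hδ' x hx.1 (by rw [abs_of_nonpos (by linarith)]; linarith)
    have := (abs_lt.mp this).2
    linarith
  have hsinc : IncAt f (Set.Icc a b) s := by
    rcases has.eq_or_lt with h | h
    · rwa [← h]
    · refine (hinc s ⟨has, hsb⟩).resolve_right ?_
      rintro ⟨δ, hδ, hd⟩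
      have hlt : max a (s - δ / 2) < s := max_lt h (by linarith)
      have := (hd _ ⟨le_max_left _ _, hlt.le.trans hsb⟩ (by
        rw [abs_of_neg (sub_neg.mpr hlt)]
        have := le_max_right a (s - δ / 2)
        linarith)).2 hlt
      have := hsT _ (le_max_left _ _) hlt.le
      linarith
  rcases hsb.eq_or_lt with h | h
  · rwa [h] at hsinc
  exfalso
  obtain ⟨δ, hδ, hd⟩ := hsinc
  set y := min b (s + δ / 2) with hy
  have hsy : s < y := lt_min h (by linarith)
  have hyb : y ≤ b := min_le_left _ _
  have hyδ : y - s < δ := by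
    have := min_le_right b (s + δ / 2)
    linarith
  have hfy : f s < f y := (hd y ⟨has.trans hsy.le, hyb⟩
    (by rwa [abs_of_pos (sub_pos.mpr hsy)])).1 hsy
  -- If s < b, then f takes a value f y > f s just after s. The first point c at which this level is
  -- reached is again maximal on its initial segment and lies beyond s, a contradiction.
  obtain ⟨c, hcl⟩ := hc.exists_isLUB
    (S := fun x => (s ≤ x ∧ x ≤ y) ∧ ∀ z, s ≤ z → z ≤ x → f z < f y) (b := y)
    (((QDef.le (.const _) (.var _)).and (QDef.le (.var _) (.const _))).and
      (QDef.all ((QDef.le (.const _) (.var _)).imp ((QDef.le (.var _) (.var _)).imp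
        (QDef.lt (hfv _) (.const _))))))
    ⟨s, ⟨le_rfl, hsy.le⟩, fun z h1 h2 => by rwa [le_antisymm h2 h1]⟩ (fun x hx => hx.1.2)
  have hsc : s ≤ c := hcl.1 ⟨⟨le_rfl, hsy.le⟩, fun z h1 h2 => by rwa [le_antisymm h2 h1]⟩
  have hcy : c ≤ y := hcl.2 fun x hx => hx.1.2
  have hclt : ∀ z, s ≤ z → z < c → f z < f y := by
    intro z hsz hzc
    obtain ⟨x, hx, hzx⟩ := (lt_isLUB_iff hcl).mp hzc
    exact hx.2 z hsz hzx.le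
  have hfc : f y ≤ f c := by
    rcases hcy.eq_or_lt with h' | h'
    · rw [h']
    by_contra hlt
    push Not at hlt
    obtain ⟨η, hη, hd'⟩ := hcont c ⟨has.trans hsc, hcy.trans hyb⟩ (f y - f c) (by linarith)
    have hlt' : c < min y (c + η / 2) := lt_min h' (by linarith)
    refine absurd hlt' (hcl.1 ⟨⟨hsc.trans hlt'.le, min_le_left _ _⟩, fun z hsz hz => ?_⟩).not_gt
    rcases lt_or_ge z c with h'' | h''
    · exact hclt z hsz h''
    · have h1 := hz.trans (min_le_right _ _)
      have := hd' z ⟨has.trans hsz, (hz.trans (min_le_left _ _)).trans hyb⟩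
        (by rw [abs_of_nonneg (by linarith)]; linarith)
      have := (abs_lt.mp this).2
      linarith
  have hsc' : s < c := hsc.lt_of_ne (fun h' => by rw [← h'] at hfc; linarith)
  refine absurd hsc' (hs.1 ⟨⟨has.trans hsc, hcy.trans hyb⟩, fun z haz hzc => ?_⟩).not_gt
  rcases le_or_gt z s with h' | h'
  · have := hsT z haz h'
    linarith
  · rcases hzc.eq_or_lt with h'' | h''
    · rw [h'']
    · exact ((hclt z h'.le h'').trans_le hfc).le

/-- A nowhere vanishing derivative has constant sign. -/
theorem deriv_sign (hc : M.CONT) {f f' : Q → Q} (hf : M.QMap f) {I : Set Q} (hI : I.OrdConnected)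
    (hd : ∀ x ∈ I, QDeriv f I x (f' x)) (hne : ∀ x ∈ I, f' x ≠ 0) :
    (∀ x ∈ I, 0 < f' x) ∨ ∀ x ∈ I, f' x < 0 := by
  have key : ∀ {g g' : Q → Q}, M.QMap g → (∀ x ∈ I, QDeriv g I x (g' x)) → (∀ x ∈ I, g' x ≠ 0) →
      ∀ a ∈ I, ∀ b ∈ I, a < b → 0 < g' a → 0 < g' b := by
    intro g g' hg hd hne a ha b hb hab hpos
    have hsub : Set.Icc a b ⊆ I := hI.out ha hb
    have hd' : ∀ x ∈ Set.Icc a b, QDeriv g (Set.Icc a b) x (g' x) :=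
      fun x hx => (hd x (hsub hx)).mono hsub
    -- The derivative need not be continuous, so the intermediate value theorem does not apply to
    -- it; a Darboux argument on the function itself is used.
    have hinc := incAt_of_incAt hc hg hab (fun x hx => (hd' x hx).cont) (fun x hx => by
      rcases lt_or_gt_of_ne (hne x (hsub hx)) with h | h
      · exact Or.inr ((hd' x hx).neg.incAt (neg_pos.mpr h))
      · exact Or.inl ((hd' x hx).incAt h)) ((hd' a ⟨le_rfl, hab.le⟩).incAt hpos)
    rcases lt_or_gt_of_ne (hne b hb) with h | h
    · exfalso
      obtain ⟨δ, hδ, h1⟩ := hinc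
      obtain ⟨δ', hδ', h2⟩ := (hd' b ⟨hab.le, le_rfl⟩).neg.incAt (neg_pos.mpr h)
      obtain ⟨z, hz, hzx, hzδ, hiff⟩ := exists_near (I := Set.Icc a b) Set.ordConnected_Icc
        (x := b) (w := a) ⟨hab.le, le_rfl⟩ ⟨le_rfl, hab.le⟩ hab.ne (lt_min hδ hδ')
      have hzb : z < b := hzx.lt_or_gt.resolve_right fun h => absurd (hiff.mp h) hab.not_gt
      have e1 := (h1 z hz (hzδ.trans_le (min_le_left _ _))).2 hzb
      have e2 := (h2 z hz (hzδ.trans_le (min_le_right _ _))).2 hzb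
      linarith
    · exact h
  by_cases hall : ∀ x ∈ I, 0 < f' x
  · exact Or.inl hall
  · right
    push Not at hall
    obtain ⟨x, hx, hle⟩ := hall
    have hneg : f' x < 0 := hle.lt_of_ne (hne x hx)
    have hdn : ∀ x ∈ I, QDeriv (fun z => -f z) I x (-f' x) := fun x hx => (hd x hx).neg
    have hfn : M.QMap fun z => -f z := QFun.neg hf
    intro y hy
    rcases lt_trichotomy x y with h | h | h
    · have := key hfn (g' := fun x => -f' x) hdn (fun x hx => neg_ne_zero.mpr (hne x hx)) x hx y hy h
        (neg_pos.mpr hneg)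
      exact neg_pos.mp this
    · rwa [← h]
    · by_contra hn
      push Not at hn
      have := key hf hd hne y hy x hx h (hn.lt_of_ne (hne y hy).symm)
      linarith

theorem strictMonoOn_of_deriv_pos (hc : M.CONT) {f f' : Q → Q} (hf : M.QMap f) {I : Set Q}
    (hI : I.OrdConnected) (hd : ∀ x ∈ I, QDeriv f I x (f' x)) (hpos : ∀ x ∈ I, 0 < f' x) :
    StrictMonoOn f I := by
  intro a ha b hb hab
  have hsub : Set.Icc a b ⊆ I := hI.out ha hb
  exact lt_of_incAt hc hf hab fun x hx => ((hd x (hsub hx)).mono hsub).incAt (hpos x (hsub hx))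

/-- The derivative of a definable function is definable. -/
theorem QMap.deriv {f f' : Q → Q} (hf : M.QMap f) {I : Set Q} (hI : I.OrdConnected)
    (hId : M.QSet I) (hI2 : ∀ x ∈ I, ∃ w ∈ I, w ≠ x) (hd : ∀ x ∈ I, QDeriv f I x (f' x))
    (h0 : ∀ x ∉ I, f' x = 0) : M.QMap f' := by
  have hfv : ∀ {γ : Type} [Finite γ] (i : γ), M.QFun fun x : γ → Q => f (x i) :=
    fun i => QFun.comp hf (.var i)
  have hIv : ∀ {γ : Type} [Finite γ] (i : γ), M.QDef fun x : γ → Q => x i ∈ I :=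
    fun i => QDef.comp (S := fun z => z ∈ I) hId (.var i)
  -- The ε-δ condition is itself first-order, and uniqueness of derivatives on I makes it the graph
  -- of f' there; off I the value is 0.
  refine QFun.of_graph (R := fun a y => (a 0 ∈ I ∧ ∀ ε, 0 < ε → ∃ δ, 0 < δ ∧ ∀ z, z ∈ I →
    |z - a 0| < δ → |f z - f (a 0) - (z - a 0) * y| ≤ ε * |z - a 0|) ∨ (¬ a 0 ∈ I ∧ y = 0)) ?_ ?_
  · refine QDef.or (QDef.and (hIv _) (QDef.all ?_)) ((hIv _).not.and (QDef.eq (.var _) (.const _)))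
    refine QDef.imp (QDef.lt (.const _) (.var _)) (QDef.ex ?_)
    refine QDef.and (QDef.lt (.const _) (.var _)) (QDef.all ?_)
    refine QDef.imp (hIv _) (QDef.imp ?_ ?_)
    · exact QDef.lt (QFun.abs (.sub (.var _) (.var _))) (.var _)
    · exact QDef.le (QFun.abs (.sub (.sub (hfv _) (hfv _)) (.mul (.sub (.var _) (.var _)) (.var _))))
        (.mul (.var _) (QFun.abs (.sub (.var _) (.var _))))
  · intro a y
    by_cases h : a 0 ∈ I
    · simp only [h, true_and, not_true_eq_false, false_and, or_false]
      obtain ⟨w, hw, hne⟩ := hI2 _ h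
      constructor
      · intro h'
        exact QDeriv.unique hI h hw hne h' (hd _ h)
      · rintro rfl
        exact hd _ h
    · simp [h, h0 _ h]

end WorldModel

/-- The derivative of an inverse function. -/
theorem QDeriv.of_inverse {f g h : Q → Q} {J K : Set Q} {s y z : Q} (hJ : J.OrdConnected)
    (hmono : StrictMonoOn f J) (hg : ∀ t ∈ K, g t ∈ J) (hs : s ∈ K)
    (hfg : ∀ t ∈ K, f (g t) = h t) (hf : QDeriv f J (g s) y) (hy : 0 < y) (hh : QDeriv h K s z) :
    QDeriv g K s (z / y) := by
  obtain ⟨η, hη, hgr⟩ := hf.growth hy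
  obtain ⟨κ, hκ, hlip⟩ := hh.lipschitz
  set C := (|z| + 1) * 2 / y with hC
  have hCpos : 0 < C := by positivity
  -- No continuity of g is assumed. Near g s the growth estimate bounds distances in the argument by
  -- distances in the value; farther away strict monotonicity keeps the values at least that far
  -- apart.
  have hlow : ∀ t ∈ J, |f t - f (g s)| < y / 2 * (η / 2) → |t - g s| ≤ 2 / y * |f t - f (g s)| := by
    intro t ht hlt
    rcases lt_trichotomy t (g s) with h1 | h1 | h1
    · have hm := hmono ht (hg s hs) h1
      rw [abs_of_neg (sub_neg.mpr hm)] at hlt ⊢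
      rw [abs_of_neg (sub_neg.mpr h1)]
      by_cases hnear : |t - g s| < η
      · have := (hgr t ht hnear).2 h1
        rw [div_mul_eq_mul_div, le_div_iff₀ hy]
        linarith
      · exfalso
        rw [abs_of_neg (sub_neg.mpr h1)] at hnear
        have hJ' : g s - η / 2 ∈ J := hJ.out ht (hg s hs) ⟨by linarith, by linarith⟩
        have := (hgr _ hJ' (by rw [abs_of_neg (by linarith)]; linarith)).2 (by linarith)
        have := hmono ht hJ' (by linarith)
        linarith
    · rw [h1]; simp
    · have hm := hmono (hg s hs) ht h1
      rw [abs_of_pos (sub_pos.mpr hm)] at hlt ⊢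
      rw [abs_of_pos (sub_pos.mpr h1)]
      by_cases hnear : |t - g s| < η
      · have := (hgr t ht hnear).1 h1
        rw [div_mul_eq_mul_div, le_div_iff₀ hy]
        linarith
      · exfalso
        rw [abs_of_pos (sub_pos.mpr h1)] at hnear
        have hJ' : g s + η / 2 ∈ J := hJ.out (hg s hs) ht ⟨by linarith, by linarith⟩
        have := (hgr _ hJ' (by rw [abs_of_pos (by linarith)]; linarith)).1 (by linarith)
        have := hmono hJ' ht (by linarith)
        linarith
  obtain ⟨δ₀, hδ₀, hcont⟩ := hh.cont (y / 2 * (η / 2)) (by positivity)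
  have hgl : ∀ t ∈ K, |t - s| < min δ₀ κ → |g t - g s| ≤ C * |t - s| := by
    intro t ht hlt
    have h1 := hlow (g t) (hg t ht) (by
      rw [hfg t ht, hfg s hs]
      exact hcont t ht (hlt.trans_le (min_le_left _ _)))
    rw [hfg t ht, hfg s hs] at h1
    have h2 := hlip t ht (hlt.trans_le (min_le_right _ _))
    calc |g t - g s| ≤ 2 / y * |h t - h s| := h1
      _ ≤ 2 / y * ((|z| + 1) * |t - s|) := mul_le_mul_of_nonneg_left h2 (by positivity)
      _ = C * |t - s| := by rw [hC]; ring
  intro ε hε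
  obtain ⟨δ₁, hδ₁, hf1⟩ := hf (ε * y / (2 * C)) (by positivity)
  obtain ⟨δ₂, hδ₂, hh2⟩ := hh (ε * y / 2) (by positivity)
  refine ⟨min (min δ₀ κ) (min δ₂ (δ₁ / C)), by positivity, fun t ht hlt => ?_⟩
  have hlt1 := hlt.trans_le (min_le_left _ _)
  have hlt2 := hlt.trans_le ((min_le_right _ _).trans (min_le_left _ _))
  have hlt3 := hlt.trans_le ((min_le_right _ _).trans (min_le_right _ _))
  rw [lt_div_iff₀ hCpos] at hlt3
  have e0 := hgl t ht hlt1
  have e1 := hf1 (g t) (hg t ht) (by linarith)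
  have e2 := hh2 t ht hlt2
  rw [hfg t ht, hfg s hs] at e1
  -- The error of g times y is the error of h minus the error of f at g t; each receives half of ε
  -- y.
  have e3 : |(g t - g s - (t - s) * (z / y)) * y| ≤ ε * y / 2 * |t - s| + ε * y / 2 * |t - s| := by
    calc |(g t - g s - (t - s) * (z / y)) * y|
        = |(h t - h s - (t - s) * z) - (h t - h s - (g t - g s) * y)| := by
          congr 1; field_simp; ring
      _ ≤ _ := abs_sub _ _
      _ ≤ ε * y / 2 * |t - s| + ε * y / (2 * C) * (C * |t - s|) := by
          refine add_le_add e2 (e1.trans ?_)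
          exact mul_le_mul_of_nonneg_left e0 (by positivity)
      _ = _ := by field_simp
  rw [abs_mul, abs_of_pos hy] at e3
  refine le_of_mul_le_mul_right (e3.trans_eq ?_) hy
  ring

end Calculus

/-! ### Curves and radar coordinates in the Minkowski plane. -/

section PlaneCurves

open WorldModel

variable {n : ℕ} {B : Type u} {Q : Type v} [Field Q] [LinearOrder Q] [IsStrictOrderedRing Q]

/-- A definable curve in the Minkowski plane, in light coordinates `U` and `V`, that is parametrized by
proper time. -/
structure PlaneLife (M : WorldModel n B Q) (I : Set Q) (U V U' V' : Q → Q) : Prop where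
  ord : I.OrdConnected
  defI : M.QSet I
  two : ∀ x ∈ I, ∃ w ∈ I, w ≠ x
  mapU : M.QMap U
  mapV : M.QMap V
  derivU : ∀ x ∈ I, QDeriv U I x (U' x)
  derivV : ∀ x ∈ I, QDeriv V I x (V' x)
  unit : ∀ x ∈ I, U' x * V' x = 1

/-- The point with light coordinates `u` and `v` lies at the radar time `s` and at the signed radar
distance `ρ` from the curve. -/
def RadarPoint (I : Set Q) (U V : Q → Q) (ρ s u v : Q) : Prop :=
  s - ρ ∈ I ∧ s + ρ ∈ I ∧ u = U (s - ρ) ∧ v = V (s + ρ)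

/-- Spatial reflection: it exchanges the light coordinates and the sign of the radar distance, and
keeps the radar time. -/
theorem RadarPoint.swap {I : Set Q} {U V : Q → Q} {ρ s u v : Q} (h : RadarPoint I U V ρ s u v) :
    RadarPoint I V U (-ρ) s v u := by
  obtain ⟨h1, h2, h3, h4⟩ := h
  refine ⟨?_, ?_, ?_, ?_⟩
  · rwa [sub_neg_eq_add]
  · rwa [← sub_eq_add_neg]
  · rwa [sub_neg_eq_add]
  · rwa [← sub_eq_add_neg]

theorem QDeriv.comp_neg {f : Q → Q} {I : Set Q} {x y : Q} (h : QDeriv f I (-x) y) :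
    QDeriv (fun z => f (-z)) {z | -z ∈ I} x (-y) := fun ε hε => by
  obtain ⟨δ, hδ, h⟩ := h ε hε
  refine ⟨δ, hδ, fun z hz hzx => ?_⟩
  have e : |-z - -x| = |z - x| := by rw [neg_sub_neg, abs_sub_comm]
  have := h (-z) hz (by rwa [e])
  rw [e] at this
  rwa [show f (-z) - f (-x) - (z - x) * -y = f (-z) - f (-x) - (-z - -x) * y by ring]

namespace PlaneLife

variable {M : WorldModel n B Q} {I J K : Set Q} {U V U' V' Ub Vb Ub' Vb' Uc Vc Uc' Vc' : Q → Q}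

theorem swap (h : PlaneLife M I U V U' V') : PlaneLife M I V U V' U' :=
  ⟨h.ord, h.defI, h.two, h.mapV, h.mapU, h.derivV, h.derivU, fun x hx => by
    rw [mul_comm, h.unit x hx]⟩

/-- Reversal of coordinate time takes (u, v) to (-v, -u). -/
theorem timeReverse (h : PlaneLife M I U V U' V') :
    PlaneLife M I (fun x => -V x) (fun x => -U x) (fun x => -V' x) (fun x => -U' x) :=
  ⟨h.ord, h.defI, h.two, QFun.neg h.mapV, QFun.neg h.mapU, fun x hx => (h.derivV x hx).neg,
    fun x hx => (h.derivU x hx).neg, fun x hx => by rw [neg_mul_neg, mul_comm, h.unit x hx]⟩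

/-- Reversal of the curve's own time. No axiom fixes whether clocks of different observers run in
the same direction. -/
theorem reparam_neg (h : PlaneLife M I U V U' V') :
    PlaneLife M {z | -z ∈ I} (fun x => U (-x)) (fun x => V (-x)) (fun x => -U' (-x))
      (fun x => -V' (-x)) := by
  refine ⟨⟨fun x hx y hy z hz => ?_⟩, ?_, fun x hx => ?_, ?_, ?_, ?_, ?_, ?_⟩
  · exact h.ord.out hy hx ⟨neg_le_neg hz.2, neg_le_neg hz.1⟩
  · exact QDef.comp (S := fun z => z ∈ I) h.defI (QFun.neg (QFun.var _))
  · obtain ⟨w, hw, hne⟩ := h.two (-x) hx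
    refine ⟨-w, by simpa using hw, fun h => hne ?_⟩
    rw [← h, neg_neg]
  · exact QFun.comp h.mapU (QFun.neg (QFun.var _))
  · exact QFun.comp h.mapV (QFun.neg (QFun.var _))
  · exact fun x hx => (h.derivU (-x) hx).comp_neg
  · exact fun x hx => (h.derivV (-x) hx).comp_neg
  · intro x hx
    rw [neg_mul_neg]
    exact h.unit (-x) hx

/-- U' cannot vanish because U' V' = 1, so its sign is constant by the Darboux property. -/
theorem sign (hc : M.CONT) (h : PlaneLife M I U V U' V') :
    (∀ x ∈ I, 0 < U' x) ∨ ∀ x ∈ I, U' x < 0 :=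
  WorldModel.deriv_sign hc h.mapU h.ord h.derivU fun x hx h0 => by
    have := h.unit x hx
    rw [h0, zero_mul] at this
    exact zero_ne_one this

theorem pos_right (h : PlaneLife M I U V U' V') (hU : ∀ x ∈ I, 0 < U' x) (x : Q) (hx : x ∈ I) :
    0 < V' x :=
  pos_of_mul_pos_right (by rw [h.unit x hx]; exact one_pos) (hU x hx).le

theorem strictMonoU (hc : M.CONT) (h : PlaneLife M I U V U' V') (hU : ∀ x ∈ I, 0 < U' x) :
    StrictMonoOn U I := WorldModel.strictMonoOn_of_deriv_pos hc h.mapU h.ord h.derivU hU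

theorem strictMonoV (hc : M.CONT) (h : PlaneLife M I U V U' V') (hU : ∀ x ∈ I, 0 < U' x) :
    StrictMonoOn V I :=
  WorldModel.strictMonoOn_of_deriv_pos hc h.mapV h.ord h.derivV (h.pos_right hU)

theorem injOnU (hc : M.CONT) (h : PlaneLife M I U V U' V') : I.InjOn U := by
  rcases h.sign hc with hU | hU
  · exact (h.strictMonoU hc hU).injOn
  · intro x hx y hy hxy
    have := (h.timeReverse.strictMonoV hc (fun x hx => ?_)).injOn hx hy (by simp [hxy])
    · exact this
    · have h1 : 0 < (-U' x) * (-V' x) := by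
        rw [neg_mul_neg, h.unit x hx]; exact one_pos
      exact pos_of_mul_pos_right h1 (neg_pos.mpr (hU x hx)).le

/-- The proper time of a curve at constant signed radar distance as a function of the radar time, in
case the parametrizations have the same orientation. -/
theorem exists_clock_of_pos (hc : M.CONT) (h : PlaneLife M I U V U' V') (hU : ∀ x ∈ I, 0 < U' x)
    (hb : PlaneLife M J Ub Vb Ub' Vb') (hUb : ∀ x ∈ J, 0 < Ub' x) {ρ : Q}
    (hf : ∀ t ∈ J, ∃ s, RadarPoint I U V ρ s (Ub t) (Vb t)) {t₁ t₂ s₁ s₂ : Q} (ht₁ : t₁ ∈ J)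
    (ht₂ : t₂ ∈ J) (hs : s₁ < s₂) (h₁ : RadarPoint I U V ρ s₁ (Ub t₁) (Vb t₁))
    (h₂ : RadarPoint I U V ρ s₂ (Ub t₂) (Vb t₂)) :
    (∀ s ∈ Set.Icc s₁ s₂, ∃ t ∈ J, RadarPoint I U V ρ s (Ub t) (Vb t)) ∧
    ∃ g, M.QMap g ∧ |t₂ - t₁| = g s₂ - g s₁ ∧ ∀ s ∈ Set.Icc s₁ s₂, ∃ r, 0 < r ∧
      r * r = U' (s - ρ) * V' (s + ρ) ∧ QDeriv g (Set.Icc s₁ s₂) s r := by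
  have mU := h.strictMonoU hc hU
  have mUb := hb.strictMonoU hc hUb
  have mVb := hb.strictMonoV hc hUb
  have hVb := hb.pos_right hUb
  have hlt : t₁ < t₂ := by
    rw [← mUb.lt_iff_lt ht₁ ht₂, h₁.2.2.1, h₂.2.2.1, mU.lt_iff_lt h₁.1 h₂.1]
    linarith
  have hsub : Set.Icc t₁ t₂ ⊆ J := hb.ord.out ht₁ ht₂
  have hm : ∀ s ∈ Set.Icc s₁ s₂, s - ρ ∈ I := fun s hs =>
    h.ord.out h₁.1 h₂.1 ⟨by linarith [hs.1], by linarith [hs.2]⟩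
  have hp : ∀ s ∈ Set.Icc s₁ s₂, s + ρ ∈ I := fun s hs =>
    h.ord.out h₁.2.1 h₂.2.1 ⟨by linarith [hs.1], by linarith [hs.2]⟩
  -- The intermediate value theorem provides t with the right u. The radar time that `hf` assigns to
  -- t must then be s, because U is injective, and this yields the right v.
  have hsurj : ∀ s, s ∈ Set.Icc s₁ s₂ → ∃ t ∈ Set.Icc t₁ t₂, Ub t = U (s - ρ) ∧ Vb t = V (s + ρ) := by
    intro s hs
    obtain ⟨t, ht, hts⟩ := WorldModel.ivt (y := U (s - ρ)) hc hb.mapU hlt.le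
      (fun x hx => ((hb.derivU x (hsub hx)).mono hsub).cont)
      (by rw [h₁.2.2.1, mU.le_iff_le h₁.1 (hm s hs)]; linarith [hs.1])
      (by rw [h₂.2.2.1, mU.le_iff_le (hm s hs) h₂.1]; linarith [hs.2])
    obtain ⟨s', hs'⟩ := hf t (hsub ht)
    have : s' = s := by
      have := mU.injOn hs'.1 (hm s hs) (by rw [← hs'.2.2.1, hts])
      linarith
    exact ⟨t, ht, hts, by rw [hs'.2.2.2, this]⟩
  refine ⟨fun s hs => ?_, ?_⟩
  · obtain ⟨t, ht, h3, h4⟩ := hsurj s hs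
    exact ⟨t, hsub ht, hm s hs, hp s hs, h3, h4⟩
  classical
  set g : Q → Q := fun s => if hs : s ∈ Set.Icc s₁ s₂ then (hsurj s hs).choose else 0 with hg
  have hgs : ∀ s ∈ Set.Icc s₁ s₂, g s ∈ Set.Icc t₁ t₂ ∧ Ub (g s) = U (s - ρ) ∧
      Vb (g s) = V (s + ρ) := by
    intro s hs
    have := (hsurj s hs).choose_spec
    simp only [hg, dif_pos hs]
    exact this
  have hs₁ : s₁ ∈ Set.Icc s₁ s₂ := ⟨le_rfl, hs.le⟩
  have hs₂ : s₂ ∈ Set.Icc s₁ s₂ := ⟨hs.le, le_rfl⟩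
  have hg₁ : g s₁ = t₁ := mUb.injOn (hsub (hgs s₁ hs₁).1) ht₁ (by rw [(hgs s₁ hs₁).2.1, h₁.2.2.1])
  have hg₂ : g s₂ = t₂ := mUb.injOn (hsub (hgs s₂ hs₂).1) ht₂ (by rw [(hgs s₂ hs₂).2.1, h₂.2.2.1])
  refine ⟨g, ?_, ?_, ?_⟩
  · refine QFun.of_graph (R := fun a y => ((s₁ ≤ a 0 ∧ a 0 ≤ s₂) ∧ (t₁ ≤ y ∧ y ≤ t₂) ∧
      Ub y = U (a 0 - ρ)) ∨ (¬(s₁ ≤ a 0 ∧ a 0 ≤ s₂) ∧ y = 0)) ?_ ?_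
    · refine QDef.or (QDef.and ?_ (QDef.and ?_ ?_)) (QDef.and (QDef.not ?_) ?_)
      · exact (QDef.le (.const _) (.var _)).and (QDef.le (.var _) (.const _))
      · exact (QDef.le (.const _) (.var _)).and (QDef.le (.var _) (.const _))
      · exact QDef.eq (QFun.comp hb.mapU (.var _)) (QFun.comp h.mapU (.sub (.var _) (.const _)))
      · exact (QDef.le (.const _) (.var _)).and (QDef.le (.var _) (.const _))
      · exact QDef.eq (.var _) (.const _)
    · intro a y
      by_cases ha : s₁ ≤ a 0 ∧ a 0 ≤ s₂
      · simp only [ha, true_and, and_self, not_true_eq_false, false_and, or_false]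
        constructor
        · rintro ⟨hy, hy'⟩
          exact mUb.injOn (hsub hy) (hsub (hgs _ ha).1) (by rw [hy', (hgs _ ha).2.1])
        · rintro rfl
          exact ⟨(hgs _ ha).1, (hgs _ ha).2.1⟩
      · simp only [ha, false_and, not_false_eq_true, true_and, false_or]
        simp only [hg]
        rw [dif_neg (show ¬a 0 ∈ Set.Icc s₁ s₂ from ha)]
  · rw [hg₁, hg₂, abs_of_pos (sub_pos.mpr hlt)]
  · intro s hs
    have hJ := hsub (hgs s hs).1
    -- The rate of the clock is computed twice, from u as U' / Ub' and from v as V' / Vb'. The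
    -- product of the two expressions is U' V', since Ub' Vb' = 1.
    have d1 : QDeriv g (Set.Icc s₁ s₂) s (U' (s - ρ) / Ub' (g s)) := by
      refine QDeriv.of_inverse (h := fun t => U (t + -ρ)) hb.ord mUb (fun t ht => hsub (hgs t ht).1) hs
        (fun t ht => by rw [(hgs t ht).2.1, sub_eq_add_neg]) (hb.derivU _ hJ) (hUb _ hJ) ?_
      refine QDeriv.comp_add (I := I) ?_ fun z hz => ?_
      · rw [← sub_eq_add_neg]; exact h.derivU _ (hm s hs)
      · rw [← sub_eq_add_neg]; exact hm z hz
    have d2 : QDeriv g (Set.Icc s₁ s₂) s (V' (s + ρ) / Vb' (g s)) := by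
      refine QDeriv.of_inverse (h := fun t => V (t + ρ)) hb.ord mVb (fun t ht => hsub (hgs t ht).1) hs
        (fun t ht => by rw [(hgs t ht).2.2]) (hb.derivV _ hJ) (hVb _ hJ) ?_
      exact QDeriv.comp_add (I := I) (h.derivV _ (hp s hs)) fun z hz => hp z hz
    have hex : ∃ w ∈ Set.Icc s₁ s₂, w ≠ s := by
      by_cases h' : s₁ = s
      · exact ⟨s₂, hs₂, by rw [← h']; exact ne_of_gt ‹s₁ < s₂›⟩
      · exact ⟨s₁, hs₁, h'⟩
    obtain ⟨w, hw, hne⟩ := hex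
    have hr := d1.unique Set.ordConnected_Icc hs hw hne d2
    refine ⟨_, div_pos (hU _ (hm s hs)) (hUb _ hJ), ?_, d1⟩
    nth_rewrite 2 [hr]
    rw [div_mul_div_comm, hb.unit _ hJ, div_one]

/-- The proper time of a curve at constant signed radar distance as a function of the radar time. -/
theorem exists_clock (hc : M.CONT) (h : PlaneLife M I U V U' V') (hU : ∀ x ∈ I, 0 < U' x)
    (hb : PlaneLife M J Ub Vb Ub' Vb') {ρ : Q}
    (hf : ∀ t ∈ J, ∃ s, RadarPoint I U V ρ s (Ub t) (Vb t)) {t₁ t₂ s₁ s₂ : Q} (ht₁ : t₁ ∈ J)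
    (ht₂ : t₂ ∈ J) (hs : s₁ < s₂) (h₁ : RadarPoint I U V ρ s₁ (Ub t₁) (Vb t₁))
    (h₂ : RadarPoint I U V ρ s₂ (Ub t₂) (Vb t₂)) :
    (∀ s ∈ Set.Icc s₁ s₂, ∃ t ∈ J, RadarPoint I U V ρ s (Ub t) (Vb t)) ∧
    ∃ g, M.QMap g ∧ |t₂ - t₁| = g s₂ - g s₁ ∧ ∀ s ∈ Set.Icc s₁ s₂, ∃ r, 0 < r ∧
      r * r = U' (s - ρ) * V' (s + ρ) ∧ QDeriv g (Set.Icc s₁ s₂) s r := by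
  rcases hb.sign hc with hUb | hUb
  · exact h.exists_clock_of_pos hc hU hb hUb hf ht₁ ht₂ hs h₁ h₂
  · obtain ⟨h3, g, hg, hgt, hgd⟩ := h.exists_clock_of_pos (t₁ := -t₁) (t₂ := -t₂) hc hU hb.reparam_neg
      (fun x hx => neg_pos.mpr (hUb _ hx)) (fun t ht => hf (-t) ht) (by simpa using ht₁)
      (by simpa using ht₂) hs (by simpa using h₁) (by simpa using h₂)
    refine ⟨fun s hs => ?_, g, hg, ?_, hgd⟩
    · obtain ⟨t, ht, h4⟩ := h3 s hs
      exact ⟨-t, ht, h4⟩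
    · rw [← hgt, neg_sub_neg, abs_sub_comm]

/-- The clock at the greater signed radar distance runs faster. -/
theorem clock_lt (hc : M.CONT) (h : PlaneLife M I U V U' V') (hU : ∀ x ∈ I, 0 < U' x)
    (hV' : StrictMonoOn V' I) (hb : PlaneLife M J Ub Vb Ub' Vb') (hc' : PlaneLife M K Uc Vc Uc' Vc')
    {ρb ρc α : Q} (hρ : ρb < ρc) (hα : |α| ≤ ρc - ρb)
    (hfb : ∀ t ∈ J, ∃ s, RadarPoint I U V ρb s (Ub t) (Vb t))
    (hfc : ∀ t ∈ K, ∃ s, RadarPoint I U V ρc s (Uc t) (Vc t)) {t₁ t₂ x₁ x₂ s₁ s₂ : Q}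
    (ht₁ : t₁ ∈ J) (ht₂ : t₂ ∈ J) (hx₁ : x₁ ∈ K) (hx₂ : x₂ ∈ K) (hs : s₁ < s₂)
    (hb₁ : RadarPoint I U V ρb s₁ (Ub t₁) (Vb t₁)) (hb₂ : RadarPoint I U V ρb s₂ (Ub t₂) (Vb t₂))
    (hc₁ : RadarPoint I U V ρc (s₁ + α) (Uc x₁) (Vc x₁))
    (hc₂ : RadarPoint I U V ρc (s₂ + α) (Uc x₂) (Vc x₂)) : |t₂ - t₁| < |x₂ - x₁| := by
  obtain ⟨-, gb, hgb, hgbt, hgbd⟩ := h.exists_clock hc hU hb hfb ht₁ ht₂ hs hb₁ hb₂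
  obtain ⟨-, gc, hgc, hgct, hgcd⟩ := h.exists_clock hc hU hc' hfc hx₁ hx₂ (by linarith) hc₁ hc₂
  obtain ⟨hα1, hα2⟩ := abs_le.mp hα
  rw [hgbt, hgct]
  -- It suffices that the lead gc (s + α) - gb s of the front clock grows through each point.
  have hF : M.QMap fun s => gc (s + α) - gb s :=
    QFun.sub (QFun.comp hgc (.add (.var _) (.const _))) hgb
  have := WorldModel.lt_of_incAt hc hF hs fun s hsI => ?_
  · linarith
  obtain ⟨rb, hrb, hrb2, db⟩ := hgbd s hsI
  obtain ⟨rc, hrc, hrc2, dc⟩ := hgcd (s + α) ⟨by linarith [hsI.1], by linarith [hsI.2]⟩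
  have dc' : QDeriv (fun z => gc (z + α)) (Set.Icc s₁ s₂) s rc :=
    dc.comp_add fun z hz => ⟨by linarith [hz.1], by linarith [hz.2]⟩
  refine (dc'.sub db).incAt (sub_pos.mpr ?_)
  have mb : s - ρb ∈ I := h.ord.out hb₁.1 hb₂.1 ⟨by linarith [hsI.1], by linarith [hsI.2]⟩
  have pb : s + ρb ∈ I := h.ord.out hb₁.2.1 hb₂.2.1 ⟨by linarith [hsI.1], by linarith [hsI.2]⟩
  have mc : s + α - ρc ∈ I := h.ord.out hc₁.1 hc₂.1 ⟨by linarith [hsI.1], by linarith [hsI.2]⟩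
  have pc : s + α + ρc ∈ I := h.ord.out hc₁.2.1 hc₂.2.1 ⟨by linarith [hsI.1], by linarith [hsI.2]⟩
  have hV := h.pos_right hU
  have e1 : V' (s + ρb) ≤ V' (s + α + ρc) := (hV'.le_iff_le pb pc).mpr (by linarith)
  have e2 : V' (s + α - ρc) ≤ V' (s - ρb) := (hV'.le_iff_le mc mb).mpr (by linarith)
  have e3 : V' (s + ρb) < V' (s + α + ρc) ∨ V' (s + α - ρc) < V' (s - ρb) := by
    rcases lt_or_ge (s + ρb) (s + α + ρc) with h' | h'
    · exact Or.inl (hV' pb pc h')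
    · exact Or.inr (hV' mc mb (by linarith))
  have u1 : U' (s - ρb) = 1 / V' (s - ρb) := by
    rw [eq_div_iff (hV _ mb).ne', h.unit _ mb]
  have u2 : U' (s + α - ρc) = 1 / V' (s + α - ρc) := by
    rw [eq_div_iff (hV _ mc).ne', h.unit _ mc]
  have key : rb * rb < rc * rc := by
    rw [hrb2, hrc2, u1, u2, one_div_mul_eq_div, one_div_mul_eq_div,
      div_lt_div_iff₀ (hV _ mb) (hV _ mc)]
    rcases e3 with e3 | e3
    · exact mul_lt_mul e3 e2 (hV _ mc) (hV _ pc).le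
    · calc _ ≤ V' (s + α + ρc) * V' (s + α - ρc) := mul_le_mul_of_nonneg_right e1 (hV _ mc).le
        _ < _ := mul_lt_mul_of_pos_left e3 (hV _ pc)
  nlinarith

/-- The hypothesis on acceleration speaks only of spacelike separated points of b and c, so such a
pair must be exhibited before V' is known to increase. -/
theorem clock_lt_of_lt (hc : M.CONT) (h : PlaneLife M I U V U' V') (hU : ∀ x ∈ I, 0 < U' x)
    (hV0 : ∀ x ∉ I, V' x = 0) (hb : PlaneLife M J Ub Vb Ub' Vb')
    (hc' : PlaneLife M K Uc Vc Uc' Vc') {ρb ρc α : Q} (hρ : ρb < ρc) (hα : |α| ≤ ρc - ρb)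
    (hacc : ∀ t ∈ J, ∀ x ∈ K, (Uc x - Ub t) * (Vc x - Vb t) < 0 → ∀ s ∈ I, ∃ a,
      QDeriv V' I s a ∧ 0 < (Vc x - Vb t) * a)
    (hfb : ∀ t ∈ J, ∃ s, RadarPoint I U V ρb s (Ub t) (Vb t))
    (hfc : ∀ t ∈ K, ∃ s, RadarPoint I U V ρc s (Uc t) (Vc t)) {t₁ t₂ x₁ x₂ s₁ s₂ : Q}
    (ht₁ : t₁ ∈ J) (ht₂ : t₂ ∈ J) (hx₁ : x₁ ∈ K) (hx₂ : x₂ ∈ K) (hs : s₁ < s₂)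
    (hb₁ : RadarPoint I U V ρb s₁ (Ub t₁) (Vb t₁)) (hb₂ : RadarPoint I U V ρb s₂ (Ub t₂) (Vb t₂))
    (hc₁ : RadarPoint I U V ρc (s₁ + α) (Uc x₁) (Vc x₁))
    (hc₂ : RadarPoint I U V ρc (s₂ + α) (Uc x₂) (Vc x₂)) : |t₂ - t₁| < |x₂ - x₁| := by
  obtain ⟨hα1, hα2⟩ := abs_le.mp hα
  have mU := h.strictMonoU hc hU
  have mV := h.strictMonoV hc hU
  have sb := (h.exists_clock hc hU hb hfb ht₁ ht₂ hs hb₁ hb₂).1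
  have sc := (h.exists_clock hc hU hc' hfc hx₁ hx₂ (by linarith : s₁ + α < s₂ + α) hc₁ hc₂).1
  -- For |α| = ρc - ρb, as in photon simultaneity, corresponding points may be only lightlike
  -- separated. Moving one of them a little along its world-line, within the given stretch, makes
  -- the separation spacelike.
  obtain ⟨s, hsI, s', hsI', hlt⟩ : ∃ s ∈ Set.Icc s₁ s₂, ∃ s' ∈ Set.Icc (s₁ + α) (s₂ + α),
      |s' - s| < ρc - ρb := by
    set s := min s₂ (s₁ + (ρc - ρb) / 2) with hs_def
    have hs1 : s₁ < s := lt_min hs (by linarith)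
    have hs2 : s ≤ s₂ := min_le_left _ _
    have hs3 : s ≤ s₁ + (ρc - ρb) / 2 := min_le_right _ _
    rcases le_or_gt 0 α with h' | h'
    · exact ⟨s, ⟨hs1.le, hs2⟩, s₁ + α, ⟨le_rfl, by linarith⟩, abs_lt.mpr ⟨by linarith, by linarith⟩⟩
    · exact ⟨s₁, ⟨le_rfl, hs.le⟩, s + α, ⟨by linarith, by linarith⟩,
        abs_lt.mpr ⟨by linarith, by linarith⟩⟩
  obtain ⟨t, ht, hbt⟩ := sb s hsI
  obtain ⟨x, hx, hcx⟩ := sc s' hsI'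
  obtain ⟨hl1, hl2⟩ := abs_lt.mp hlt
  have dV : 0 < Vc x - Vb t := by
    rw [sub_pos, hbt.2.2.2, hcx.2.2.2, mV.lt_iff_lt hbt.2.1 hcx.2.1]
    linarith
  have dU : Uc x - Ub t < 0 := by
    rw [sub_neg, hbt.2.2.1, hcx.2.2.1, mU.lt_iff_lt hcx.1 hbt.1]
    linarith
  have hdd := hacc t ht x hx (mul_neg_of_neg_of_pos dU dV)
  choose! V'' hV'' hpos using hdd
  have mV' : StrictMonoOn V' I :=
    WorldModel.strictMonoOn_of_deriv_pos hc (h.mapV.deriv h.ord h.defI h.two h.derivV hV0) h.ord hV''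
      fun s hs => pos_of_mul_pos_right (hpos s hs) dV.le
  exact h.clock_lt hc hU mV' hb hc' hρ hα hfb hfc ht₁ ht₂ hx₁ hx₂ hs hb₁ hb₂ hc₁ hc₂

/-- The clock in the direction of the acceleration runs faster. -/
theorem clock_lt_of_ne (hc : M.CONT) (h : PlaneLife M I U V U' V') (hU : ∀ x ∈ I, 0 < U' x)
    (hU0 : ∀ x ∉ I, U' x = 0) (hV0 : ∀ x ∉ I, V' x = 0) (hb : PlaneLife M J Ub Vb Ub' Vb')
    (hc' : PlaneLife M K Uc Vc Uc' Vc') {ρb ρc α : Q} (hρ : ρb ≠ ρc) (hα : |α| ≤ |ρc - ρb|)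
    (hacc : ∀ t ∈ J, ∀ x ∈ K, (Uc x - Ub t) * (Vc x - Vb t) < 0 → ∀ s ∈ I, ∃ a a',
      (QDeriv U' I s a ∧ 0 < (Uc x - Ub t) * a) ∧ (QDeriv V' I s a' ∧ 0 < (Vc x - Vb t) * a'))
    (hfb : ∀ t ∈ J, ∃ s, RadarPoint I U V ρb s (Ub t) (Vb t))
    (hfc : ∀ t ∈ K, ∃ s, RadarPoint I U V ρc s (Uc t) (Vc t)) {t₁ t₂ x₁ x₂ s₁ s₂ : Q}
    (ht₁ : t₁ ∈ J) (ht₂ : t₂ ∈ J) (hx₁ : x₁ ∈ K) (hx₂ : x₂ ∈ K) (hs : s₁ < s₂)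
    (hb₁ : RadarPoint I U V ρb s₁ (Ub t₁) (Vb t₁)) (hb₂ : RadarPoint I U V ρb s₂ (Ub t₂) (Vb t₂))
    (hc₁ : RadarPoint I U V ρc (s₁ + α) (Uc x₁) (Vc x₁))
    (hc₂ : RadarPoint I U V ρc (s₂ + α) (Uc x₂) (Vc x₂)) : |t₂ - t₁| < |x₂ - x₁| := by
  rcases lt_or_gt_of_ne hρ with hlt | hlt
  · refine h.clock_lt_of_lt hc hU hV0 hb hc' hlt (hα.trans_eq (abs_of_pos (sub_pos.mpr hlt))) ?_ hfb
      hfc ht₁ ht₂ hx₁ hx₂ hs hb₁ hb₂ hc₁ hc₂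
    intro t ht x hx hneg s hs
    obtain ⟨a, a', -, h2⟩ := hacc t ht x hx hneg s hs
    exact ⟨a', h2⟩
  -- For ρc < ρb the plane is reflected, and U' takes the role of V'.
  · refine h.swap.clock_lt_of_lt hc (h.pos_right hU) hU0 hb.swap hc'.swap (neg_lt_neg hlt)
      (hα.trans_eq ?_) ?_
      (fun t ht => (hfb t ht).imp fun _ => RadarPoint.swap)
      (fun t ht => (hfc t ht).imp fun _ => RadarPoint.swap)
      ht₁ ht₂ hx₁ hx₂ hs hb₁.swap hb₂.swap hc₁.swap hc₂.swap
    · rw [abs_of_neg (sub_neg.mpr hlt)]; ring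
    · intro t ht x hx hneg s hs
      obtain ⟨a, a', h1, -⟩ := hacc t ht x hx (by rwa [mul_comm]) s hs
      exact ⟨a, h1⟩

/-- A curve at constant radar distance is at constant signed radar distance. -/
theorem exists_signed_distance (hc : M.CONT) (h : PlaneLife M I U V U' V')
    (hU : ∀ x ∈ I, 0 < U' x) (hb : PlaneLife M J Ub Vb Ub' Vb') {r : Q}
    (hr : ∀ t ∈ J, ∃ x ∈ I, ∃ y ∈ I, |x - y| = 2 * r ∧ Ub t = U x ∧ Vb t = V y) :
    ∃ ρ, ∀ t ∈ J, ∃ s, RadarPoint I U V ρ s (Ub t) (Vb t) := by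
  have mU := h.strictMonoU hc hU
  have mV := h.strictMonoV hc hU
  -- T and T' say that the point is spacelike separated from some point of the curve, on one side or
  -- on the other. Both are open conditions and exclude each other; for nonzero radar distance one
  -- of them holds, as the midpoint of the two instants shows.
  set T : Q → Prop := fun t => ∃ x, x ∈ I ∧ Ub t < U x ∧ V x < Vb t with hT
  set T' : Q → Prop := fun t => ∃ x, x ∈ I ∧ U x < Ub t ∧ Vb t < V x with hT'
  have hTdef : M.QDef fun a : Fin 1 → Q => T (a 0) :=
    QDef.ex (QDef.and (QDef.comp (S := fun z => z ∈ I) h.defI (.var _))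
      (QDef.and (QDef.lt (QFun.comp hb.mapU (.var _)) (QFun.comp h.mapU (.var _)))
        (QDef.lt (QFun.comp h.mapV (.var _)) (QFun.comp hb.mapV (.var _)))))
  have hmid : ∀ x ∈ I, ∀ y ∈ I, x < y → (x + y) / 2 ∈ I ∧ x < (x + y) / 2 ∧ (x + y) / 2 < y := by
    intro x hx y hy hxy
    exact ⟨h.ord.out hx hy ⟨by linarith, by linarith⟩, by linarith, by linarith⟩
  have hTlt : ∀ x ∈ I, ∀ y ∈ I, ∀ t, Ub t = U x → Vb t = V y → x < y → T t := by
    intro x hx y hy t h1 h2 hxy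
    obtain ⟨hm, h3, h4⟩ := hmid x hx y hy hxy
    exact ⟨_, hm, by rw [h1]; exact mU hx hm h3, by rw [h2]; exact mV hm hy h4⟩
  have hTgt : ∀ x ∈ I, ∀ y ∈ I, ∀ t, Ub t = U x → Vb t = V y → y < x → T' t := by
    intro x hx y hy t h1 h2 hxy
    obtain ⟨hm, h3, h4⟩ := hmid y hy x hx hxy
    exact ⟨_, hm, by rw [h1]; exact mU hm hx h4, by rw [h2]; exact mV hy hm h3⟩
  have hTT' : ∀ t, T' t → ¬T t := by
    rintro t ⟨x, hx, h1, h2⟩ ⟨y, hy, h3, h4⟩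
    have h5 := (mU.lt_iff_lt hx hy).mp (h1.trans h3)
    have h6 := (mV.lt_iff_lt hy hx).mp (h4.trans h2)
    exact absurd h5 h6.not_gt
  by_cases hr0 : r = 0
  · refine ⟨0, fun t ht => ?_⟩
    obtain ⟨x, hx, y, hy, hxy, h1, h2⟩ := hr t ht
    have : x = y := by
      rw [hr0, mul_zero, abs_eq_zero, sub_eq_zero] at hxy
      exact hxy
    subst this
    exact ⟨x, by simpa using hx, by simpa using hx, by simpa using h1, by simpa using h2⟩
  have hne : ∀ x y : Q, |x - y| = 2 * r → x ≠ y := by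
    rintro x y hxy rfl
    apply hr0
    simp at hxy
    exact hxy
  have hrpos : ∀ x y : Q, |x - y| = 2 * r → 0 < r := fun x y hxy => by
    have := abs_pos.mpr (sub_ne_zero.mpr (hne x y hxy))
    linarith
  have hopen : ∀ t ∈ J, T t → ∃ δ, 0 < δ ∧ ∀ z ∈ J, |z - t| < δ → T z := by
    rintro t ht ⟨x, hx, h1, h2⟩
    obtain ⟨δ, hδ, h3⟩ := (hb.derivU t ht).cont (U x - Ub t) (by linarith)
    obtain ⟨δ', hδ', h4⟩ := (hb.derivV t ht).cont (Vb t - V x) (by linarith)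
    refine ⟨min δ δ', lt_min hδ hδ', fun z hz hzt => ⟨x, hx, ?_, ?_⟩⟩
    · have := (abs_lt.mp (h3 z hz (hzt.trans_le (min_le_left _ _)))).2
      linarith
    · have := (abs_lt.mp (h4 z hz (hzt.trans_le (min_le_right _ _)))).1
      linarith
  have hopen' : ∀ t ∈ J, ¬T t → ∃ δ, 0 < δ ∧ ∀ z ∈ J, |z - t| < δ → ¬T z := by
    intro t ht hn
    obtain ⟨x, hx, y, hy, hxy, e1, e2⟩ := hr t ht
    have hyx : y < x := by
      rcases lt_or_gt_of_ne (hne x y hxy) with h' | h'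
      · exact absurd (hTlt x hx y hy t e1 e2 h') hn
      · exact h'
    obtain ⟨x, hx, h1, h2⟩ := hTgt x hx y hy t e1 e2 hyx
    obtain ⟨δ, hδ, h3⟩ := (hb.derivU t ht).cont (Ub t - U x) (by linarith)
    obtain ⟨δ', hδ', h4⟩ := (hb.derivV t ht).cont (V x - Vb t) (by linarith)
    refine ⟨min δ δ', lt_min hδ hδ', fun z hz hzt => hTT' z ⟨x, hx, ?_, ?_⟩⟩
    · have := (abs_lt.mp (h3 z hz (hzt.trans_le (min_le_left _ _)))).1
      linarith
    · have := (abs_lt.mp (h4 z hz (hzt.trans_le (min_le_right _ _)))).2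
      linarith
  by_cases hex : ∃ t ∈ J, T t
  · obtain ⟨t₀, ht₀, hTt₀⟩ := hex
    refine ⟨r, fun t ht => ?_⟩
    -- By connectedness the observer stays on one side, so the sign of the radar distance does not
    -- change.
    have hTt := WorldModel.locally_constant hc hb.ord hTdef hopen hopen' ht₀ ht hTt₀
    obtain ⟨x, hx, y, hy, hxy, e1, e2⟩ := hr t ht
    have hlt : x < y := by
      rcases lt_or_gt_of_ne (hne x y hxy) with h' | h'
      · exact h'
      · exact absurd hTt (hTT' t (hTgt x hx y hy t e1 e2 h'))
    rw [abs_of_neg (sub_neg.mpr hlt)] at hxy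
    have e3 : x + r + r = y := by linarith
    exact ⟨x + r, by simpa using hx, by rwa [e3], by simpa using e1, by rwa [e3]⟩
  · refine ⟨-r, fun t ht => ?_⟩
    obtain ⟨x, hx, y, hy, hxy, e1, e2⟩ := hr t ht
    have hlt : y < x := by
      rcases lt_or_gt_of_ne (hne x y hxy) with h' | h'
      · exact absurd ⟨t, ht, hTlt x hx y hy t e1 e2 h'⟩ hex
      · exact h'
    rw [abs_of_pos (sub_pos.mpr hlt)] at hxy
    have e3 : y + r - -r = x := by linarith
    exact ⟨y + r, by rwa [e3], by simpa using hy, by rwa [e3], by simpa using e2⟩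

/-- Points on the same side of each other's light cones. -/
theorem radarTime_sub (hc : M.CONT) (h : PlaneLife M I U V U' V') (hU : ∀ x ∈ I, 0 < U' x)
    {ρ₁ ρ₂ s₁ s₂ u₁ u₂ v₁ v₂ : Q} (h₁ : RadarPoint I U V ρ₁ s₁ u₁ v₁)
    (h₂ : RadarPoint I U V ρ₂ s₂ u₂ v₂) (hl : (u₁ - u₂) * (v₁ - v₂) = 0)
    (hle : u₁ + v₁ ≤ u₂ + v₂) : s₂ - s₁ = |ρ₂ - ρ₁| := by
  have mU := h.strictMonoU hc hU
  have mV := h.strictMonoV hc hU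
  -- Lightlike separated points share u or v, which fixes s - ρ or s + ρ; the order in the other
  -- light coordinate gives the sign of ρ₂ - ρ₁.
  rcases mul_eq_zero.mp hl with h0 | h0
  · rw [sub_eq_zero] at h0
    have e1 := mU.injOn h₁.1 h₂.1 (by rw [← h₁.2.2.1, ← h₂.2.2.1, h0])
    have e2 := (mV.le_iff_le h₁.2.1 h₂.2.1).mp (by rw [← h₁.2.2.2, ← h₂.2.2.2]; linarith)
    rw [abs_of_nonneg (by linarith)]; linarith
  · rw [sub_eq_zero] at h0
    have e1 := mV.injOn h₁.2.1 h₂.2.1 (by rw [← h₁.2.2.2, ← h₂.2.2.2, h0])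
    have e2 := (mU.le_iff_le h₁.1 h₂.1).mp (by rw [← h₁.2.2.1, ← h₂.2.2.1]; linarith)
    rw [abs_of_nonpos (by linarith)]; linarith

/-- A photon cannot join two points of the same curve of constant distance that have different radar
times. Needed when an observer sees an event of its own life by a photon. -/
theorem radarPoint_unique (hc : M.CONT) (h : PlaneLife M I U V U' V') (hU : ∀ x ∈ I, 0 < U' x)
    {ρ s₁ s₂ u₁ u₂ v₁ v₂ : Q} (h₁ : RadarPoint I U V ρ s₁ u₁ v₁)
    (h₂ : RadarPoint I U V ρ s₂ u₂ v₂) (hl : (u₁ - u₂) * (v₁ - v₂) = 0) : s₁ = s₂ := by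
  rcases le_total (u₁ + v₁) (u₂ + v₂) with hle | hle
  · have := h.radarTime_sub hc hU h₁ h₂ hl hle
    rw [sub_self, abs_zero] at this
    linarith
  · have := h.radarTime_sub hc hU h₂ h₁ (by linear_combination hl) hle
    rw [sub_self, abs_zero] at this
    linarith

end PlaneLife

end PlaneCurves

/-! ### Life-curves, velocities and time orientation. -/

section LifeCurves

open WorldModel

variable {n : ℕ} {B : Type u} {Q : Type v} [Field Q] [LinearOrder Q] [IsStrictOrderedRing Q]

/-- The point of the time-axis with time component `t`. -/
def timeVec (t : Q) : Coord n Q := Fin.cons t fun _ => 0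

theorem timeVec_zero (t : Q) : (timeVec t : Coord n Q) 0 = t := rfl

theorem timeVec_succ (t : Q) (i : Fin n) : (timeVec t : Coord n Q) i.succ = 0 := rfl

theorem timeVec_sub (t s : Q) : (timeVec t - timeVec s : Coord n Q) = (t - s) • timeVec 1 := by
  funext i
  refine Fin.cases ?_ (fun i => ?_) i
  · simp [timeVec_zero]
  · simp [timeVec_succ]

theorem mq_timeVec (t : Q) : mq (timeVec t : Coord n Q) = t ^ 2 := by
  simp [mq, timeVec_zero, timeVec_succ]

theorem abs_apply_le_euclLen (hE : ∀ x : Q, 0 < x → ∃ y : Q, y * y = x) (p : Coord n Q)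
    (i : Fin (n + 1)) : |p i| ≤ euclLen p := by
  obtain ⟨h1, h2⟩ := euclLen_spec hE p
  refine abs_le_of_sq_le_sq ?_ h1
  rw [sq (euclLen p), h2]
  exact Finset.single_le_sum (f := fun i => p i ^ 2) (fun _ _ => sq_nonneg _) (Finset.mem_univ i)

theorem euclLen_le_sum_abs (hE : ∀ x : Q, 0 < x → ∃ y : Q, y * y = x) (p : Coord n Q) :
    euclLen p ≤ ∑ i, |p i| := by
  obtain ⟨h1, h2⟩ := euclLen_spec hE p
  refine le_of_sq_le_sq ?_ (Finset.sum_nonneg fun _ _ => abs_nonneg _)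
  rw [sq, h2]
  calc ∑ i, p i ^ 2 = ∑ i, |p i| ^ 2 := by simp only [sq_abs]
    _ ≤ _ := Finset.sum_sq_le_sq_sum_of_nonneg fun i _ => abs_nonneg _

theorem euclLen_timeVec (hE : ∀ x : Q, 0 < x → ∃ y : Q, y * y = x) (t : Q) :
    euclLen (timeVec t : Coord n Q) = |t| := by
  obtain ⟨h1, h2⟩ := euclLen_spec hE (timeVec t : Coord n Q)
  rw [Fin.sum_univ_succ] at h2
  simp only [timeVec_zero, timeVec_succ] at h2
  rw [← sq_eq_sq₀ h1 (abs_nonneg _), sq_abs, sq, h2]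
  simp

theorem euclLen_eq_zero (hE : ∀ x : Q, 0 < x → ∃ y : Q, y * y = x) {p : Coord n Q}
    (h : euclLen p ≤ 0) : p = 0 := by
  funext i
  have := (abs_apply_le_euclLen hE p i).trans h
  simpa using this

/-- The derivative relation of the graph of a curve is given by the derivatives of the coordinates. -/
theorem mem_derivRel_iff (hE : ∀ x : Q, 0 < x → ∃ y : Q, y * y = x) {F : Set (Q × Coord n Q)}
    {I : Set Q} {γ : Q → Coord n Q} (hF : ∀ t p, (t, p) ∈ F ↔ t ∈ I ∧ p = γ t) (t : Q)
    (y : Coord n Q) :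
    (t, y) ∈ derivRel F ↔ t ∈ I ∧ ∀ i, QDeriv (fun z => γ z i) I t (y i) := by
  constructor
  · rintro ⟨p, hp, h⟩
    simp only [hF] at hp h
    obtain ⟨ht, rfl⟩ := hp
    refine ⟨ht, fun i ε hε => ?_⟩
    obtain ⟨δ, hδ, h⟩ := h ε hε
    refine ⟨δ, hδ, fun z hz hzt => ?_⟩
    have h1 := h z (γ z) ⟨hz, rfl⟩ hzt
    have h2 := abs_apply_le_euclLen hE (γ z - γ t - (z - t) • y) i
    exact h2.trans h1
  · rintro ⟨ht, h⟩
    refine ⟨γ t, (hF _ _).mpr ⟨ht, rfl⟩, fun ε hε => ?_⟩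
    -- The error is shared equally among the n + 1 coordinates.
    have hN : (0 : Q) < (n : Q) + 1 := by positivity
    choose δ hδ hd using fun i => h i (ε / ((n : Q) + 1)) (div_pos hε hN)
    refine ⟨Finset.univ.inf' Finset.univ_nonempty δ, (Finset.lt_inf'_iff _).mpr fun i _ => hδ i, ?_⟩
    intro x z hz hxt
    simp only [hF] at hz
    obtain ⟨hx, rfl⟩ := hz
    refine (euclLen_le_sum_abs hE _).trans ?_
    calc ∑ i, |(γ x - γ t - (x - t) • y) i| ≤ ∑ _i : Fin (n + 1), ε / ((n : Q) + 1) * |x - t| :=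
          Finset.sum_le_sum fun i _ =>
            hd i x hx (hxt.trans_le (Finset.inf'_le _ (Finset.mem_univ i)))
      _ = ε * |x - t| := by
          rw [Finset.sum_const, Finset.card_univ, Fintype.card_fin, nsmul_eq_mul]
          push_cast
          field_simp

namespace WorldModel

variable {M : WorldModel n B Q}

/-- The instants of the life of `k` according to `k`. -/
def lifeTimes (M : WorldModel n B Q) (k : B) : Set Q := {t | k ∈ M.ev k (timeVec t)}

/-- The life-curve of `k` according to `m` as a function. -/
noncomputable def lifePos (M : WorldModel n B Q) (m k : B) (t : Q) : Coord n Q :=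
  open Classical in if h : ∃ p, (t, p) ∈ M.lifeCurve m k then h.choose else 0

theorem AccRel.eq_timeVec (hM : M.AccRel) {k : B} (hk : k ∈ M.Ob) {q : Coord n Q}
    (h : k ∈ M.ev k q) : q = timeVec (q 0) := by
  have := ((hM.axSelf0 k hk q).mp h).2
  funext i
  exact Fin.cases rfl this i

/-- A co-moving inertial observer from `AxCmv` sees the event, and `AxEv` passes it on to m. -/
theorem AccRel.exists_ev_eq (hM : M.AccRel) {m k : B} (hm : m ∈ M.IOb) (hk : k ∈ M.Ob)
    {q : Coord n Q} (h : k ∈ M.ev k q) : ∃ p, M.ev m p = M.ev k q := by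
  obtain ⟨m', hm', ⟨q', hq'⟩, -⟩ := hM.axCmv k hk q h
  have h1 : M.ev k q ∈ M.EvOf m' := ⟨⟨q', hq'.1.symm⟩, hq'.2⟩
  rw [hM.axEv m' hm' m hm] at h1
  exact h1.1

theorem AccRel.mem_lifeTimes_iff (hM : M.AccRel) {m k : B} (hm : m ∈ M.IOb) (hk : k ∈ M.Ob) (t : Q) :
    t ∈ M.lifeTimes k ↔ ∃ p, (t, p) ∈ M.lifeCurve m k := by
  constructor
  · intro h
    obtain ⟨p, hp⟩ := hM.exists_ev_eq hm hk h
    exact ⟨p, timeVec t, h, hp.symm, rfl⟩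
  · rintro ⟨p, q, hq, -, rfl⟩
    rwa [hM.eq_timeVec hk hq] at hq

theorem AccRel.ev_lifePos (hM : M.AccRel) {m k : B} (hm : m ∈ M.IOb) (hk : k ∈ M.Ob) {t : Q}
    (ht : t ∈ M.lifeTimes k) : M.ev m (M.lifePos m k t) = M.ev k (timeVec t) := by
  have h := (hM.mem_lifeTimes_iff hm hk t).mp ht
  rw [lifePos, dif_pos h]
  obtain ⟨q, hq, hqe, hq0⟩ := h.choose_spec
  rw [hM.eq_timeVec hk hq, hq0] at hqe
  exact hqe.symm

theorem AccRel.mem_lifeCurve_iff (hn : 2 ≤ n) (hM : M.AccRel) {m k : B} (hm : m ∈ M.IOb)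
    (hk : k ∈ M.Ob) (t : Q) (p : Coord n Q) :
    (t, p) ∈ M.lifeCurve m k ↔ t ∈ M.lifeTimes k ∧ p = M.lifePos m k t := by
  constructor
  · intro h
    have ht := (hM.mem_lifeTimes_iff hm hk t).mpr ⟨p, h⟩
    refine ⟨ht, hM.ev_injective hn hm ?_⟩
    obtain ⟨q, hq, hqe, hq0⟩ := h
    rw [hM.eq_timeVec hk hq, hq0] at hqe
    rw [hM.ev_lifePos hm hk ht, ← hqe]
  · rintro ⟨ht, rfl⟩
    exact ⟨timeVec t, ht, (hM.ev_lifePos hm hk ht).symm, rfl⟩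

theorem AccRel.lifePos_of_notMem (hM : M.AccRel) {m k : B} (hm : m ∈ M.IOb) (hk : k ∈ M.Ob) {t : Q}
    (ht : t ∉ M.lifeTimes k) : M.lifePos m k t = 0 := by
  rw [hM.mem_lifeTimes_iff hm hk] at ht
  rw [lifePos, dif_neg ht]

theorem AccRel.mem_wl_lifePos (hM : M.AccRel) {m k : B} (hm : m ∈ M.IOb) (hk : k ∈ M.Ob) {t : Q}
    (ht : t ∈ M.lifeTimes k) : M.lifePos m k t ∈ M.wl m k := by
  change k ∈ M.ev m (M.lifePos m k t)
  rw [hM.ev_lifePos hm hk ht]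
  exact ht

theorem AccRel.lifeTimes_eq (hM : M.AccRel) {k : B} (hk : k ∈ M.Ob) :
    M.lifeTimes k = {t : Q | ∃ r, k ∈ M.ev k r ∧ r 0 = t} := by
  ext t
  constructor
  · exact fun h => ⟨_, h, rfl⟩
  · rintro ⟨r, hr, rfl⟩
    rwa [hM.eq_timeVec hk hr] at hr

theorem AccRel.ordConnected_lifeTimes (hM : M.AccRel) {k : B} (hk : k ∈ M.Ob) :
    (M.lifeTimes k).OrdConnected := by
  rw [hM.lifeTimes_eq hk]
  exact (hM.axSelf0Plus k hk).2

theorem AccRel.exists_mem_lifeTimes (hM : M.AccRel) {k : B} (hk : k ∈ M.Ob) (x : Q) :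
    ∃ w ∈ M.lifeTimes k, w ≠ x := by
  rw [hM.lifeTimes_eq hk]
  obtain ⟨p, q, hpq, hp, hq⟩ := (hM.axSelf0Plus k hk).1
  by_cases h : p 0 = x
  · exact ⟨q 0, ⟨q, hq, rfl⟩, fun h' => hpq (h.trans h'.symm)⟩
  · exact ⟨p 0, ⟨p, hp, rfl⟩, h⟩

theorem AccRel.qset_lifeTimes (hM : M.AccRel) {m k : B} (hm : m ∈ M.IOb) (hk : k ∈ M.Ob) :
    M.QSet (M.lifeTimes k) := by
  have h : M.QDef fun a : Fin 1 → Q => ∃ p : Fin (n + 1) → Q, (a 0, p) ∈ M.lifeCurve m k :=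
    QDef.ex_tuple (QDef.reindex (M.qdef_lifeCurve m k)
      fun o : Option (Fin (n + 1)) => o.elim (Sum.inl 0) Sum.inr)
  exact h.congr fun a => hM.mem_lifeTimes_iff hm hk _

/-- Stated for linear combinations of the coordinates so as to cover light coordinates directly. -/
theorem AccRel.qmap_lifePos (hn : 2 ≤ n) (hM : M.AccRel) {m k : B} (hm : m ∈ M.IOb) (hk : k ∈ M.Ob)
    (c : Coord n Q) : M.QMap fun t => ∑ j, c j * M.lifePos m k t j := by
  refine QFun.of_graph (R := fun a y => (∃ p : Fin (n + 1) → Q, (a 0, p) ∈ M.lifeCurve m k ∧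
    y = ∑ j, c j * p j) ∨ (¬(a 0 ∈ M.lifeTimes k) ∧ y = 0)) ?_ ?_
  · refine QDef.or (QDef.ex_tuple (QDef.and ?_ ?_)) (QDef.and ?_ ?_)
    · exact QDef.reindex (M.qdef_lifeCurve m k)
        fun o : Option (Fin (n + 1)) => o.elim (Sum.inl (some 0)) Sum.inr
    · exact QDef.eq (.var _) (QFun.sum _ fun j => .mul (.const _) (.var _))
    · exact QDef.not (QDef.comp (S := fun z => z ∈ M.lifeTimes k) (hM.qset_lifeTimes hm hk) (.var _))
    · exact QDef.eq (.var _) (.const _)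
  · intro a y
    simp only [hM.mem_lifeCurve_iff hn hm hk]
    by_cases h : a 0 ∈ M.lifeTimes k
    · simp [h]
    · simp [h, hM.lifePos_of_notMem hm hk h]

/-- The velocity of an observer according to an inertial observer exists and is a unit vector. -/
theorem AccRel.exists_velocity (hn : 2 ≤ n) (hM : M.AccRel) {m k : B} (hm : m ∈ M.IOb)
    (hk : k ∈ M.Ob) {t : Q} (ht : t ∈ M.lifeTimes k) : ∃ y : Coord n Q, mq y = 1 ∧
      ∀ i, QDeriv (fun z => M.lifePos m k z i) (M.lifeTimes k) t (y i) := by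
  obtain ⟨m', hm', -, hcm⟩ := hM.axCmv k hk _ ht
  obtain ⟨L, o, hL, hLo⟩ := hM.poincare hn hm' hm
  have hE := hM.axEOF
  -- For the co-moving m' the life-curve agrees with the time-axis to first order at t. The Poincaré
  -- map to m carries this to a derivative L (timeVec 1), a unit vector.
  have key : ∀ ε : Q, 0 < ε → ∃ δ : Q, 0 < δ ∧ ∀ z ∈ M.lifeTimes k, |z - t| < δ →
      ∃ p, M.lifePos m k z = L p + o ∧ euclLen (p - timeVec z) ≤ ε * |z - t| := by
    intro ε hε
    obtain ⟨δ, hδ, h⟩ := hcm ε hε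
    refine ⟨δ, hδ, fun z hz hzt => ?_⟩
    have e : euclLen (timeVec z - timeVec t : Coord n Q) = |z - t| := by
      rw [timeVec_sub, show (z - t) • (timeVec 1 : Coord n Q) = timeVec (z - t) by
        funext i
        exact Fin.cases (by simp [timeVec_zero]) (fun i => by simp [timeVec_succ]) i, euclLen_timeVec hE]
    obtain ⟨p0, hp0⟩ := hM.exists_ev_eq hm' hk hz
    obtain ⟨p, hp, -, hpe⟩ := h (timeVec z) (by rwa [e]) ⟨p0, hp0.symm, k, hz⟩
    refine ⟨p, hM.ev_injective hn hm ?_, by rwa [e] at hpe⟩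
    rw [hM.ev_lifePos hm hk hz, hLo]
    exact hp.1
  have ht0 : M.lifePos m k t = L (timeVec t) + o := by
    obtain ⟨δ, hδ, h⟩ := key 1 one_pos
    obtain ⟨p, hp, hpe⟩ := h t ht (by simpa using hδ)
    rw [sub_self, abs_zero, mul_zero] at hpe
    rw [hp, sub_eq_zero.mp (euclLen_eq_zero hE hpe)]
  refine ⟨L (timeVec 1), by rw [hL, mq_timeVec, one_pow], fun i ε hε => ?_⟩
  -- A bound for the norm of the i-th coordinate of L; the summand 1 keeps it positive.
  set C : Q := ∑ j, |L (Pi.single j 1) i| + 1 with hC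
  have hC0 : 0 ≤ ∑ j, |L (Pi.single j 1) i| := Finset.sum_nonneg fun _ _ => abs_nonneg _
  have hCpos : 0 < C := by linarith
  have hLb : ∀ w : Coord n Q, |L w i| ≤ C * euclLen w := by
    intro w
    have hw : L w i = ∑ j, w j * L (Pi.single j 1) i := by
      rw [LinearMap.pi_apply_eq_sum_univ L w]
      simp only [Finset.sum_apply, Pi.smul_apply, smul_eq_mul]
      refine Finset.sum_congr rfl fun j _ => ?_
      rw [show (fun l => if j = l then (1 : Q) else 0) = Pi.single j 1 from
        funext fun l => by simp [Pi.single_apply, eq_comm]]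
    rw [hw]
    calc |∑ j, w j * L (Pi.single j 1) i| ≤ ∑ j, |w j * L (Pi.single j 1) i| :=
          Finset.abs_sum_le_sum_abs _ _
      _ ≤ ∑ j, euclLen w * |L (Pi.single j 1) i| := Finset.sum_le_sum fun j _ => by
          rw [abs_mul]
          exact mul_le_mul_of_nonneg_right (abs_apply_le_euclLen hE w j) (abs_nonneg _)
      _ = euclLen w * ∑ j, |L (Pi.single j 1) i| := by rw [Finset.mul_sum]
      _ ≤ C * euclLen w := by
          rw [mul_comm]
          exact mul_le_mul_of_nonneg_right (by linarith) (euclLen_spec hE w).1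
  obtain ⟨δ, hδ, h⟩ := key (ε / C) (div_pos hε hCpos)
  refine ⟨δ, hδ, fun z hz hzt => ?_⟩
  obtain ⟨p, hp, hpe⟩ := h z hz hzt
  have e : M.lifePos m k z - M.lifePos m k t - (z - t) • L (timeVec 1) = L (p - timeVec z) := by
    rw [hp, ht0, ← map_smul, ← timeVec_sub, map_sub, map_sub]; abel
  have e' := congrFun e i
  simp only [Pi.sub_apply, Pi.smul_apply, smul_eq_mul] at e'
  rw [e']
  refine (hLb _).trans ?_
  calc C * euclLen (p - timeVec z) ≤ C * (ε / C * |z - t|) := mul_le_mul_of_nonneg_left hpe hCpos.le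
    _ = ε * |z - t| := by field_simp

/-- The velocity of `k` according to `m` as a function. -/
noncomputable def lifeVel (M : WorldModel n B Q) (m k : B) (t : Q) : Coord n Q :=
  open Classical in if h : t ∈ M.lifeTimes k ∧ ∃ y : Coord n Q, mq y = 1 ∧
      ∀ i, QDeriv (fun z => M.lifePos m k z i) (M.lifeTimes k) t (y i) then h.2.choose else 0

theorem lifeVel_of_notMem {m k : B} {t : Q} (ht : t ∉ M.lifeTimes k) : M.lifeVel m k t = 0 := by
  rw [lifeVel, dif_neg fun h => ht h.1]

theorem AccRel.lifeVel_spec (hn : 2 ≤ n) (hM : M.AccRel) {m k : B} (hm : m ∈ M.IOb)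
    (hk : k ∈ M.Ob) {t : Q} (ht : t ∈ M.lifeTimes k) : mq (M.lifeVel m k t) = 1 ∧
      ∀ i, QDeriv (fun z => M.lifePos m k z i) (M.lifeTimes k) t (M.lifeVel m k t i) := by
  have h := hM.exists_velocity hn hm hk ht
  rw [lifeVel, dif_pos ⟨ht, h⟩]
  exact h.choose_spec

theorem AccRel.mem_relVelocity_iff (hn : 2 ≤ n) (hM : M.AccRel) {m k : B} (hm : m ∈ M.IOb)
    (hk : k ∈ M.Ob) (t : Q) (y : Coord n Q) :
    (t, y) ∈ M.relVelocity m k ↔ t ∈ M.lifeTimes k ∧ y = M.lifeVel m k t := by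
  rw [relVelocity, mem_derivRel_iff hM.axEOF (hM.mem_lifeCurve_iff hn hm hk)]
  refine and_congr_right fun ht => ⟨fun h => funext fun i => ?_, ?_⟩
  · obtain ⟨w, hw, hne⟩ := hM.exists_mem_lifeTimes hk t
    exact QDeriv.unique (hM.ordConnected_lifeTimes hk) ht hw hne (h i)
      ((hM.lifeVel_spec hn hm hk ht).2 i)
  · rintro rfl
    exact (hM.lifeVel_spec hn hm hk ht).2

theorem AccRel.mem_relAcceleration_iff (hn : 2 ≤ n) (hM : M.AccRel) {m k : B} (hm : m ∈ M.IOb)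
    (hk : k ∈ M.Ob) (t : Q) (a : Coord n Q) :
    (t, a) ∈ M.relAcceleration m k ↔ t ∈ M.lifeTimes k ∧
      ∀ i, QDeriv (fun z => M.lifeVel m k z i) (M.lifeTimes k) t (a i) := by
  rw [relAcceleration, mem_derivRel_iff hM.axEOF (hM.mem_relVelocity_iff hn hm hk)]

/-- `AxEvTr` places the event in the observer's own coordinates, and `AxSelf0` places it on the
time-axis. -/
theorem AccRel.exists_instant (hM : M.AccRel) {m k : B} (hm : m ∈ M.IOb) (hk : k ∈ M.Ob)
    {e : Set B} (he : e ∈ M.Ev) (hke : k ∈ e) :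
    ∃ t ∈ M.lifeTimes k, M.ev k (timeVec t) = e ∧ M.ev m (M.lifePos m k t) = e := by
  obtain ⟨⟨q, rfl⟩, -⟩ := hM.axEvTr k hk e he hke
  have hq := hM.eq_timeVec hk hke
  have ht : q 0 ∈ M.lifeTimes k := by
    change k ∈ M.ev k (timeVec (q 0))
    rwa [← hq]
  exact ⟨q 0, ht, by rw [← hq], by rw [hM.ev_lifePos hm hk ht, ← hq]⟩

/-- A Lorentz transformation preserves or reverses the order of causally related points. -/
theorem exists_time_orientation (L : Coord n Q →ₗ[Q] Coord n Q) (hL : ∀ p, mq (L p) = mq p) :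
    ∃ η : Q, (η = 1 ∨ η = -1) ∧ ∀ z, mq z = 0 → 0 ≤ z 0 → 0 ≤ η * L z 0 := by
  -- The orientation is the sign of the time component of the image of the time unit vector.
  set f := L (timeVec 1) with hf
  have hfq : mq f = 1 := by rw [hf, hL, mq_timeVec, one_pow]
  have hfs : ∑ i : Fin n, f i.succ ^ 2 = f 0 ^ 2 - 1 := by
    rw [mq] at hfq; linarith
  have hb : ∀ z, mb (L z) f = z 0 := by
    intro z
    have h1 := hL (z + timeVec 1)
    rw [map_add, mq_add, mq_add, hL, hL] at h1
    have h2 : mb z (timeVec 1) = z 0 := by simp [mb, timeVec_zero, timeVec_succ]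
    rw [h2] at h1
    linarith
  -- If L z 0 and f 0 had opposite signs, then mb (L z) f = z 0 ≥ 0 would bound the spatial product
  -- by the negative number L z 0 * f 0. This contradicts Cauchy–Schwarz, as the space part of f is
  -- shorter than |f 0|.
  have key : ∀ z, mq z = 0 → 0 ≤ z 0 → 0 ≤ L z 0 * f 0 := by
    intro z hz h0
    by_contra hneg
    push Not at hneg
    have h1 := hb z
    have h2 : ∑ i : Fin n, L z i.succ ^ 2 = L z 0 ^ 2 := by
      have := hL z
      rw [hz, mq] at this
      linarith
    have h3 := Finset.sum_mul_sq_le_sq_mul_sq Finset.univ (fun i : Fin n => L z i.succ)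
      fun i => f i.succ
    rw [h2, hfs] at h3
    rw [mb] at h1
    set S := ∑ i : Fin n, L z i.succ * f i.succ
    have h4 : S ≤ L z 0 * f 0 := by linarith
    have h5 : L z 0 ≠ 0 := by
      intro h; rw [h, zero_mul] at hneg; exact lt_irrefl _ hneg
    have h6 : 0 < L z 0 ^ 2 := by positivity
    nlinarith
  rcases le_or_gt 0 (f 0) with h | h
  · have hpos : 0 < f 0 := by
      refine h.lt_of_ne fun h' => ?_
      rw [← h'] at hfs
      have : 0 ≤ ∑ i : Fin n, f i.succ ^ 2 := Finset.sum_nonneg fun _ _ => sq_nonneg _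
      rw [hfs] at this
      norm_num at this
    exact ⟨1, Or.inl rfl, fun z hz h0 => by
      rw [one_mul]; exact nonneg_of_mul_nonneg_left (key z hz h0) hpos⟩
  · refine ⟨-1, Or.inr rfl, fun z hz h0 => ?_⟩
    have := key z hz h0
    rw [neg_one_mul]
    by_contra hn
    push Not at hn
    nlinarith

/-- The order of events according to an observer is the order of their time components or its
reverse. -/
theorem AccRel.exists_precedes_orientation (hn : 2 ≤ n) (hM : M.AccRel) {m k : B} (hm : m ∈ M.IOb)
    (hk : k ∈ M.Ob) : ∃ η : Q, (η = 1 ∨ η = -1) ∧ ∀ p q : Coord n Q, mq (q - p) = 0 →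
      M.Precedes k (M.ev m p) (M.ev m q) → 0 ≤ η * (q 0 - p 0) := by
  -- `Precedes` quantifies over all co-moving inertial observers; a single one suffices to fix the
  -- orientation.
  obtain ⟨t, ht, -⟩ := hM.exists_mem_lifeTimes hk 0
  obtain ⟨m', hm', hcm⟩ := hM.axCmv k hk _ ht
  obtain ⟨L, o, hL, hLo⟩ := hM.poincare hn hm' hm
  obtain ⟨η, hη, h⟩ := exists_time_orientation L hL
  refine ⟨η, hη, fun p q hpq hprec => ?_⟩
  obtain ⟨p', q', hp', hq', hle⟩ := hprec m' hm' ⟨_, ht, hcm⟩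
  have e1 : p = L p' + o := hM.ev_injective hn hm (by rw [hLo, hp'.1])
  have e2 : q = L q' + o := hM.ev_injective hn hm (by rw [hLo, hq'.1])
  have e3 : q - p = L (q' - p') := by rw [e1, e2, map_sub]; abel
  have := h (q' - p') (by rw [← hL, ← e3, hpq]) (by simpa using hle)
  rw [← e3] at this
  exact this

end WorldModel

end LifeCurves

/-! ### Spaceships in the light coordinates of a vertical plane. -/

section Spaceships

open WorldModel

variable {n : ℕ} {B : Type u} {Q : Type v} [Field Q] [LinearOrder Q] [IsStrictOrderedRing Q]

/-- A linear coordinate; for unit vectors `w` of space and `ε = ±1`, the coordinates given by `w` and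
`-w` are light coordinates of the vertical planes in the direction of `w`. -/
def lightCoord (ε : Q) (w : Fin n → Q) (p : Coord n Q) : Q := ε * p 0 + ∑ j, w j * p j.succ

theorem lightCoord_sub (ε : Q) (w : Fin n → Q) (p q : Coord n Q) :
    lightCoord ε w (p - q) = lightCoord ε w p - lightCoord ε w q := by
  simp only [lightCoord, Pi.sub_apply, mul_sub, Finset.sum_sub_distrib]; ring

theorem lightCoord_neg_right (ε : Q) (w : Fin n → Q) (p : Coord n Q) :
    lightCoord ε (-w) p = ε * p 0 - ∑ j, w j * p j.succ := by
  simp [lightCoord, sub_eq_add_neg]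

theorem lightCoord_neg_left (ε : Q) (w : Fin n → Q) (p : Coord n Q) :
    lightCoord (-ε) w p = -lightCoord ε (-w) p := by
  rw [lightCoord_neg_right, lightCoord]; ring

theorem sum_sq_of_parallel {w : Fin n → Q} (hw : ∑ j, w j ^ 2 = 1) {p : Coord n Q}
    (hp : ∀ i : Fin n, p i.succ = (∑ j, w j * p j.succ) * w i) :
    ∑ i : Fin n, p i.succ ^ 2 = (∑ j, w j * p j.succ) ^ 2 := by
  calc ∑ i : Fin n, p i.succ ^ 2 = ∑ i : Fin n, (∑ j, w j * p j.succ) ^ 2 * w i ^ 2 :=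
        Finset.sum_congr rfl fun i _ => by rw [← mul_pow, ← hp i]
    _ = _ := by rw [← Finset.mul_sum, hw, mul_one]

theorem mq_eq_lightCoord_mul {ε : Q} (hε : ε = 1 ∨ ε = -1) {w : Fin n → Q} (hw : ∑ j, w j ^ 2 = 1)
    {p : Coord n Q} (hp : ∀ i : Fin n, p i.succ = (∑ j, w j * p j.succ) * w i) :
    lightCoord ε (-w) p * lightCoord ε w p = mq p := by
  rw [lightCoord_neg_right, mq, sum_sq_of_parallel hw hp, lightCoord]
  have : ε * ε = 1 := by rcases hε with rfl | rfl <;> norm_num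
  linear_combination p 0 ^ 2 * this

theorem IsVerticalPlane.exists_direction (hE : ∀ x : Q, 0 < x → ∃ y : Q, y * y = x)
    {P : Set (Coord n Q)} (hP : IsVerticalPlane P) : ∃ w : Fin n → Q, ∑ j, w j ^ 2 = 1 ∧
      ∀ p ∈ P, ∀ q ∈ P, ∀ i : Fin n,
        (p - q) i.succ = (∑ j, w j * (p - q) j.succ) * w i := by
  obtain ⟨o, w, ⟨i, hi⟩, rfl⟩ := hP
  have hpos : 0 < ∑ j : Fin n, w j.succ ^ 2 :=
    Finset.sum_pos' (fun _ _ => sq_nonneg _) ⟨i, Finset.mem_univ i, by positivity⟩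
  obtain ⟨r, hr⟩ := hE _ hpos
  have hr0 : r ≠ 0 := by rintro rfl; rw [← hr] at hpos; simp at hpos
  have h1 : ∑ j : Fin n, (w j.succ / r) ^ 2 = 1 := by
    simp only [div_pow]
    rw [← Finset.sum_div, ← hr]
    field_simp
  refine ⟨fun j => w j.succ / r, h1, ?_⟩
  rintro p ⟨s, x, rfl⟩ q ⟨s', x', rfl⟩ i
  have e : ∀ j : Fin n, (o + s • (Pi.single 0 1 : Coord n Q) + x • w -
      (o + s' • (Pi.single 0 1 : Coord n Q) + x' • w)) j.succ = ((x - x') * r) * (w j.succ / r) := by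
    intro j
    simp
    field_simp
  simp only [e]
  have : ∑ j : Fin n, w j.succ / r * ((x - x') * r * (w j.succ / r)) =
      ((x - x') * r) * ∑ j : Fin n, (w j.succ / r) ^ 2 := by
    rw [Finset.mul_sum]
    exact Finset.sum_congr rfl fun j _ => by ring
  rw [this, h1, mul_one]

/-- Two nonzero numbers of the same sign that dominate two others. -/
theorem mul_pos_of_dominated {ε t x s y l : Q} (hε : ε = 1 ∨ ε = -1) (hl : 0 < l) (hyx : l * y = x)
    (ht : t ^ 2 < x ^ 2) (hs : s ^ 2 < y ^ 2) :
    0 < (ε * t - x) * (ε * s - y) ∧ 0 < (ε * t + x) * (ε * s + y) := by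
  rw [sq_lt_sq] at ht hs
  have ht' : |ε * t| < |x| := by rcases hε with rfl | rfl <;> simpa using ht
  have hs' : |ε * s| < |y| := by rcases hε with rfl | rfl <;> simpa using hs
  rcases lt_trichotomy y 0 with h | h | h
  · have hx : x < 0 := by rw [← hyx]; exact mul_neg_of_pos_of_neg hl h
    rw [abs_of_neg h] at hs'
    rw [abs_of_neg hx] at ht'
    obtain ⟨a1, a2⟩ := abs_lt.mp ht'
    obtain ⟨b1, b2⟩ := abs_lt.mp hs'
    exact ⟨mul_pos (by linarith) (by linarith), mul_pos_of_neg_of_neg (by linarith) (by linarith)⟩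
  · rw [h, abs_zero] at hs'
    exact absurd hs' (abs_nonneg _).not_gt
  · have hx : 0 < x := by rw [← hyx]; exact mul_pos hl h
    rw [abs_of_pos h] at hs'
    rw [abs_of_pos hx] at ht'
    obtain ⟨a1, a2⟩ := abs_lt.mp ht'
    obtain ⟨b1, b2⟩ := abs_lt.mp hs'
    exact ⟨mul_pos_of_neg_of_neg (by linarith) (by linarith), mul_pos (by linarith) (by linarith)⟩

theorem QDeriv.lightCoord {I : Set Q} {γ : Q → Coord n Q} {t : Q} {y : Coord n Q}
    (h : ∀ i, QDeriv (fun z => γ z i) I t (y i)) (ε : Q) (w : Fin n → Q) :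
    QDeriv (fun z => _root_.lightCoord ε w (γ z)) I t (_root_.lightCoord ε w y) :=
  ((h 0).const_mul ε).add (QDeriv.sum _ fun j => (h j.succ).const_mul (w j))

/-- Each instant of the curve that is joined by light to the point is s - ρ or s + ρ; two different
ones are both of these. -/
theorem PlaneLife.radarTime_eq_mid {M : WorldModel n B Q} {I : Set Q} {U V U' V' : Q → Q}
    (hc : M.CONT) (h : PlaneLife M I U V U' V') (hU : ∀ x ∈ I, 0 < U' x) {ρ s u v x y : Q}
    (hs : RadarPoint I U V ρ s u v) (hx : x ∈ I) (hy : y ∈ I) (hxy : x ≠ y)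
    (h1 : (u - U x) * (v - V x) = 0) (h2 : (u - U y) * (v - V y) = 0) : s = (x + y) / 2 := by
  have iU := (h.strictMonoU hc hU).injOn
  have iV := (h.strictMonoV hc hU).injOn
  obtain ⟨m1, m2, e1, e2⟩ := hs
  have h3 : ∀ z ∈ I, (u - U z) * (v - V z) = 0 → s - ρ = z ∨ s + ρ = z := by
    intro z hz h0
    rcases mul_eq_zero.mp h0 with h0 | h0
    · exact Or.inl (iU m1 hz (by rw [← e1]; exact sub_eq_zero.mp h0))
    · exact Or.inr (iV m2 hz (by rw [← e2]; exact sub_eq_zero.mp h0))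
  rcases h3 x hx h1 with h4 | h4 <;> rcases h3 y hy h2 with h5 | h5
  · exact absurd (h4.symm.trans h5) hxy
  · linarith
  · linarith
  · exact absurd (h4.symm.trans h5) hxy

namespace WorldModel

variable {M : WorldModel n B Q}

/-- The light coordinate of the life-curve of `h` according to `m`. -/
noncomputable def lifeCoord (M : WorldModel n B Q) (m : B) (ε : Q) (w : Fin n → Q) (h : B) (t : Q) :
    Q := lightCoord ε w (M.lifePos m h t)

/-- The light coordinate of the velocity of `h` according to `m`. -/
noncomputable def velCoord (M : WorldModel n B Q) (m : B) (ε : Q) (w : Fin n → Q) (h : B) (t : Q) :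
    Q := lightCoord ε w (M.lifeVel m h t)

theorem velCoord_of_notMem {m h : B} {t : Q} (ht : t ∉ M.lifeTimes h) (ε : Q) (w : Fin n → Q) :
    M.velCoord m ε w h t = 0 := by
  simp [velCoord, lightCoord, lifeVel_of_notMem ht]

/-- The part of the position orthogonal to w is constant along the life, so its derivative is zero.
-/
theorem AccRel.lifeVel_parallel (hn : 2 ≤ n) (hM : M.AccRel) {m h : B} (hm : m ∈ M.IOb)
    (hh : h ∈ M.Ob) {w : Fin n → Q}
    (hw : ∀ p ∈ M.wl m h, ∀ q ∈ M.wl m h, ∀ i : Fin n,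
      (p - q) i.succ = (∑ j, w j * (p - q) j.succ) * w i) {t : Q} (ht : t ∈ M.lifeTimes h)
    (i : Fin n) : M.lifeVel m h t i.succ = (∑ j, w j * M.lifeVel m h t j.succ) * w i := by
  have hd := (hM.lifeVel_spec hn hm hh ht).2
  have d1 := (hd i.succ).sub
    ((QDeriv.sum Finset.univ fun j => (hd (Fin.succ j)).const_mul (w j)).const_mul (w i))
  set c := M.lifePos m h t i.succ - w i * ∑ j, w j * M.lifePos m h t j.succ with hc
  have d2 := (QDeriv.const (I := M.lifeTimes h) (x := t) c).congr
    (g := fun z => M.lifePos m h z i.succ - w i * ∑ j, w j * M.lifePos m h z j.succ) ht fun z hz => by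
      have := hw _ (hM.mem_wl_lifePos hm hh hz) _ (hM.mem_wl_lifePos hm hh ht) i
      simp only [Pi.sub_apply, mul_sub, Finset.sum_sub_distrib] at this
      rw [hc]
      linarith
  obtain ⟨z, hz, hne⟩ := hM.exists_mem_lifeTimes hh t
  have := QDeriv.unique (hM.ordConnected_lifeTimes hh) ht hz hne d1 d2
  linarith

/-- In the plane mq is the product of the light coordinates, so a velocity with mq = 1 gives U' V' =
1. -/
theorem AccRel.planeLife (hn : 2 ≤ n) (hM : M.AccRel) {m h : B} (hm : m ∈ M.IOb)
    (hh : h ∈ M.Ob) {ε : Q} (hε : ε = 1 ∨ ε = -1) {w : Fin n → Q} (hw1 : ∑ j, w j ^ 2 = 1)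
    (hw : ∀ p ∈ M.wl m h, ∀ q ∈ M.wl m h, ∀ i : Fin n,
      (p - q) i.succ = (∑ j, w j * (p - q) j.succ) * w i) :
    PlaneLife M (M.lifeTimes h) (M.lifeCoord m ε (-w) h) (M.lifeCoord m ε w h)
      (M.velCoord m ε (-w) h) (M.velCoord m ε w h) := by
  have hmap : ∀ w : Fin n → Q, M.QMap (M.lifeCoord m ε w h) := fun w =>
    QFun.congr (hM.qmap_lifePos hn hm hh (Fin.cons ε w)) fun a => by
      change _ = ∑ j, (Fin.cons ε w : Coord n Q) j * M.lifePos m h (a 0) j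
      rw [Fin.sum_univ_succ]; rfl
  refine ⟨hM.ordConnected_lifeTimes hh, hM.qset_lifeTimes hm hh,
    fun x _ => hM.exists_mem_lifeTimes hh x, hmap _, hmap _, ?_, ?_, ?_⟩
  · exact fun x hx => QDeriv.lightCoord (hM.lifeVel_spec hn hm hh hx).2 _ _
  · exact fun x hx => QDeriv.lightCoord (hM.lifeVel_spec hn hm hh hx).2 _ _
  · intro x hx
    rw [velCoord, velCoord, mq_eq_lightCoord_mul hε hw1 (hM.lifeVel_parallel hn hm hh hw hx),
      (hM.lifeVel_spec hn hm hh hx).1]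

/-- A coordinate system for the vertical plane in which a spaceship moves: an inertial observer `m`, the
orientation `ε` of the time of `k`, a direction `w` of space, and the signed radar distances of the
rear and of the front. -/
structure ShipFrame (M : WorldModel n B Q) (m b k c : B) (ε : Q) (w : Fin n → Q) (ρb ρc : Q) :
    Prop where
  inertial : m ∈ M.IOb
  rear_ob : b ∈ M.Ob
  mid_ob : k ∈ M.Ob
  front_ob : c ∈ M.Ob
  eps : ε = 1 ∨ ε = -1
  unit : ∑ j, w j ^ 2 = 1
  coplanar : M.CoplanarFor m b k c
  parallel : ∀ p ∈ M.wl m b ∪ M.wl m k ∪ M.wl m c, ∀ q ∈ M.wl m b ∪ M.wl m k ∪ M.wl m c,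
    ∀ i : Fin n, (p - q) i.succ = (∑ j, w j * (p - q) j.succ) * w i
  pos : ∀ t ∈ M.lifeTimes k, 0 < M.velCoord m ε (-w) k t
  rear : ∀ t ∈ M.lifeTimes b, ∃ s, RadarPoint (M.lifeTimes k) (M.lifeCoord m ε (-w) k)
    (M.lifeCoord m ε w k) ρb s (M.lifeCoord m ε (-w) b t) (M.lifeCoord m ε w b t)
  front : ∀ t ∈ M.lifeTimes c, ∃ s, RadarPoint (M.lifeTimes k) (M.lifeCoord m ε (-w) k)
    (M.lifeCoord m ε w k) ρc s (M.lifeCoord m ε (-w) c t) (M.lifeCoord m ε w c t)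

theorem Elapsed.eq {k : B} {e₁ e₂ : Set B} {x t₁ t₂ : Q} (h : M.Elapsed k e₁ e₂ x)
    (h₁ : M.ev k (timeVec t₁) = e₁) (h₂ : M.ev k (timeVec t₂) = e₂) : x = |t₁ - t₂| := by
  obtain ⟨p, q, hp, hq, rfl⟩ := h
  rw [← hp.eq h₁, ← hq.eq h₂]
  rfl

/-- `Elapsed` requires unique locations. An event containing k is located only on the time-axis of
k, where `hinj` separates the instants. -/
theorem AccRel.elapsed (hM : M.AccRel) {k : B} (hk : k ∈ M.Ob)
    (hinj : ∀ t₁ ∈ M.lifeTimes k, ∀ t₂ ∈ M.lifeTimes k,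
      M.ev k (timeVec t₁) = M.ev k (timeVec t₂) → t₁ = t₂) {t₁ t₂ : Q} (h₁ : t₁ ∈ M.lifeTimes k)
    (h₂ : t₂ ∈ M.lifeTimes k) :
    M.Elapsed k (M.ev k (timeVec t₁)) (M.ev k (timeVec t₂)) |t₁ - t₂| := by
  have hloc : ∀ t ∈ M.lifeTimes k, M.IsLoc k (M.ev k (timeVec t)) (timeVec t) := by
    intro t ht
    refine ⟨rfl, fun q hq => ?_⟩
    have hkq : k ∈ M.ev k q := by rw [hq]; exact ht
    have e := hM.eq_timeVec hk hkq
    have hq0 : q 0 ∈ M.lifeTimes k := by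
      change k ∈ M.ev k (timeVec (q 0))
      rwa [← e]
    rw [e, hinj (q 0) hq0 t ht (by rw [← e, hq])]
  exact ⟨_, _, hloc _ h₁, hloc _ h₂, rfl⟩

theorem AccRel.lightlike_of_photon (hM : M.AccRel) {m : B} (hm : m ∈ M.IOb) {ph : B}
    (hph : ph ∈ M.Ph) {p q : Coord n Q} (h : ph ∈ M.ev m p ∩ M.ev m q) : mq (p - q) = 0 :=
  (hM.photon_iff hm p q).mpr ⟨ph, ⟨hph, h.1⟩, h.2⟩

/-- In the coordinates of a vertical plane, an observer at constant radar distance satisfies the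
hypothesis of `PlaneLife.exists_signed_distance`. -/
theorem AccRel.exists_radar_instants (hM : M.AccRel) {m k h : B} (hm : m ∈ M.IOb)
    (hk : k ∈ M.Ob) (hh : h ∈ M.Ob) {ε : Q} (hε : ε = 1 ∨ ε = -1) {w : Fin n → Q}
    (hw1 : ∑ j, w j ^ 2 = 1) (hw : ∀ p ∈ M.wl m h, ∀ q ∈ M.wl m k, ∀ i : Fin n,
      (p - q) i.succ = (∑ j, w j * (p - q) j.succ) * w i)
    (hiU : (M.lifeTimes k).InjOn (M.lifeCoord m ε (-w) k))
    (hiV : (M.lifeTimes k).InjOn (M.lifeCoord m ε w k)) (hn : 2 ≤ n)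
    {r : Q} (hr : ∀ e ∈ M.Ev, h ∈ e → M.RadarDist k e r) {t : Q} (ht : t ∈ M.lifeTimes h) :
    ∃ x ∈ M.lifeTimes k, ∃ y ∈ M.lifeTimes k, |x - y| = 2 * r ∧
      M.lifeCoord m ε (-w) h t = M.lifeCoord m ε (-w) k x ∧
      M.lifeCoord m ε w h t = M.lifeCoord m ε w k y := by
  have he := hM.ev_lifePos hm hh ht
  rcases hr (M.ev h (timeVec t)) ⟨h, hh, ⟨_, rfl⟩, ⟨h, ht⟩⟩ ht with ⟨rfl, hke⟩ | ⟨hr0, h1⟩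
  · obtain ⟨x, hx, -, hxm⟩ := hM.exists_instant hm hk ⟨h, hh, ⟨_, rfl⟩, ⟨h, ht⟩⟩ hke
    have e : M.lifePos m h t = M.lifePos m k x := hM.ev_injective hn hm (by rw [he, hxm])
    exact ⟨x, hx, x, hx, by simp, by rw [lifeCoord, e]; rfl, by rw [lifeCoord, e]; rfl⟩
  · obtain ⟨e₁, he₁, e₂, he₂, ph₁, hph₁, ph₂, hph₂, hk12, h1, h2, hel⟩ := h1
    obtain ⟨x, hx, hxk, hxm⟩ := hM.exists_instant hm hk he₁ hk12.1
    obtain ⟨y, hy, hyk, hym⟩ := hM.exists_instant hm hk he₂ hk12.2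
    have hd := hel.eq hxk hyk
    have hne : x ≠ y := by
      rintro rfl
      rw [sub_self, abs_zero] at hd
      linarith
    have hlight : ∀ z ∈ M.lifeTimes k, ∀ e ph, M.ev m (M.lifePos m k z) = e → ph ∈ M.Ph →
        ph ∈ M.ev h (timeVec t) ∩ e → M.lifeCoord m ε (-w) h t = M.lifeCoord m ε (-w) k z ∨
          M.lifeCoord m ε w h t = M.lifeCoord m ε w k z := by
      rintro z hz e ph rfl hph hpe
      rw [← he] at hpe
      have := hM.lightlike_of_photon hm hph hpe
      rw [← mq_eq_lightCoord_mul hε hw1 (hw _ (hM.mem_wl_lifePos hm hh ht) _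
        (hM.mem_wl_lifePos hm hk hz)), lightCoord_sub, lightCoord_sub, mul_eq_zero, sub_eq_zero,
        sub_eq_zero] at this
      exact this
    -- Different instants of k cannot share a light coordinate, so one of the two photons keeps u
    -- and the other keeps v.
    rcases hlight x hx e₁ ph₁ hxm hph₁ h1 with h3 | h3 <;>
      rcases hlight y hy e₂ ph₂ hym hph₂ h2 with h4 | h4
    · exact absurd (hiU hx hy (h3.symm.trans h4)) hne
    · exact ⟨x, hx, y, hy, hd.symm, h3, h4⟩
    · exact ⟨y, hy, x, hx, by rw [abs_sub_comm, hd], h4, h3⟩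
    · exact absurd (hiV hx hy (h3.symm.trans h4)) hne

theorem AccRel.exists_shipFrame (hn : 2 ≤ n) (hM : M.AccRel) {b k c : B}
    (hship : M.RadarSpaceship b k c) : ∃ m ε w ρb ρc, M.ShipFrame m b k c ε w ρb ρc := by
  obtain ⟨m, hm, hcop⟩ := hship.coplanar
  obtain ⟨P, hP, hsub⟩ := id hcop
  obtain ⟨w, hw1, hw⟩ := hP.exists_direction hM.axEOF
  have hwk : ∀ p ∈ M.wl m k, ∀ q ∈ M.wl m k, ∀ i : Fin n,
      (p - q) i.succ = (∑ j, w j * (p - q) j.succ) * w i := fun p hp q hq =>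
    hw p (hsub (Or.inl (Or.inr hp))) q (hsub (Or.inl (Or.inr hq)))
  -- ε turns the coordinate time of m to agree with the clock of k.
  obtain ⟨ε, hε, hpos⟩ : ∃ ε : Q, (ε = 1 ∨ ε = -1) ∧
      ∀ t ∈ M.lifeTimes k, 0 < M.velCoord m ε (-w) k t := by
    have hk := hM.planeLife hn hm hship.mid_ob (Or.inl rfl) hw1 hwk
    rcases hk.sign hM.cont with h | h
    · exact ⟨1, Or.inl rfl, h⟩
    · refine ⟨-1, Or.inr rfl, fun t ht => ?_⟩
      rw [velCoord, lightCoord_neg_left, neg_neg]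
      have h1 := hk.unit t ht
      have h2 := h t ht
      change 0 < -M.velCoord m 1 w k t
      by_contra h3
      push Not at h3
      nlinarith
  have hk := hM.planeLife hn hm hship.mid_ob hε hw1 hwk
  have iU := (hk.strictMonoU hM.cont hpos).injOn
  have iV := (hk.strictMonoV hM.cont hpos).injOn
  obtain ⟨rb, hrb⟩ := hship.rear_dist
  obtain ⟨rc, hrc⟩ := hship.front_dist
  obtain ⟨ρb, hρb⟩ := hk.exists_signed_distance hM.cont hpos
    (hM.planeLife hn hm hship.rear_ob hε hw1 fun p hp q hq =>
      hw p (hsub (Or.inl (Or.inl hp))) q (hsub (Or.inl (Or.inl hq))))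
    fun t ht => hM.exists_radar_instants hm hship.mid_ob hship.rear_ob hε hw1
      (fun p hp q hq => hw p (hsub (Or.inl (Or.inl hp))) q (hsub (Or.inl (Or.inr hq)))) iU iV hn hrb ht
  obtain ⟨ρc, hρc⟩ := hk.exists_signed_distance hM.cont hpos
    (hM.planeLife hn hm hship.front_ob hε hw1 fun p hp q hq =>
      hw p (hsub (Or.inr hp)) q (hsub (Or.inr hq)))
    fun t ht => hM.exists_radar_instants hm hship.mid_ob hship.front_ob hε hw1
      (fun p hp q hq => hw p (hsub (Or.inr hp)) q (hsub (Or.inl (Or.inr hq)))) iU iV hn hrc ht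
  exact ⟨m, ε, w, ρb, ρc, hm, hship.rear_ob, hship.mid_ob, hship.front_ob, hε, hw1, hcop,
    fun p hp q hq => hw p (hsub hp) q (hsub hq), hpos, hρb, hρc⟩

namespace ShipFrame

variable {m b k c : B} {ε : Q} {w : Fin n → Q} {ρb ρc : Q}

theorem memRear {t : Q} (hM : M.AccRel) (F : M.ShipFrame m b k c ε w ρb ρc)
    (ht : t ∈ M.lifeTimes b) : M.lifePos m b t ∈ M.wl m b ∪ M.wl m k ∪ M.wl m c :=
  Or.inl (Or.inl (hM.mem_wl_lifePos F.inertial F.rear_ob ht))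

theorem memMid {t : Q} (hM : M.AccRel) (F : M.ShipFrame m b k c ε w ρb ρc)
    (ht : t ∈ M.lifeTimes k) : M.lifePos m k t ∈ M.wl m b ∪ M.wl m k ∪ M.wl m c :=
  Or.inl (Or.inr (hM.mem_wl_lifePos F.inertial F.mid_ob ht))

theorem memFront {t : Q} (hM : M.AccRel) (F : M.ShipFrame m b k c ε w ρb ρc)
    (ht : t ∈ M.lifeTimes c) : M.lifePos m c t ∈ M.wl m b ∪ M.wl m k ∪ M.wl m c :=
  Or.inr (hM.mem_wl_lifePos F.inertial F.front_ob ht)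

theorem mq_eq (F : M.ShipFrame m b k c ε w ρb ρc) {p q : Coord n Q}
    (hp : p ∈ M.wl m b ∪ M.wl m k ∪ M.wl m c) (hq : q ∈ M.wl m b ∪ M.wl m k ∪ M.wl m c) :
    mq (p - q) = (lightCoord ε (-w) p - lightCoord ε (-w) q) *
      (lightCoord ε w p - lightCoord ε w q) := by
  rw [← mq_eq_lightCoord_mul F.eps F.unit (F.parallel p hp q hq), lightCoord_sub, lightCoord_sub]

theorem eq_of_lightCoord_eq (F : M.ShipFrame m b k c ε w ρb ρc) {p q : Coord n Q}
    (hp : p ∈ M.wl m b ∪ M.wl m k ∪ M.wl m c) (hq : q ∈ M.wl m b ∪ M.wl m k ∪ M.wl m c)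
    (hU : lightCoord ε (-w) p = lightCoord ε (-w) q) (hV : lightCoord ε w p = lightCoord ε w q) :
    p = q := by
  have h1 : lightCoord ε (-w) (p - q) = 0 := by rw [lightCoord_sub, hU, sub_self]
  have h2 : lightCoord ε w (p - q) = 0 := by rw [lightCoord_sub, hV, sub_self]
  rw [lightCoord_neg_right] at h1
  rw [lightCoord] at h2
  have h3 : ∑ j, w j * (p - q) j.succ = 0 := by linarith
  have h4 : ε * (p - q) 0 = 0 := by linarith
  rw [← sub_eq_zero]
  funext i
  refine Fin.cases ?_ (fun i => ?_) i
  · refine (mul_eq_zero.mp h4).resolve_left ?_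
    rcases F.eps with rfl | rfl <;> norm_num
  · rw [F.parallel p hp q hq i, h3, zero_mul]
    rfl

theorem planeMid (hn : 2 ≤ n) (hM : M.AccRel) (F : M.ShipFrame m b k c ε w ρb ρc) :
    PlaneLife M (M.lifeTimes k) (M.lifeCoord m ε (-w) k) (M.lifeCoord m ε w k)
      (M.velCoord m ε (-w) k) (M.velCoord m ε w k) :=
  hM.planeLife hn F.inertial F.mid_ob F.eps F.unit fun p hp q hq =>
    F.parallel p (Or.inl (Or.inr hp)) q (Or.inl (Or.inr hq))

theorem planeRear (hn : 2 ≤ n) (hM : M.AccRel) (F : M.ShipFrame m b k c ε w ρb ρc) :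
    PlaneLife M (M.lifeTimes b) (M.lifeCoord m ε (-w) b) (M.lifeCoord m ε w b)
      (M.velCoord m ε (-w) b) (M.velCoord m ε w b) :=
  hM.planeLife hn F.inertial F.rear_ob F.eps F.unit fun p hp q hq =>
    F.parallel p (Or.inl (Or.inl hp)) q (Or.inl (Or.inl hq))

theorem planeFront (hn : 2 ≤ n) (hM : M.AccRel) (F : M.ShipFrame m b k c ε w ρb ρc) :
    PlaneLife M (M.lifeTimes c) (M.lifeCoord m ε (-w) c) (M.lifeCoord m ε w c)
      (M.velCoord m ε (-w) c) (M.velCoord m ε w c) :=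
  hM.planeLife hn F.inertial F.front_ob F.eps F.unit fun p hp q hq =>
    F.parallel p (Or.inr hp) q (Or.inr hq)

/-- The acceleration of `k` in light coordinates has the direction of the spaceship. -/
theorem acceleration (hn : 2 ≤ n) (hM : M.AccRel) (F : M.ShipFrame m b k c ε w ρb ρc)
    (hacc : M.PositivelyAccelerated k) (hdir : M.DirectionOfAcceleration b k c) {t x : Q}
    (ht : t ∈ M.lifeTimes b) (hx : x ∈ M.lifeTimes c)
    (hneg : (M.lifeCoord m ε (-w) c x - M.lifeCoord m ε (-w) b t) *
      (M.lifeCoord m ε w c x - M.lifeCoord m ε w b t) < 0) {s : Q} (hs : s ∈ M.lifeTimes k) :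
    ∃ a a', (QDeriv (M.velCoord m ε (-w) k) (M.lifeTimes k) s a ∧
        0 < (M.lifeCoord m ε (-w) c x - M.lifeCoord m ε (-w) b t) * a) ∧
      (QDeriv (M.velCoord m ε w k) (M.lifeTimes k) s a' ∧
        0 < (M.lifeCoord m ε w c x - M.lifeCoord m ε w b t) * a') := by
  have hm := F.inertial
  obtain ⟨_, hacc, -⟩ := hacc s ⟨timeVec s, timeVec s, hs, rfl, rfl⟩
  obtain ⟨a, ha, -⟩ := hacc m hm
  set p := M.lifePos m c x with hp
  set q := M.lifePos m b t with hq
  have hwlc : p ∈ M.wl m c := hM.mem_wl_lifePos hm F.front_ob hx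
  have hwlb : q ∈ M.wl m b := hM.mem_wl_lifePos hm F.rear_ob ht
  have hpar := F.parallel p (F.memFront hM hx) q (F.memRear hM ht)
  have hsp : mq (p - q) < 0 := by
    rw [F.mq_eq (F.memFront hM hx) (F.memRear hM ht)]
    exact hneg
  obtain ⟨ha1, -, l, hl, hla⟩ := hdir m hm F.coplanar s a ha p ⟨c, hwlc⟩ q ⟨b, hwlb⟩ hwlc hwlb
    ((spacelike_iff hM.axEOF _).mpr hsp)
  rw [spacelike_iff hM.axEOF] at ha1
  have hlsum : l * ∑ j, w j * a j.succ = ∑ j, w j * (p - q) j.succ := by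
    rw [Finset.mul_sum]
    refine Finset.sum_congr rfl fun j _ => ?_
    rw [← hla]; ring
  have hapar : ∀ i : Fin n, a i.succ = (∑ j, w j * a j.succ) * w i := by
    intro i
    apply mul_left_cancel₀ hl.ne'
    rw [hla, hpar, ← hlsum, mul_assoc]
  have h1 : a 0 ^ 2 < (∑ j, w j * a j.succ) ^ 2 := by
    rw [mq, sum_sq_of_parallel F.unit hapar] at ha1
    linarith
  have h2 : (p - q) 0 ^ 2 < (∑ j, w j * (p - q) j.succ) ^ 2 := by
    rw [mq, sum_sq_of_parallel F.unit hpar] at hsp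
    linarith
  -- Two spacelike vectors of the plane with the same spatial direction lie in the same quadrant of
  -- the light cross, so their light coordinates have equal signs.
  have key := mul_pos_of_dominated F.eps hl hlsum h2 h1
  have hd := ((hM.mem_relAcceleration_iff hn hm F.mid_ob s a).mp ha).2
  refine ⟨lightCoord ε (-w) a, lightCoord ε w a, ⟨QDeriv.lightCoord hd _ _, ?_⟩,
    QDeriv.lightCoord hd _ _, ?_⟩
  · rw [lifeCoord, lifeCoord, ← lightCoord_sub, lightCoord_neg_right, lightCoord_neg_right]
    exact key.1
  · rw [lifeCoord, lifeCoord, ← lightCoord_sub, lightCoord, lightCoord]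
    exact key.2

/-- The rear clock runs slower with respect to each relation between events that is given by a constant
offset of the radar times. -/
theorem runsSlower (hn : 2 ≤ n) (hM : M.AccRel) (F : M.ShipFrame m b k c ε w ρb ρc)
    (hacc : M.PositivelyAccelerated k) (hdir : M.DirectionOfAcceleration b k c)
    (hbc : ∀ e ∈ M.Ev, ¬(b ∈ e ∧ c ∈ e)) {sim : Set B → Set B → Prop} {α : Q}
    (hα : |α| ≤ |ρc - ρb|)
    (hsim : ∀ t ∈ M.lifeTimes b, ∀ x ∈ M.lifeTimes c,
      sim (M.ev m (M.lifePos m b t)) (M.ev m (M.lifePos m c x)) → ∀ s s',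
      RadarPoint (M.lifeTimes k) (M.lifeCoord m ε (-w) k) (M.lifeCoord m ε w k) ρb s
        (M.lifeCoord m ε (-w) b t) (M.lifeCoord m ε w b t) →
      RadarPoint (M.lifeTimes k) (M.lifeCoord m ε (-w) k) (M.lifeCoord m ε w k) ρc s'
        (M.lifeCoord m ε (-w) c x) (M.lifeCoord m ε w c x) → s' = s + α) :
    M.RunsSlower sim b c := by
  intro eb heb eb' heb' ec hec ec' hec' hb hc h1 h2 hne
  have hm := F.inertial
  have Pk := F.planeMid hn hM
  have Pb := F.planeRear hn hM
  have Pc := F.planeFront hn hM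
  obtain ⟨t₁, ht₁, et₁, pt₁⟩ := hM.exists_instant hm F.rear_ob heb hb.1
  obtain ⟨t₂, ht₂, et₂, pt₂⟩ := hM.exists_instant hm F.rear_ob heb' hb.2
  obtain ⟨x₁, hx₁, ex₁, px₁⟩ := hM.exists_instant hm F.front_ob hec hc.1
  obtain ⟨x₂, hx₂, ex₂, px₂⟩ := hM.exists_instant hm F.front_ob hec' hc.2
  obtain ⟨s₁, hs₁⟩ := F.rear t₁ ht₁
  obtain ⟨s₂, hs₂⟩ := F.rear t₂ ht₂
  obtain ⟨y₁, hy₁⟩ := F.front x₁ hx₁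
  obtain ⟨y₂, hy₂⟩ := F.front x₂ hx₂
  have e₁ := hsim t₁ ht₁ x₁ hx₁ (by rwa [pt₁, px₁]) s₁ y₁ hs₁ hy₁
  have e₂ := hsim t₂ ht₂ x₂ hx₂ (by rwa [pt₂, px₂]) s₂ y₂ hs₂ hy₂
  rw [e₁] at hy₁
  rw [e₂] at hy₂
  -- Equal signed distances would force α = 0, and then b and c would meet.
  have hρ : ρb ≠ ρc := by
    intro h
    rw [h, sub_self, abs_zero] at hα
    have hα0 : α = 0 := abs_eq_zero.mp (le_antisymm hα (abs_nonneg _))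
    rw [hα0, add_zero, ← h] at hy₁
    have : M.lifePos m b t₁ = M.lifePos m c x₁ :=
      F.eq_of_lightCoord_eq (F.memRear hM ht₁) (F.memFront hM hx₁)
        (hs₁.2.2.1.trans hy₁.2.2.1.symm) (hs₁.2.2.2.trans hy₁.2.2.2.symm)
    refine hbc eb heb ⟨hb.1, ?_⟩
    rw [← pt₁, this, px₁]
    exact hc.1
  have hinj : ∀ {h : B}, h ∈ M.Ob → (M.lifeTimes h).InjOn (M.lifeCoord m ε (-w) h) →
      ∀ t₁ ∈ M.lifeTimes h, ∀ t₂ ∈ M.lifeTimes h,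
        M.ev h (timeVec t₁) = M.ev h (timeVec t₂) → t₁ = t₂ := by
    intro h hh hi t₁ ht₁ t₂ ht₂ he
    refine hi ht₁ ht₂ ?_
    rw [lifeCoord, lifeCoord, hM.ev_injective hn hm (p := M.lifePos m h t₁) (q := M.lifePos m h t₂)
      (by rw [hM.ev_lifePos hm hh ht₁, hM.ev_lifePos hm hh ht₂, he])]
  have elb := hM.elapsed F.rear_ob (hinj F.rear_ob (Pb.injOnU hM.cont)) ht₁ ht₂
  have elc := hM.elapsed F.front_ob (hinj F.front_ob (Pc.injOnU hM.cont)) hx₁ hx₂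
  rw [et₁, et₂] at elb
  rw [ex₁, ex₂] at elc
  refine ⟨_, _, elb, elc, ?_⟩
  have hU0 : ∀ x ∉ M.lifeTimes k, M.velCoord m ε (-w) k x = 0 := fun x hx => velCoord_of_notMem hx _ _
  have hV0 : ∀ x ∉ M.lifeTimes k, M.velCoord m ε w k x = 0 := fun x hx => velCoord_of_notMem hx _ _
  have hA := fun t ht x hx hneg s hs =>
    F.acceleration (t := t) (x := x) (s := s) hn hM hacc hdir ht hx hneg hs
  rcases lt_trichotomy s₁ s₂ with h | h | h
  · rw [abs_sub_comm t₁, abs_sub_comm x₁]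
    exact Pk.clock_lt_of_ne hM.cont F.pos hU0 hV0 Pb Pc hρ hα hA F.rear F.front ht₁ ht₂ hx₁ hx₂ h
      hs₁ hs₂ hy₁ hy₂
  -- Equal radar times give equal instants of b and of c, so the two pairs of events coincide.
  · exfalso
    apply hne
    rw [← h] at hs₂ hy₂
    have e3 := Pb.injOnU hM.cont ht₁ ht₂ (hs₁.2.2.1.trans hs₂.2.2.1.symm)
    have e4 := Pc.injOnU hM.cont hx₁ hx₂ (hy₁.2.2.1.trans hy₂.2.2.1.symm)
    exact ⟨by rw [← et₁, ← et₂, e3], by rw [← ex₁, ← ex₂, e4]⟩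
  · exact Pk.clock_lt_of_ne hM.cont F.pos hU0 hV0 Pb Pc hρ hα hA F.rear F.front ht₂ ht₁ hx₂ hx₁ h
      hs₂ hs₁ hy₂ hy₁

/-- Photon connected points at which the orientation `η` of time is given. -/
theorem radarTime_sub (hn : 2 ≤ n) (hM : M.AccRel) (F : M.ShipFrame m b k c ε w ρb ρc) {η : Q}
    (hη : η = 1 ∨ η = -1) {p q : Coord n Q} (hp : p ∈ M.wl m b ∪ M.wl m k ∪ M.wl m c)
    (hq : q ∈ M.wl m b ∪ M.wl m k ∪ M.wl m c) (hpq : mq (q - p) = 0)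
    (hle : 0 ≤ η * (q 0 - p 0)) {ρ₁ ρ₂ s₁ s₂ : Q}
    (h₁ : RadarPoint (M.lifeTimes k) (M.lifeCoord m ε (-w) k) (M.lifeCoord m ε w k) ρ₁ s₁
      (lightCoord ε (-w) p) (lightCoord ε w p))
    (h₂ : RadarPoint (M.lifeTimes k) (M.lifeCoord m ε (-w) k) (M.lifeCoord m ε w k) ρ₂ s₂
      (lightCoord ε (-w) q) (lightCoord ε w q)) : s₂ - s₁ = ε * η * |ρ₂ - ρ₁| := by
  have Pk := F.planeMid hn hM
  rw [F.mq_eq hq hp] at hpq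
  have hsum : ∀ r : Coord n Q, lightCoord ε (-w) r + lightCoord ε w r = 2 * (ε * r 0) := by
    intro r; rw [lightCoord_neg_right, lightCoord]; ring
  -- ε η tells whether the precedence order agrees with the direction of the clock of k.
  have hcase : ε * η = 1 ∨ ε * η = -1 := by
    rcases F.eps with rfl | rfl <;> rcases hη with rfl | rfl <;> norm_num
  have hle' : 0 ≤ ε * η * (ε * (q 0 - p 0)) := by
    have hεε : ε * ε = 1 := by rcases F.eps with rfl | rfl <;> norm_num
    calc 0 ≤ η * (q 0 - p 0) := hle
      _ = _ := by linear_combination (-(η * (q 0 - p 0))) * hεε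
  rcases hcase with h | h
  · rw [h, one_mul] at hle' ⊢
    exact Pk.radarTime_sub hM.cont F.pos h₁ h₂ (by linear_combination hpq)
      (by rw [hsum, hsum]; linarith)
  · rw [h] at hle' ⊢
    have := Pk.radarTime_sub hM.cont F.pos h₂ h₁ hpq (by rw [hsum, hsum]; linarith)
    rw [abs_sub_comm]
    linarith

theorem radarPoint_mid {t : Q} (ht : t ∈ M.lifeTimes k) :
    RadarPoint (M.lifeTimes k) (M.lifeCoord m ε (-w) k) (M.lifeCoord m ε w k) 0 t
      (lightCoord ε (-w) (M.lifePos m k t)) (lightCoord ε w (M.lifePos m k t)) := by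
  refine ⟨?_, ?_, ?_, ?_⟩
  · rwa [sub_zero]
  · rwa [add_zero]
  · rw [sub_zero]; rfl
  · rw [add_zero]; rfl

/-- The radar time of an event in the sense of radar simultaneity. -/
theorem radarTime_of_radarAt (hn : 2 ≤ n) (hM : M.AccRel) (F : M.ShipFrame m b k c ε w ρb ρc)
    {p : Coord n Q} (hp : p ∈ M.wl m b ∪ M.wl m k ∪ M.wl m c) {s₀ ρ s : Q}
    (hs₀ : s₀ ∈ M.lifeTimes k) (h : M.RadarAt k (M.ev k (timeVec s₀)) (M.ev m p))
    (hs : RadarPoint (M.lifeTimes k) (M.lifeCoord m ε (-w) k) (M.lifeCoord m ε w k) ρ s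
      (lightCoord ε (-w) p) (lightCoord ε w p)) : s = s₀ := by
  have hm := F.inertial
  have Pk := F.planeMid hn hM
  obtain ⟨f, hf, g, hg, ph, hph, ph', hph', hkf, hkg, h1, h2, h3, X, hX1, hX2⟩ := h
  obtain ⟨x, hx, exk, exm⟩ := hM.exists_instant hm F.mid_ob hf hkf
  obtain ⟨y, hy, eyk, eym⟩ := hM.exists_instant hm F.mid_ob hg hkg
  rcases h3 with h3 | h3
  -- The radar time is the midpoint of the two different photon instants, and so is s₀, being
  -- equally far from both.
  · have hne : x ≠ y := by
      rintro rfl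
      exact h3 (eyk.symm.trans exk)
    rw [← exm] at h1
    rw [← eym] at h2
    have l1 := hM.lightlike_of_photon hm hph h1
    have l2 := hM.lightlike_of_photon hm hph' h2
    rw [F.mq_eq hp (F.memMid hM hx)] at l1
    rw [F.mq_eq hp (F.memMid hM hy)] at l2
    have hmid := Pk.radarTime_eq_mid hM.cont F.pos hs hx hy hne l1 l2
    have d1 := hX1.eq rfl exk
    have d2 := hX2.eq rfl eyk
    rw [d1] at d2
    rcases abs_eq_abs.mp d2 with h4 | h4
    · exact absurd (by linarith) hne
    · linarith
  · have e : p = M.lifePos m k s₀ :=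
      hM.ev_injective hn hm (by rw [h3, hM.ev_lifePos hm F.mid_ob hs₀])
    obtain ⟨m1, m2, e1, e2⟩ := hs
    rw [e] at e1 e2
    have e3 := (Pk.strictMonoU hM.cont F.pos).injOn hs₀ m1 e1
    have e4 := (Pk.strictMonoV hM.cont F.pos).injOn hs₀ m2 e2
    linarith

end ShipFrame

end WorldModel

end Spaceships

/-! ### The four simultaneities as offsets of radar time. -/

theorem mainTheorem11 {n : ℕ} {B : Type u} {Q : Type v} [Field Q] [LinearOrder Q]
    [IsStrictOrderedRing Q] (hn : 3 ≤ n + 1) (M : WorldModel n B Q) (hM : M.AccRel) (b k c : B)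
    (hship : M.RadarSpaceship b k c)
    (hacc : M.PositivelyAccelerated k)
    (hdir : M.DirectionOfAcceleration b k c)
    (hbc : ∀ e ∈ M.Ev, ¬(b ∈ e ∧ c ∈ e)) :
    M.RunsSlower (M.RadarSimul k) b c ∧
      (M.RunsSlower (M.PhotonSimul k) b c ∧ M.RunsSlower (M.PhotonSimul b) b c ∧
        M.RunsSlower (M.PhotonSimul c) b c) := by
  replace hn : 2 ≤ n := by omega
  obtain ⟨m, ε, w, ρb, ρc, F⟩ := hM.exists_shipFrame hn hship
  have hm := F.inertial
  have Pk := F.planeMid hn hM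
  have habs : ∀ η : Q, η = 1 ∨ η = -1 → ∀ x : Q, |ε * η * x| = |x| := by
    intro η hη x
    rcases F.eps with rfl | rfl <;> rcases hη with rfl | rfl <;> simp
  refine ⟨?_, ?_, ?_, ?_⟩
  · refine F.runsSlower hn hM hacc hdir hbc (α := 0) (by rw [abs_zero]; exact abs_nonneg _) ?_
    rintro t ht x hx ⟨e, he, hke, hb, hc⟩ s s' hs hs'
    obtain ⟨s₀, hs₀, es₀, -⟩ := hM.exists_instant hm F.mid_ob he hke
    rw [← es₀] at hb hc
    rw [F.radarTime_of_radarAt hn hM (F.memRear hM ht) hs₀ hb hs,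
      F.radarTime_of_radarAt hn hM (F.memFront hM hx) hs₀ hc hs', add_zero]
  · obtain ⟨η, hη, hor⟩ := hM.exists_precedes_orientation hn hm F.mid_ob
    refine F.runsSlower hn hM hacc hdir hbc (α := ε * η * (|ρb| - |ρc|)) ?_ ?_
    · rw [habs η hη, abs_sub_comm |ρb|]
      exact abs_abs_sub_abs_le ρc ρb
    · rintro t ht x hx ⟨e, he, ph₁, hph₁, ph₂, hph₂, hke, h1, h2, hp1, hp2⟩ s s' hs hs'
      obtain ⟨s₀, hs₀, -, rfl⟩ := hM.exists_instant hm F.mid_ob he hke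
      have l1 := hM.lightlike_of_photon hm hph₁ h1
      have l2 := hM.lightlike_of_photon hm hph₂ h2
      have e1 := F.radarTime_sub hn hM hη (F.memRear hM ht) (F.memMid hM hs₀) l1 (hor _ _ l1 hp1) hs
        (WorldModel.ShipFrame.radarPoint_mid hs₀)
      have e2 := F.radarTime_sub hn hM hη (F.memFront hM hx) (F.memMid hM hs₀) l2 (hor _ _ l2 hp2)
        hs' (WorldModel.ShipFrame.radarPoint_mid hs₀)
      rw [zero_sub, abs_neg] at e1 e2
      linear_combination e1 - e2
  · obtain ⟨η, hη, hor⟩ := hM.exists_precedes_orientation hn hm F.rear_ob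
    refine F.runsSlower hn hM hacc hdir hbc (α := -(ε * η * |ρb - ρc|)) ?_ ?_
    · rw [abs_neg, habs η hη, abs_abs, abs_sub_comm]
    · rintro t ht x hx ⟨e, he, ph₁, hph₁, ph₂, hph₂, hbe, h1, h2, hp1, hp2⟩ s s' hs hs'
      obtain ⟨t₀, ht₀, -, rfl⟩ := hM.exists_instant hm F.rear_ob he hbe
      obtain ⟨s₀, hs₀⟩ := F.rear t₀ ht₀
      have l1 := hM.lightlike_of_photon hm hph₁ h1
      have l2 := hM.lightlike_of_photon hm hph₂ h2
      have e2 := F.radarTime_sub hn hM hη (F.memFront hM hx) (F.memRear hM ht₀) l2 (hor _ _ l2 hp2)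
        hs' hs₀
      rw [F.mq_eq (F.memRear hM ht₀) (F.memRear hM ht)] at l1
      have e1 := Pk.radarPoint_unique hM.cont F.pos hs₀ hs l1
      rw [← e1]
      linear_combination -e2
  · obtain ⟨η, hη, hor⟩ := hM.exists_precedes_orientation hn hm F.front_ob
    refine F.runsSlower hn hM hacc hdir hbc (α := ε * η * |ρc - ρb|) ?_ ?_
    · rw [habs η hη, abs_abs]
    · rintro t ht x hx ⟨e, he, ph₁, hph₁, ph₂, hph₂, hce, h1, h2, hp1, hp2⟩ s s' hs hs'
      obtain ⟨x₀, hx₀, -, rfl⟩ := hM.exists_instant hm F.front_ob he hce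
      obtain ⟨s₀, hs₀⟩ := F.front x₀ hx₀
      have l1 := hM.lightlike_of_photon hm hph₁ h1
      have l2 := hM.lightlike_of_photon hm hph₂ h2
      have e1 := F.radarTime_sub hn hM hη (F.memRear hM ht) (F.memFront hM hx₀) l1 (hor _ _ l1 hp1)
        hs hs₀
      rw [F.mq_eq (F.memFront hM hx₀) (F.memFront hM hx)] at l2
      have e2 := Pk.radarPoint_unique hM.cont F.pos hs₀ hs' l2
      rw [← e2]
      linear_combination e1
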